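/- Let $d\in\{2,3\}$ and let $\Omega\subset\mathbb R^d$ be a bounded polygonal/polyhedral domain with Lipschitz boundary. Let $f\in L^2(\Omega)$, and let $\alpha:\Omega\times[0,\infty)\to[0,\infty)$ be $C^1$ in its second variable with $c_a\le \alpha(x,t^2)+2t^2D_2\alpha(x,t^2)\le C_a$ for all $x\in\Omega$, $t>0$, where $c_a,C_a>0$ are constants. Let $\mathcal T_0$ be a conforming triangulation of $\Omega$ into tagged $d$-simplices, labelled so that it satisfies Stevenson's condition: all elements have the same type, and two neighbouring elements are reflected neighbours if the refinement edge of one of them is contained in both, while otherwise their two children containing the common side are reflected neighbours. Assume that $\alpha(\cdot,t)$ and $t\,D_2\alpha(\cdot,t)$ are Lipschitz with a constant $L$ in each $T\in\mathcal T_0$, uniformly in $t>0$. Let $\mathbb T$ be the set of all conforming triangulations obtained from $\mathcal T_0$ by Stevenson's bisection of tagged simplices, and let $\kappa_{\mathbb T}=\sup_{\mathcal T\in\mathbb T}\sup_{T\in\mathcal T}\operatorname{diam}(T)/\rho_T$, with $\rho_T$ the radius of the largest ball contained in $T$. For $\mathcal T\in\mathbb T$ let $\mathbb V_{\mathcal T}=\{V\in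 H^1_0(\Omega): V|_T\in\mathbb P_1(T)\ \forall T\in\mathcal T\}$. For $V\in\mathbb V_{\mathcal T}$ put $\Gamma_V=\alpha(\cdot,|\nabla V|^2)\nabla V$. The element residual is $R_{\mathcal T}(V)|_T=-\nabla\cdot\Gamma_V-f$ on each $T\in\mathcal T$. The jump residual is $J_{\mathcal T}(V)|_S=\tfrac12\big(\Gamma_V|_{T_1}\cdot\vec n_1+\Gamma_V|_{T_2}\cdot\vec n_2\big)$ on a side $S$ shared by $T_1,T_2\in\mathcal T$ with outward unit normals $\vec n_1,\vec n_2$, and $J_{\mathcal T}(V)|_S=0$ on a side $S\subset\partial\Omega$. With $H_T=|T|^{1/d}$ define $$\eta^2_{\mathcal T}(V;T)=H_T^2\|R_{\mathcal T}(V)\|^2_{L^2(T)}+H_T\|J_{\mathcal T}(V)\|^2_{L^2(\partial T)},$$ $$\operatorname{osc}^2_{\mathcal T}(V;T)=H_T^2\|R_{\mathcal T}(V)-\overline{R_{\mathcal T}(V)}\|^2_{L^2(T)}+H_T\|J_{\mathcal T}(V)-\overline{J_{\mathcal T}(V)}\|^2_{L^2(\partial T)},$$ where the bars denote the mean value on $T$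 and on each side of $T$, respectively. For $\Xi\subset\mathcal T$ let $\eta^2_{\mathcal T}(V;\Xi)=\sum_{T\in\Xi}\eta^2_{\mathcal T}(V;T)$ and $\operatorname{osc}^2_{\mathcal T}(V;\Xi)=\sum_{T\in\Xi}\operatorname{osc}^2_{\mathcal T}(V;T)$, and let $\eta^2_{\mathcal T}(V)=\eta^2_{\mathcal T}(V;\mathcal T)$. Then there is a constant $C_E>1$, depending only on $d$, $\kappa_{\mathbb T}$ and the problem data $(\Omega,\alpha,c_a,C_a,L,f)$, such that the following hold. (i) (Estimator reduction) Let $\mathcal T\in\mathbb T$, $\mathcal M\subset\mathcal T$, $n\ge1$, and let $\mathcal T_*\in\mathbb T$ be obtained from $\mathcal T$ by bisecting each element of $\mathcal M$ at least $n$ times (other elements may be bisected too). Then for all $V\in\mathbb V_{\mathcal T}$, $V_*\in\mathbb V_{\mathcal T_*}$ and $\delta>0$, $$\eta^2_{\mathcal T_*}(V_*)\le(1+\delta)\left\{\eta^2_{\mathcal T}(V)-(1-2^{-n/d})\,\eta^2_{\mathcal T}(V;\mathcal M)\right\}+(1+\delta^{-1})\,C_E\,\|\nabla(V_*-V)\|^2_{L^2(\Omega)}.$$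 (ii) (Oscillation perturbation) Let $\mathcal T\in\mathbb T$ and let $\mathcal T_*\in\mathbb T$ be a refinement of $\mathcal T$. Then for all $V\in\mathbb V_{\mathcal T}$ and $V_*\in\mathbb V_{\mathcal T_*}$, $$\operatorname{osc}^2_{\mathcal T}(V;\mathcal T\cap\mathcal T_*)\le 2\operatorname{osc}^2_{\mathcal T_*}(V_*;\mathcal T\cap\mathcal T_*)+2\,C_E\,\|\nabla(V_*-V)\|^2_{L^2(\Omega)}.$$ -/

import Mathlib

open MeasureTheory Filter Topology Set
open scoped NNReal ENNReal ContDiff RealInnerProductSpace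

noncomputable section

namespace AFEM

/-- Euclidean space `ℝ^d`. -/
abbrev E (d : ℕ) := EuclideanSpace ℝ (Fin d)

/-! ### The domain, the Sobolev space and the coefficient -/

/-- Near every boundary point, `Ω` is, in suitable orthonormal coordinates, the set of points lying
strictly above the graph of a Lipschitz function. -/
def HasLipschitzBoundary {d : ℕ} (Ω : Set (E d)) : Prop :=
  ∀ p ∈ frontier Ω, ∃ (ν : E d) (r : ℝ) (K : ℝ≥0) (g : E d → ℝ),
    ‖ν‖ = 1 ∧ 0 < r ∧ LipschitzWith K g ∧
      ∀ x ∈ Metric.ball p r,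
        (x ∈ Ω ↔ g ((Submodule.span ℝ {ν})ᗮ.starProjection x) < ⟪ν, x⟫)

/-- Bounded domain (nonempty, open, connected) with Lipschitz boundary. -/
structure IsBoundedLipschitzDomain {d : ℕ} (Ω : Set (E d)) : Prop where
  isOpen : IsOpen Ω
  isConnected : IsConnected Ω
  isBounded : Bornology.IsBounded Ω
  lipschitz : HasLipschitzBoundary Ω

/-- `v ∈ H¹₀(Ω)`, the closure of `C_c^∞(Ω)` in `H¹(Ω)`: there are test functions `φ k` converging
to `v` in `L²(Ω)` whose gradients converge in `L²(Ω)` (the limit `g` is the weak gradient). -/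
def MemH10 {d : ℕ} (Ω : Set (E d)) (v : E d → ℝ) : Prop :=
  MemLp v 2 (volume.restrict Ω) ∧
  ∃ g : E d → E d, MemLp g 2 (volume.restrict Ω) ∧
    ∃ φ : ℕ → E d → ℝ,
      (∀ k, ContDiff ℝ ∞ (φ k) ∧ HasCompactSupport (φ k) ∧ tsupport (φ k) ⊆ Ω) ∧
      Tendsto (fun k => eLpNorm (fun x => φ k x - v x) 2 (volume.restrict Ω)) atTop (𝓝 0) ∧
      Tendsto (fun k => eLpNorm (fun x => gradient (φ k) x - g x) 2 (volume.restrict Ω))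
        atTop (𝓝 0)

/-- `α : Ω × [0,∞) → ℝ` is `C¹` in its second variable and
`c_a ≤ α(x,t²) + 2 t² D₂α(x,t²) ≤ C_a` for all `x ∈ Ω`, `t > 0`. -/
def IsAdmissibleCoefficient {d : ℕ} (Ω : Set (E d)) (α : E d → ℝ → ℝ) (c_a C_a : ℝ) : Prop :=
  ∀ x ∈ Ω, ContDiffOn ℝ 1 (α x) (Ici 0) ∧
    ∀ t : ℝ, 0 < t →
      c_a ≤ α x (t ^ 2) + 2 * t ^ 2 * deriv (α x) (t ^ 2) ∧
      α x (t ^ 2) + 2 * t ^ 2 * deriv (α x) (t ^ 2) ≤ C_a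

/-! ### Tagged simplices and bisection -/

/-- A tagged simplex `(x_0, …, x_d)_γ`: an ordered list of vertices together with a type
`γ ∈ {0, …, d-1}`. -/
structure TaggedSimplex (d : ℕ) where
  vtx : Fin (d + 1) → E d
  typ : Fin d

namespace TaggedSimplex

variable {d : ℕ}

instance : DecidableEq (TaggedSimplex d) := Classical.decEq _

/-- The closed simplex as a subset of `ℝ^d`. -/
def body (T : TaggedSimplex d) : Set (E d) := convexHull ℝ (range T.vtx)

/-- The set of vertices of the side opposite to the `i`-th vertex. -/
def sideVtx (T : TaggedSimplex d) (i : Fin (d + 1)) : Set (E d) := T.vtx '' {j | j ≠ i}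

/-- The (closed) side opposite to the `i`-th vertex. -/
def side (T : TaggedSimplex d) (i : Fin (d + 1)) : Set (E d) := convexHull ℝ (T.sideVtx i)

/-- Unit vector orthogonal to the side opposite to the `i`-th vertex, pointing from that vertex
towards the side: the outward unit normal on that side. -/
def normal (T : TaggedSimplex d) (i : Fin (d + 1)) : E d :=
  let v := (vectorSpan ℝ (T.sideVtx i))ᗮ.starProjection (T.vtx (i + 1) - T.vtx i)
  ‖v‖⁻¹ • v

/-- Midpoint of the refinement edge `x_0 x_d`. -/
def mid (T : TaggedSimplex d) : E d := midpoint ℝ (T.vtx 0) (T.vtx (Fin.last d))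

/-- The type `γ + 1 mod d` of the children. -/
def nextTyp (T : TaggedSimplex d) : Fin d := ⟨(T.typ + 1) % d, Nat.mod_lt _ T.typ.pos⟩

/-- First child `(x_0, m, x_1, …, x_{d-1})_{γ+1 mod d}`, with `m` the midpoint of `x_0 x_d`. -/
def child₀ (T : TaggedSimplex d) : TaggedSimplex d where
  vtx i :=
    if i.val = 0 then T.vtx 0
    else if i.val = 1 then T.mid
    else T.vtx ⟨i.val - 1, by omega⟩
  typ := T.nextTyp

/-- Second child `(x_d, m, x_1, …, x_γ, x_{d-1}, …, x_{γ+1})_{γ+1 mod d}`. -/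
def child₁ (T : TaggedSimplex d) : TaggedSimplex d where
  vtx i :=
    if h0 : i.val = 0 then T.vtx (Fin.last d)
    else if h1 : i.val = 1 then T.mid
    else if h2 : i.val ≤ T.typ.val + 1 then T.vtx ⟨i.val - 1, by omega⟩
    else T.vtx ⟨d + 1 + T.typ.val - i.val, by have := T.typ.isLt; omega⟩
  typ := T.nextTyp

/-- `C` is one of the two children of `T`. -/
def IsChild (T C : TaggedSimplex d) : Prop := C = T.child₀ ∨ C = T.child₁

/-- `T_R = (x_d, x_1, …, x_γ, x_{d-1}, …, x_{γ+1}, x_0)_γ`, the tagged simplex which differs from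
`T` only by its ordering and has the same children as `T`. -/
def reflect (T : TaggedSimplex d) : TaggedSimplex d where
  vtx i :=
    if h0 : i.val = 0 then T.vtx (Fin.last d)
    else if h1 : i.val = d then T.vtx 0
    else if h2 : i.val ≤ T.typ.val then T.vtx i
    else T.vtx ⟨d + T.typ.val - i.val, by have := T.typ.isLt; omega⟩
  typ := T.typ

/-- `IsDescendant k T T'`: `T'` arises from `T` by `k` successive bisections. -/
inductive IsDescendant : ℕ → TaggedSimplex d → TaggedSimplex d → Prop
  | refl (T : TaggedSimplex d) : IsDescendant 0 T T
  | step {k : ℕ} {T T' C : TaggedSimplex d} :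
      IsDescendant k T T' → IsChild T' C → IsDescendant (k + 1) T C

/-- Distinct simplices having a common side. -/
def Neighbours (T T' : TaggedSimplex d) : Prop :=
  T ≠ T' ∧ ∃ i j, T.sideVtx i = T'.sideVtx j

/-- Two tagged simplices of the same type are reflected neighbours: they share a side, and the
vertex sequence of `T` or of `T_R` coincides with that of `T'` in all but one position. -/
def ReflectedNeighbours (T T' : TaggedSimplex d) : Prop :=
  Neighbours T T' ∧ T.typ = T'.typ ∧
    ∃ k, (∀ i, i ≠ k → T.vtx i = T'.vtx i) ∨ (∀ i, i ≠ k → T.reflect.vtx i = T'.vtx i)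

/-- Local mesh size `H_T = |T|^{1/d}`. -/
def size (T : TaggedSimplex d) : ℝ := (volume T.body).toReal ^ (1 / (d : ℝ))

/-- Radius of the largest ball contained in `T`. -/
def inradius (T : TaggedSimplex d) : ℝ :=
  sSup {r : ℝ | 0 ≤ r ∧ ∃ x, Metric.closedBall x r ⊆ T.body}

end TaggedSimplex

open TaggedSimplex

/-! ### Triangulations -/

section Mesh

variable {d : ℕ}

/-- A finite collection of (tagged) simplices. -/
abbrev Mesh (d : ℕ) := Finset (TaggedSimplex d)

/-- Two different elements meet exactly in the simplex spanned by their common vertices. -/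
def Conforming (𝒯 : Mesh d) : Prop :=
  ∀ T ∈ 𝒯, ∀ T' ∈ 𝒯, T ≠ T' →
    T.body ∩ T'.body = convexHull ℝ (range T.vtx ∩ range T'.vtx)

/-- Conforming partition of `Ω` into nondegenerate `d`-simplices. -/
structure IsTriangulation (Ω : Set (E d)) (𝒯 : Mesh d) : Prop where
  nondegenerate : ∀ T ∈ 𝒯, AffineIndependent ℝ T.vtx
  covers : (⋃ T ∈ 𝒯, T.body) = closure Ω
  disjoint : ∀ T ∈ 𝒯, ∀ T' ∈ 𝒯, T ≠ T' → Disjoint (interior T.body) (interior T'.body)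
  conforming : Conforming 𝒯

/-- Stevenson's condition on the labelling of the initial mesh: all elements have the same type,
and two neighbours are reflected neighbours if the refinement edge of one of them lies in both,
while otherwise their two children containing the common side are reflected neighbours. -/
def IsAdmissiblyLabelled (𝒯 : Mesh d) : Prop :=
  (∀ T ∈ 𝒯, ∀ T' ∈ 𝒯, T.typ = T'.typ) ∧
  ∀ T ∈ 𝒯, ∀ T' ∈ 𝒯, Neighbours T T' →
    (({T.vtx 0, T.vtx (Fin.last d)} ⊆ range T'.vtx ∨
        {T'.vtx 0, T'.vtx (Fin.last d)} ⊆ range T.vtx) → ReflectedNeighbours T T') ∧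
    (¬ ({T.vtx 0, T.vtx (Fin.last d)} ⊆ range T'.vtx ∨
        {T'.vtx 0, T'.vtx (Fin.last d)} ⊆ range T.vtx) →
      ∃ C C', IsChild T C ∧ IsChild T' C' ∧
        range T.vtx ∩ range T'.vtx ⊆ range C.vtx ∩ range C'.vtx ∧
        ReflectedNeighbours C C')

/-- Admissible initial mesh `𝒯₀` of `Ω`. -/
def IsInitialMesh (Ω : Set (E d)) (𝒯₀ : Mesh d) : Prop :=
  IsTriangulation Ω 𝒯₀ ∧ IsAdmissiblyLabelled 𝒯₀

/-- One bisection: an element of the mesh is replaced by its two children. -/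
inductive BisectStep : Mesh d → Mesh d → Prop
  | mk (𝒯 : Mesh d) (T : TaggedSimplex d) (hT : T ∈ 𝒯) :
      BisectStep 𝒯 (insert T.child₀ (insert T.child₁ (𝒯.erase T)))

/-- `𝒯'` is obtained from `𝒯` by finitely many bisections. -/
def IsRefinement (𝒯 𝒯' : Mesh d) : Prop := Relation.ReflTransGen BisectStep 𝒯 𝒯'

/-- The family `𝕋` of all conforming meshes obtained from `𝒯₀` by bisection. -/
def Family (𝒯₀ : Mesh d) : Set (Mesh d) := {𝒯 | IsRefinement 𝒯₀ 𝒯 ∧ Conforming 𝒯}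

/-- `𝒯'` is obtained from `𝒯` by bisections in which every element of `ℳ` is bisected at least
`n` times, i.e. all elements of `𝒯'` descending from an element of `ℳ` have generation at least
`n` with respect to it. -/
def BisectsAtLeast (n : ℕ) (𝒯 ℳ 𝒯' : Mesh d) : Prop :=
  IsRefinement 𝒯 𝒯' ∧
    ∀ T ∈ ℳ, ∀ T' ∈ 𝒯', ∀ k, IsDescendant k T T' → n ≤ k

/-- The shape regularity constant `κ_𝕋 = sup_{𝒯 ∈ 𝕋} sup_{T ∈ 𝒯} diam(T) / ρ_T`, in `[0,∞]`. -/
def shapeConst (𝒯₀ : Mesh d) : ℝ≥0∞ :=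
  ⨆ 𝒯 ∈ Family 𝒯₀, ⨆ T ∈ 𝒯, ENNReal.ofReal (Metric.diam T.body / T.inradius)

/-- `α(·,t)` and `t D₂α(·,t)` are `L`-Lipschitz in each element of `𝒯₀`, uniformly in `t > 0`
(jumps across the sides of `𝒯₀` are allowed). -/
def IsPiecewiseLipschitz (α : E d → ℝ → ℝ) (𝒯₀ : Mesh d) (L : ℝ≥0) : Prop :=
  ∀ T ∈ 𝒯₀, ∀ t : ℝ, 0 < t →
    LipschitzOnWith L (fun x => α x t) (interior T.body) ∧
    LipschitzOnWith L (fun x => t * deriv (α x) t) (interior T.body)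

/-- The finite element space `𝕍_𝒯 = {V ∈ H¹₀(Ω) : V|_T ∈ ℙ₁(T) for all T ∈ 𝒯}`; the functions are
their continuous representatives. -/
def FESpace (Ω : Set (E d)) (𝒯 : Mesh d) : Set (E d → ℝ) :=
  {V | MemH10 Ω V ∧ ∀ T ∈ 𝒯, ∃ A : E d →ᵃ[ℝ] ℝ, ∀ x ∈ T.body, V x = A x}

/-! ### Residuals, estimator and oscillation -/

/-- `Γ_V(x) = α(x, |∇V(x)|²) ∇V(x)`. -/
def flux (α : E d → ℝ → ℝ) (V : E d → ℝ) (x : E d) : E d :=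
  α x (‖gradient V x‖ ^ 2) • gradient V x

/-- Trace on the boundary of `T` of the restriction of `Γ_V` to (the interior of) `T`. -/
def fluxTrace (α : E d → ℝ → ℝ) (V : E d → ℝ) (T : TaggedSimplex d) : E d → E d :=
  extendFrom (interior T.body) (flux α V)

/-- Divergence of a vector field. -/
def div (G : E d → E d) (x : E d) : ℝ := ∑ i, (fderiv ℝ G x (EuclideanSpace.single i 1)) i

/-- Element residual `R_𝒯(V) = -∇·[α(·,|∇V|²)∇V] - f` in the interior of each element. As `Γ_V` is
Lipschitz there, its divergence exists almost everywhere and is its weak divergence. -/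
def elemRes (α : E d → ℝ → ℝ) (f V : E d → ℝ) (x : E d) : ℝ := - div (flux α V) x - f x

open scoped Classical in
/-- Jump residual `J_𝒯(V)` on the `i`-th side of `T ∈ 𝒯`. The sum has exactly one nonzero summand
`(T', j)` if the side is interior (shared with `T' ∈ 𝒯`), and none if it lies on `∂Ω`. -/
def jumpRes (α : E d → ℝ → ℝ) (𝒯 : Mesh d) (V : E d → ℝ) (T : TaggedSimplex d)
    (i : Fin (d + 1)) (x : E d) : ℝ :=
  ∑ T' ∈ 𝒯.erase T, ∑ j : Fin (d + 1),
    if T'.sideVtx j = T.sideVtx i then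
      (1 / 2) * (⟪fluxTrace α V T x, T.normal i⟫ + ⟪fluxTrace α V T' x, T'.normal j⟫)
    else 0

/-- `η²_𝒯(V;T) = H_T² ‖R_𝒯(V)‖²_T + H_T ‖J_𝒯(V)‖²_{∂T}`. -/
def etaSqLoc (α : E d → ℝ → ℝ) (f : E d → ℝ) (𝒯 : Mesh d) (V : E d → ℝ)
    (T : TaggedSimplex d) : ℝ :=
  T.size ^ 2 * (∫ x in T.body, (elemRes α f V x) ^ 2) +
  T.size * ∑ i, ∫ x in T.side i, (jumpRes α 𝒯 V T i x) ^ 2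
    ∂(Measure.euclideanHausdorffMeasure (d - 1))

/-- `η²_𝒯(V;Ξ)` for a set `Ξ` of elements of `𝒯`. -/
def etaSq (α : E d → ℝ → ℝ) (f : E d → ℝ) (𝒯 : Mesh d) (V : E d → ℝ) (Ξ : Mesh d) : ℝ :=
  ∑ T ∈ Ξ, etaSqLoc α f 𝒯 V T

/-- `osc²_𝒯(V;T) = H_T² ‖R - R̄‖²_T + H_T ‖J - J̄‖²_{∂T}`, with `R̄` the mean value on `T` and `J̄`
the mean value on each side. -/
def oscSqLoc (α : E d → ℝ → ℝ) (f : E d → ℝ) (𝒯 : Mesh d) (V : E d → ℝ)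
    (T : TaggedSimplex d) : ℝ :=
  T.size ^ 2 * (∫ x in T.body, (elemRes α f V x - ⨍ y in T.body, elemRes α f V y) ^ 2) +
  T.size * ∑ i, ∫ x in T.side i,
    (jumpRes α 𝒯 V T i x -
      ⨍ y in T.side i, jumpRes α 𝒯 V T i y ∂(Measure.euclideanHausdorffMeasure (d - 1))) ^ 2
    ∂(Measure.euclideanHausdorffMeasure (d - 1))

/-- `osc²_𝒯(V;Ξ)` for a set `Ξ` of elements of `𝒯`. -/
def oscSq (α : E d → ℝ → ℝ) (f : E d → ℝ) (𝒯 : Mesh d) (V : E d → ℝ) (Ξ : Mesh d) : ℝ :=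
  ∑ T ∈ Ξ, oscSqLoc α f 𝒯 V T

/-- `‖∇v‖²_Ω`. -/
def gradNormSq (Ω : Set (E d)) (v : E d → ℝ) : ℝ := ∫ x in Ω, ‖gradient v x‖ ^ 2

end Mesh

end AFEM

end

open AFEM

/-! Everything is compared on the fine mesh. A discrete function of `𝒯` also belongs to the space
over its refinement `𝒯s`, so the residuals of `V` and `Vs` can be subtracted there. Young's
inequality bounds the estimator of `Vs` by `1 + δ` times that of `V` on the fine mesh plus `1 + δ⁻¹`
times the weighted norm of the residual differences (`resDist`). For the oscillation the same is
done with `δ = 1`, since removing the mean value does not increase an `L²` norm. Three facts remain.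

Perturbation (`sum_resDist_le`). On each element both gradients are constant, say `g` and `g'`. By
the mean value theorem the condition on `α` bounds `α` and `2 t D₂α` by `C_a`, so `g ↦ α(x,|g|²) g`
is Lipschitz with constant `2 C_a`. The same argument for `α(x,·) - α(y,·)` shows that the
difference of the two fluxes is Lipschitz in `x` with constant `3 L |g - g'|`. Hence the divergences
differ by at most `3 d L |g - g'|` almost everywhere (Rademacher), and the jumps by `C_a` times the
sum of the gradient differences on the two adjacent elements. The size of an element is bounded
through the diameter of `Ω`. Shape regularity bounds `H_T |S|` by the volume of either element at
the side `S` (`size_mul_measure_side_le`), so all contributions sum up to the squared energy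
distance.

Reduction (`IsAdapted.etaSq_le_of_bisectsAtLeast`). Each bisection multiplies the size by
`2^(-1/d)`. For a coarse function the squared residuals over the descendants of `T` do not exceed
those over `T`: the bodies overlap in null sets, the old sides are merely cut into pieces, and the
new sides inside `T` carry no jump because the flux has a continuous extension to `T`. So at least
`n` bisections reduce the local estimator by the factor `2^(-n/d)`.

Locality (`IsAdapted.oscSqLoc_eq`). On an element common to both meshes the jump of `V` is the same
with respect to either: by conformity its neighbour across a side in one mesh contains, or is
contained in, the one in the other, and traces do not see this change.

The constant uses `κ` as a real number, so the shape constant must be finite. In two and three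
dimensions a linear change of metric gives the initial simplex the edge lengths of a reference
simplex. Up to scaling, only one (triangle) or three (tetrahedron) patterns of edge lengths then
occur among its descendants. -/

namespace AFEM

/-! ### Convex hulls, affine functions and Hausdorff null sets -/

section Convex

variable {d : ℕ}

/-- The zero set, in a convex hull, of an affine function which is nonnegative on the generators. -/
theorem mem_convexHull_of_affine_eq_zero {A : Set (E d)} (l : E d →ᵃ[ℝ] ℝ)
    (hl : ∀ a ∈ A, 0 ≤ l a) {x : E d} (hx : x ∈ convexHull ℝ A) (hx0 : l x = 0) :
    x ∈ convexHull ℝ {a ∈ A | l a = 0} := by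
  -- The right-hand set is convex: a convex combination of two nonnegative values vanishes only if
  -- each value with positive weight does.
  have key : convexHull ℝ A ⊆ {x | 0 ≤ l x ∧ (l x = 0 → x ∈ convexHull ℝ {a ∈ A | l a = 0})} := by
    refine convexHull_min (fun a ha => ⟨hl a ha, fun h0 => subset_convexHull ℝ _ ⟨ha, h0⟩⟩) ?_
    intro y hy z hz a b ha hb hab
    have e : l (a • y + b • z) = a * l y + b * l z := by
      have := Convex.combo_affine_apply (f := l) (x := y) (y := z) hab
      simpa using this
    refine ⟨by rw [e]; have := hy.1; have := hz.1; positivity, fun h0 => ?_⟩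
    rw [e] at h0
    have h1 : 0 ≤ a * l y := mul_nonneg ha hy.1
    have h2 : 0 ≤ b * l z := mul_nonneg hb hz.1
    have h3 : a * l y = 0 := by linarith
    have h4 : b * l z = 0 := by linarith
    rcases eq_or_ne a 0 with rfl | ha0
    · have : b = 1 := by linarith
      subst this
      simpa using hz.2 (by simpa using h4)
    rcases eq_or_ne b 0 with rfl | hb0
    · have : a = 1 := by linarith
      subst this
      simpa using hy.2 (by simpa using h3)
    exact convex_convexHull ℝ _ (hy.2 (by simpa [ha0] using h3)) (hz.2 (by simpa [hb0] using h4))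
      ha hb hab
  exact (key hx).2 hx0

theorem affine_nonneg_of_mem_convexHull {A : Set (E d)} (l : E d →ᵃ[ℝ] ℝ)
    (hl : ∀ a ∈ A, 0 ≤ l a) {x : E d} (hx : x ∈ convexHull ℝ A) : 0 ≤ l x := by
  have h : Convex ℝ (l ⁻¹' Ici 0) := (convex_Ici (0 : ℝ)).affine_preimage l
  exact convexHull_min (fun a ha => hl a ha) h hx

/-- Isometric parametrization of an affine hull by Euclidean space. -/
theorem exists_isometry_range_eq_affineSpan {A : Set (E d)} (hA : A.Nonempty) {k : ℕ}
    (hk : Module.finrank ℝ (vectorSpan ℝ A) = k) :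
    ∃ φ : E k → E d, Isometry φ ∧ range φ = affineSpan ℝ A := by
  obtain ⟨p, hp⟩ := hA
  let e := (stdOrthonormalBasis ℝ (vectorSpan ℝ A)).repr
  subst hk
  refine ⟨fun z => (e.symm z : E d) + p, ?_, ?_⟩
  · refine Isometry.of_dist_eq fun x y => ?_
    rw [dist_add_right]
    have : dist (e.symm x) (e.symm y) = dist x y := e.symm.dist_map x y
    rw [← this]; rfl
  · ext y
    constructor
    · rintro ⟨z, rfl⟩
      have h1 : (e.symm z : E d) ∈ (affineSpan ℝ A).direction := by
        rw [direction_affineSpan]; exact (e.symm z).2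
      exact AffineSubspace.vadd_mem_of_mem_direction h1 (mem_affineSpan ℝ hp)
    · intro hy
      have h1 : y -ᵥ p ∈ vectorSpan ℝ A := by
        rw [← direction_affineSpan]
        exact AffineSubspace.vsub_mem_direction hy (mem_affineSpan ℝ hp)
      refine ⟨e ⟨y -ᵥ p, h1⟩, ?_⟩
      simp

/-- `k`-dimensional measure of the affine hull of at most `k` points. -/
theorem euclideanHausdorffMeasure_affineSpan_eq_zero {A : Set (E d)} (hA : A.Finite) {k : ℕ}
    (hk : A.ncard ≤ k) :
    (μHE[k] : Measure (E d)) (affineSpan ℝ A) = 0 := by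
  rcases A.eq_empty_or_nonempty with rfl | hne
  · simp
  obtain ⟨φ, hφ, hr⟩ := exists_isometry_range_eq_affineSpan hne rfl
  -- At most `k` points span at most `k - 1` directions, so the isometric copy lives in a Euclidean
  -- space whose `k`-dimensional Hausdorff measure is zero.
  have hlt : Module.finrank ℝ (vectorSpan ℝ A) < k := by
    have : Fintype A := hA.fintype
    have h := finrank_vectorSpan_range_le ℝ (fun x : A => (x : E d)) (n := A.ncard - 1) (by
      have : 0 < A.ncard := (Set.ncard_pos hA).2 hne
      rw [← Nat.card_eq_fintype_card, Nat.card_coe_set_eq]; omega)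
    rw [Subtype.range_coe] at h
    have : 0 < A.ncard := (Set.ncard_pos hA).2 hne
    omega
  rw [← hr, ← image_univ, hφ.euclideanHausdorffMeasure_image, Measure.euclideanHausdorffMeasure_def,
    Measure.smul_apply]
  have h0 : (μH[(k : ℝ)] : Measure (E (Module.finrank ℝ (vectorSpan ℝ A)))) univ = 0 := by
    have := hausdorffMeasure_of_dimH_lt (d := (k : ℝ≥0))
      (s := (univ : Set (E (Module.finrank ℝ (vectorSpan ℝ A))))) (by
        rw [Real.dimH_univ_eq_finrank]; simpa using hlt)
    simpa using this
  exact (congrArg _ h0).trans (smul_zero _)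

theorem euclideanHausdorffMeasure_convexHull_eq_zero {A : Set (E d)} (hA : A.Finite) {k : ℕ}
    (hk : A.ncard ≤ k) :
    (μHE[k] : Measure (E d)) (convexHull ℝ A) = 0 :=
  measure_mono_null (convexHull_subset_affineSpan A)
    (euclideanHausdorffMeasure_affineSpan_eq_zero hA hk)

/-- A `k`-dimensional bounded set has measure at most that of a ball. -/
theorem euclideanHausdorffMeasure_le_of_diam {A S : Set (E d)} (hA : A.Nonempty) {k : ℕ}
    (hk : Module.finrank ℝ (vectorSpan ℝ A) = k) (hS : S ⊆ affineSpan ℝ A) {r : ℝ}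
    (hr : ∀ x ∈ S, ∀ y ∈ S, dist x y ≤ r) :
    (μHE[k] : Measure (E d)) S ≤ ENNReal.ofReal (r ^ k) * volume (Metric.ball (0 : E k) 1) := by
  rcases S.eq_empty_or_nonempty with rfl | ⟨s, hs⟩
  · simp
  obtain ⟨φ, hφ, hrange⟩ := exists_isometry_range_eq_affineSpan hA hk
  have hr0 : 0 ≤ r := by simpa using hr s hs s hs
  obtain ⟨z, hz⟩ : s ∈ range φ := by rw [hrange]; exact hS hs
  have hsub : S ⊆ φ '' Metric.closedBall z r := by
    intro x hx
    obtain ⟨w, hw⟩ : x ∈ range φ := by rw [hrange]; exact hS hx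
    refine ⟨w, ?_, hw⟩
    rw [Metric.mem_closedBall, ← hφ.dist_eq, hw, hz]
    exact hr x hx s hs
  refine (measure_mono hsub).trans ?_
  rw [hφ.euclideanHausdorffMeasure_image, EuclideanSpace.euclideanHausdorffMeasure_eq_volume,
    Measure.addHaar_closedBall _ _ hr0, finrank_euclideanSpace, Fintype.card_fin]

end Convex

/-! ### Simplices -/

namespace TaggedSimplex

variable {d : ℕ} {T : TaggedSimplex d}

/-- The vertices of a nondegenerate simplex as an affine basis. -/
noncomputable def basis (T : TaggedSimplex d) (hT : AffineIndependent ℝ T.vtx) :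
    AffineBasis (Fin (d + 1)) ℝ (E d) :=
  ⟨T.vtx, hT, by rw [hT.affineSpan_eq_top_iff_card_eq_finrank_add_one]; simp⟩

@[simp] theorem coe_basis (hT : AffineIndependent ℝ T.vtx) : ⇑(T.basis hT) = T.vtx := rfl

@[simp] theorem coord_self (hT : AffineIndependent ℝ T.vtx) (i : Fin (d + 1)) :
    (T.basis hT).coord i (T.vtx i) = 1 := (T.basis hT).coord_apply_eq i

theorem coord_ne (hT : AffineIndependent ℝ T.vtx) {i j : Fin (d + 1)} (h : i ≠ j) :
    (T.basis hT).coord i (T.vtx j) = 0 := (T.basis hT).coord_apply_ne h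

theorem mem_body_iff (hT : AffineIndependent ℝ T.vtx) {x : E d} :
    x ∈ T.body ↔ ∀ i, 0 ≤ (T.basis hT).coord i x := by
  have := (T.basis hT).convexHull_eq_nonneg_coord
  rw [coe_basis] at this
  rw [body, this]; rfl

theorem mem_interior_iff (hT : AffineIndependent ℝ T.vtx) {x : E d} :
    x ∈ interior T.body ↔ ∀ i, 0 < (T.basis hT).coord i x := by
  have := (T.basis hT).interior_convexHull
  rw [coe_basis] at this
  rw [body, this]; rfl

theorem convex_body : Convex ℝ T.body := convex_convexHull ℝ (range T.vtx)

theorem isCompact_body : IsCompact T.body := (finite_range T.vtx).isCompact_convexHull ℝ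

theorem isCompact_side (i : Fin (d + 1)) : IsCompact (T.side i) :=
  ((finite_range T.vtx).subset (image_subset_range _ _)).isCompact_convexHull ℝ

theorem measurableSet_body : MeasurableSet T.body := isCompact_body.isClosed.measurableSet

theorem measurableSet_side (i : Fin (d + 1)) : MeasurableSet (T.side i) :=
  (isCompact_side i).isClosed.measurableSet

theorem vtx_mem_body (i : Fin (d + 1)) : T.vtx i ∈ T.body :=
  subset_convexHull ℝ _ (mem_range_self i)

theorem sideVtx_subset (i : Fin (d + 1)) : T.sideVtx i ⊆ range T.vtx := image_subset_range _ _

theorem vtx_mem_sideVtx {i j : Fin (d + 1)} (h : j ≠ i) : T.vtx j ∈ T.sideVtx i :=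
  mem_image_of_mem _ h

theorem sideVtx_subset_side (i : Fin (d + 1)) : T.sideVtx i ⊆ T.side i := subset_convexHull ℝ _

theorem side_subset_body (i : Fin (d + 1)) : T.side i ⊆ T.body :=
  convexHull_mono (sideVtx_subset i)

theorem coord_eq_zero_of_mem_side (hT : AffineIndependent ℝ T.vtx) {i : Fin (d + 1)} {x : E d}
    (hx : x ∈ T.side i) : (T.basis hT).coord i x = 0 := by
  apply le_antisymm
  · have := affine_nonneg_of_mem_convexHull (-(T.basis hT).coord i) (A := T.sideVtx i) (by
      rintro _ ⟨j, hj, rfl⟩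
      simp [coord_ne hT (Ne.symm hj)]) hx
    simpa using this
  · exact (mem_body_iff hT).1 (side_subset_body i hx) i

/-- This turns statements about sides into equations between barycentric coordinates, in which
bisection is explicit. -/
theorem mem_side_iff (hT : AffineIndependent ℝ T.vtx) {i : Fin (d + 1)} {x : E d} :
    x ∈ T.side i ↔ x ∈ T.body ∧ (T.basis hT).coord i x = 0 := by
  refine ⟨fun h => ⟨side_subset_body i h, coord_eq_zero_of_mem_side hT h⟩, fun ⟨h1, h2⟩ => ?_⟩
  refine convexHull_mono ?_ (mem_convexHull_of_affine_eq_zero ((T.basis hT).coord i) ?_ h1 h2)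
  · rintro _ ⟨⟨j, rfl⟩, hj⟩
    refine vtx_mem_sideVtx ?_
    rintro rfl
    simp at hj
  · rintro _ ⟨j, rfl⟩
    exact (mem_body_iff hT).1 (vtx_mem_body j) i

theorem interior_nonempty (hT : AffineIndependent ℝ T.vtx) : (interior T.body).Nonempty := by
  have := (T.basis hT).centroid_mem_interior_convexHull
  rw [coe_basis] at this
  exact ⟨_, this⟩

theorem closure_interior_body (hT : AffineIndependent ℝ T.vtx) :
    closure (interior T.body) = T.body := by
  rw [(convex_body (T := T)).closure_interior_eq_closure_of_nonempty_interior (interior_nonempty hT),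
    isCompact_body.isClosed.closure_eq]

theorem body_ae_eq_interior : (T.body : Set (E d)) =ᵐ[volume] interior T.body := by
  have h : volume (frontier T.body) = 0 := convex_body.addHaar_frontier volume
  exact (interior_ae_eq_of_null_frontier h).symm

theorem volume_body_lt_top : volume T.body < ⊤ := isCompact_body.measure_lt_top

theorem ncard_sideVtx (hT : AffineIndependent ℝ T.vtx) (i : Fin (d + 1)) :
    (T.sideVtx i).ncard = d := by
  rw [sideVtx, ncard_image_of_injective _ hT.injective]
  have : {j | j ≠ i} = ((Finset.univ.erase i : Finset (Fin (d + 1))) : Set (Fin (d + 1))) := by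
    ext; simp
  rw [this, ncard_coe_finset, Finset.card_erase_of_mem (Finset.mem_univ _)]
  simp

theorem finrank_vectorSpan_sideVtx (hd : 0 < d) (hT : AffineIndependent ℝ T.vtx)
    (i : Fin (d + 1)) : Module.finrank ℝ (vectorSpan ℝ (T.sideVtx i)) = d - 1 := by
  have h1 := (hT.comp_embedding (Function.Embedding.subtype (fun j => j ≠ i)))
  have h2 := h1.finrank_vectorSpan (n := d - 1) (by
    rw [Fintype.card_subtype_compl]; simp; omega)
  rw [← h2]
  have : T.sideVtx i = range (T.vtx ∘ Function.Embedding.subtype (fun j => j ≠ i)) := by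
    ext x; simp [sideVtx]
  rw [this]

theorem sideVtx_nonempty (hd : 0 < d) (hT : AffineIndependent ℝ T.vtx) (i : Fin (d + 1)) :
    (T.sideVtx i).Nonempty := by
  apply nonempty_of_ncard_ne_zero; rw [ncard_sideVtx hT]; omega

theorem measure_side_le (hd : 0 < d) (hT : AffineIndependent ℝ T.vtx) (i : Fin (d + 1)) {r : ℝ}
    (hr : ∀ x ∈ T.side i, ∀ y ∈ T.side i, dist x y ≤ r) :
    (μHE[d - 1] : Measure (E d)) (T.side i) ≤
      ENNReal.ofReal (r ^ (d - 1)) * volume (Metric.ball (0 : E (d - 1)) 1) :=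
  euclideanHausdorffMeasure_le_of_diam (sideVtx_nonempty hd hT i)
    (finrank_vectorSpan_sideVtx hd hT i) (convexHull_subset_affineSpan _) hr

theorem measure_side_lt_top (hd : 0 < d) (hT : AffineIndependent ℝ T.vtx) (i : Fin (d + 1)) :
    (μHE[d - 1] : Measure (E d)) (T.side i) < ⊤ := by
  refine (measure_side_le hd hT i (r := Metric.diam (T.side i)) fun x hx y hy =>
    Metric.dist_le_diam_of_mem (isCompact_side i).isBounded hx hy).trans_lt ?_
  exact ENNReal.mul_lt_top ENNReal.ofReal_lt_top measure_ball_lt_top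

/-- The intersection lies in the hull of the remaining `d - 1` vertices, which is too small for the
`(d - 1)`-dimensional measure. -/
theorem measure_side_inter_side (hT : AffineIndependent ℝ T.vtx)
    {i j : Fin (d + 1)} (hij : i ≠ j) :
    (μHE[d - 1] : Measure (E d)) (T.side i ∩ T.side j) = 0 := by
  have hfin : {a ∈ T.sideVtx i | (T.basis hT).coord j a = 0}.Finite :=
    ((finite_range T.vtx).subset (sideVtx_subset i)).subset (sep_subset _ _)
  refine measure_mono_null (t := convexHull ℝ {a ∈ T.sideVtx i | (T.basis hT).coord j a = 0}) ?_
    (euclideanHausdorffMeasure_convexHull_eq_zero hfin ?_)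
  · rintro x ⟨hx, hx'⟩
    refine mem_convexHull_of_affine_eq_zero _ (fun a ha => ?_) hx (coord_eq_zero_of_mem_side hT hx')
    obtain ⟨k, rfl⟩ := sideVtx_subset i ha
    exact (mem_body_iff hT).1 (vtx_mem_body k) j
  · have : {a ∈ T.sideVtx i | (T.basis hT).coord j a = 0} ⊆ T.sideVtx i \ {T.vtx j} := by
      rintro a ⟨ha, h0⟩
      refine ⟨ha, ?_⟩
      rintro rfl
      simp at h0
    have hf2 : (T.sideVtx i).Finite := (finite_range T.vtx).subset (sideVtx_subset i)
    refine (ncard_le_ncard this (hf2.subset sdiff_subset)).trans ?_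
    rw [ncard_sdiff_singleton_of_mem (vtx_mem_sideVtx hij.symm), ncard_sideVtx hT]

/-! ### Bisection of a simplex -/

/-- The affine map which moves the `a`-th vertex to the midpoint of the `a`-th and `b`-th vertex
and fixes the other vertices. -/
noncomputable def bend (T : TaggedSimplex d) (hT : AffineIndependent ℝ T.vtx)
    (a b : Fin (d + 1)) : E d →ᵃ[ℝ] E d :=
  AffineMap.id ℝ (E d) +
    (LinearMap.toSpanSingleton ℝ (E d) ((1 / 2 : ℝ) • (T.vtx b - T.vtx a))).toAffineMap.comp
      ((T.basis hT).coord a)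

theorem bend_apply (hT : AffineIndependent ℝ T.vtx) (a b : Fin (d + 1)) (x : E d) :
    T.bend hT a b x =
      x + (T.basis hT).coord a x • ((1 / 2 : ℝ) • (T.vtx b - T.vtx a)) := by
  simp [bend]

theorem bend_linear (hT : AffineIndependent ℝ T.vtx) (a b : Fin (d + 1)) :
    (T.bend hT a b).linear = LinearMap.transvection ((T.basis hT).coord a).linear
      ((1 / 2 : ℝ) • (T.vtx b - T.vtx a)) := by
  ext1 x
  simp only [bend, AffineMap.add_linear, AffineMap.comp_linear, LinearMap.toAffineMap_linear,
    AffineMap.id_linear, LinearMap.transvection.apply, LinearMap.add_apply, LinearMap.comp_apply,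
    LinearMap.id_apply, LinearMap.toSpanSingleton_apply]

theorem coord_linear_sub (hT : AffineIndependent ℝ T.vtx) (a : Fin (d + 1)) (x y : E d) :
    ((T.basis hT).coord a).linear (x - y) =
      (T.basis hT).coord a x - (T.basis hT).coord a y :=
  AffineMap.linearMap_vsub _ x y

theorem coord_smul_sub_add (hT : AffineIndependent ℝ T.vtx) (j : Fin (d + 1)) (t : ℝ)
    (x y z : E d) : (T.basis hT).coord j (t • (y - z) + x) =
      (T.basis hT).coord j x +
        t * ((T.basis hT).coord j y - (T.basis hT).coord j z) := by
  change (T.basis hT).coord j (t • (y - z) +ᵥ x) = _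
  rw [AffineMap.map_vadd, map_smul, coord_linear_sub]
  simp only [smul_eq_mul, vadd_eq_add]
  ring

/-- The linear part is a transvection. Its functional takes the value `-1/2` on its vector, because
the coordinate of `a` drops by one from `a` to `b`. -/
theorem det_bend (hT : AffineIndependent ℝ T.vtx) {a b : Fin (d + 1)} (hab : a ≠ b) :
    LinearMap.det (T.bend hT a b).linear = 1 / 2 := by
  rw [bend_linear, LinearMap.transvection.det, map_smul, coord_linear_sub, coord_ne hT hab,
    coord_self]
  norm_num

theorem bend_injective (hT : AffineIndependent ℝ T.vtx) {a b : Fin (d + 1)} (hab : a ≠ b) :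
    Function.Injective (T.bend hT a b) := by
  rw [← AffineMap.linear_injective_iff]
  have h : LinearMap.det (T.bend hT a b).linear ≠ 0 := by rw [det_bend hT hab]; norm_num
  exact (LinearMap.equivOfDetNeZero _ h).injective

theorem bend_vtx_self (hT : AffineIndependent ℝ T.vtx) (a b : Fin (d + 1)) :
    T.bend hT a b (T.vtx a) = midpoint ℝ (T.vtx a) (T.vtx b) := by
  rw [bend_apply, coord_self, midpoint_eq_smul_add, invOf_eq_inv]
  module

theorem bend_vtx_of_ne (hT : AffineIndependent ℝ T.vtx) {a b j : Fin (d + 1)} (h : a ≠ j) :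
    T.bend hT a b (T.vtx j) = T.vtx j := by
  rw [bend_apply, coord_ne hT h]; simp

theorem coord_bend (hT : AffineIndependent ℝ T.vtx) (a b j : Fin (d + 1)) (x : E d) :
    (T.basis hT).coord j (T.bend hT a b x) = (T.basis hT).coord j x +
      (T.basis hT).coord a x * (1 / 2 *
        ((T.basis hT).coord j (T.vtx b) - (T.basis hT).coord j (T.vtx a))) := by
  rw [bend_apply, add_comm x, smul_smul, coord_smul_sub_add]
  ring

theorem coord_bend_self (hT : AffineIndependent ℝ T.vtx) {a b : Fin (d + 1)} (hab : a ≠ b)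
    (x : E d) : (T.basis hT).coord a (T.bend hT a b x) = 1 / 2 * (T.basis hT).coord a x := by
  rw [coord_bend, coord_self, coord_ne hT hab]; ring

theorem coord_bend_other (hT : AffineIndependent ℝ T.vtx) {a b : Fin (d + 1)} (hab : a ≠ b)
    (x : E d) : (T.basis hT).coord b (T.bend hT a b x) =
      (T.basis hT).coord b x + 1 / 2 * (T.basis hT).coord a x := by
  rw [coord_bend, coord_self, coord_ne hT hab.symm]; ring

theorem coord_bend_of_ne (hT : AffineIndependent ℝ T.vtx) {a b j : Fin (d + 1)} (ha : j ≠ a)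
    (hb : j ≠ b) (x : E d) :
    (T.basis hT).coord j (T.bend hT a b x) = (T.basis hT).coord j x := by
  rw [coord_bend, coord_ne hT ha, coord_ne hT hb]; ring

/-- In barycentric coordinates the map sends `λ_a` to `λ_a / 2` and `λ_b` to `λ_b + λ_a / 2`, and
keeps the others. Solving for the preimage, the only new sign condition is that on the difference
`λ_b - λ_a`. -/
theorem bend_image_body (hT : AffineIndependent ℝ T.vtx) {a b : Fin (d + 1)} (hab : a ≠ b) :
    T.bend hT a b '' T.body =
      {x ∈ T.body | (T.basis hT).coord a x ≤ (T.basis hT).coord b x} := by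
  ext x
  constructor
  · rintro ⟨y, hy, rfl⟩
    rw [mem_body_iff hT] at hy
    refine ⟨(mem_body_iff hT).2 fun j => ?_, ?_⟩
    · by_cases ha : j = a
      · subst ha; rw [coord_bend_self hT hab]; have := hy j; positivity
      by_cases hb : j = b
      · subst hb; rw [coord_bend_other hT hab]; have := hy j; have := hy a; positivity
      rw [coord_bend_of_ne hT ha hb]; exact hy j
    · rw [coord_bend_self hT hab, coord_bend_other hT hab]
      have := hy b
      linarith
  · rintro ⟨hx, hle⟩
    have h : LinearMap.det (T.bend hT a b).linear ≠ 0 := by rw [det_bend hT hab]; norm_num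
    have hs : Function.Surjective (T.bend hT a b) := by
      rw [← AffineMap.linear_surjective_iff]
      exact (LinearMap.equivOfDetNeZero _ h).surjective
    obtain ⟨y, rfl⟩ := hs x
    refine ⟨y, (mem_body_iff hT).2 fun j => ?_, rfl⟩
    rw [mem_body_iff hT] at hx
    rw [coord_bend_self hT hab, coord_bend_other hT hab] at hle
    have hxj := hx j
    by_cases ha : j = a
    · subst ha; rw [coord_bend_self hT hab] at hxj; linarith
    by_cases hb : j = b
    · subst hb; linarith
    rwa [coord_bend_of_ne hT ha hb] at hxj

theorem bend_image_side_subset (hT : AffineIndependent ℝ T.vtx) {a b k : Fin (d + 1)}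
    (hab : a ≠ b) (hb : k ≠ b) : T.bend hT a b '' T.side k ⊆ T.side k := by
  rintro _ ⟨y, hy, rfl⟩
  have h1 : T.bend hT a b y ∈ T.bend hT a b '' T.body := ⟨y, side_subset_body k hy, rfl⟩
  rw [bend_image_body hT hab] at h1
  refine (mem_side_iff hT).2 ⟨h1.1, ?_⟩
  have h0 := coord_eq_zero_of_mem_side hT hy
  by_cases ha : k = a
  · subst ha; rw [coord_bend_self hT hab, h0]; simp
  rw [coord_bend_of_ne hT ha hb, h0]

/-- This is the side created by the bisection, which both halves share. -/
theorem bend_image_side_other (hT : AffineIndependent ℝ T.vtx) {a b : Fin (d + 1)} (hab : a ≠ b) :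
    T.bend hT a b '' T.side b =
      {x ∈ T.body | (T.basis hT).coord a x = (T.basis hT).coord b x} := by
  ext x
  constructor
  · rintro ⟨y, hy, rfl⟩
    have h1 : T.bend hT a b y ∈ T.bend hT a b '' T.body := ⟨y, side_subset_body b hy, rfl⟩
    rw [bend_image_body hT hab] at h1
    refine ⟨h1.1, ?_⟩
    rw [coord_bend_self hT hab, coord_bend_other hT hab, coord_eq_zero_of_mem_side hT hy, zero_add]
  · rintro ⟨hx, h0⟩
    have h1 : x ∈ T.bend hT a b '' T.body := by
      rw [bend_image_body hT hab]; exact ⟨hx, h0.le⟩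
    obtain ⟨y, hy, rfl⟩ := h1
    refine ⟨y, (mem_side_iff hT).2 ⟨hy, ?_⟩, rfl⟩
    rw [coord_bend_self hT hab, coord_bend_other hT hab] at h0
    linarith

/-- `C` is, up to the ordering of its vertices, the half of `T` which arises when the `a`-th vertex
is moved to the midpoint of the `a`-th and `b`-th vertex. -/
def IsHalf (T : TaggedSimplex d) (hT : AffineIndependent ℝ T.vtx) (a b : Fin (d + 1))
    (C : TaggedSimplex d) : Prop :=
  ∃ σ : Equiv.Perm (Fin (d + 1)), C.vtx = T.bend hT a b ∘ T.vtx ∘ σ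

section IsHalf

variable {hT : AffineIndependent ℝ T.vtx} {a b : Fin (d + 1)} {C : TaggedSimplex d}

theorem IsHalf.affineIndependent (h : T.IsHalf hT a b C) (hab : a ≠ b) :
    AffineIndependent ℝ C.vtx := by
  obtain ⟨σ, hσ⟩ := h
  rw [hσ]
  exact (hT.comp_embedding σ.toEmbedding).map' _ (bend_injective hT hab)

theorem IsHalf.body_eq (h : T.IsHalf hT a b C) : C.body = T.bend hT a b '' T.body := by
  obtain ⟨σ, hσ⟩ := h
  rw [body, body, AffineMap.image_convexHull, hσ, range_comp, range_comp, σ.surjective.range_eq,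
    image_univ]

theorem IsHalf.volume_body (h : T.IsHalf hT a b C) (hab : a ≠ b) :
    volume C.body = 2⁻¹ * volume T.body := by
  have e : (T.bend hT a b : E d → E d) =
      (fun x => x + T.bend hT a b 0) ∘ (T.bend hT a b).linear := by
    ext1 x
    have := (T.bend hT a b).map_vadd 0 x
    simpa using this
  rw [h.body_eq, e, image_comp, image_add_right, measure_preimage_add_right,
    Measure.addHaar_image_linearMap, det_bend hT hab]
  congr 1
  rw [abs_of_pos (by norm_num), one_div, ENNReal.ofReal_inv_of_pos (by norm_num)]
  simp

/-- Halving the volume is the source of the factor `2^(-n/d)` in the estimator reduction. -/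
theorem IsHalf.size_eq (h : T.IsHalf hT a b C) (hab : a ≠ b) :
    C.size = (2 : ℝ) ^ (-(1 : ℝ) / d) * T.size := by
  rw [size, size, h.volume_body hab, ENNReal.toReal_mul, Real.mul_rpow (by simp) (by simp)]
  congr 1
  rw [ENNReal.toReal_inv, ENNReal.toReal_ofNat, Real.inv_rpow (by norm_num), ← Real.rpow_neg
    (by norm_num)]
  congr 1; ring

theorem IsHalf.exists_perm (h : T.IsHalf hT a b C) :
    ∃ σ : Equiv.Perm (Fin (d + 1)), (∀ i, C.vtx i = T.bend hT a b (T.vtx (σ i))) ∧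
      ∀ i, C.side i = T.bend hT a b '' T.side (σ i) := by
  obtain ⟨σ, hσ⟩ := h
  refine ⟨σ, fun i => congrFun hσ i, fun i => ?_⟩
  rw [side, side, AffineMap.image_convexHull, sideVtx, sideVtx, hσ, image_comp, image_comp]
  congr 3
  ext j
  constructor
  · rintro ⟨k, hk, rfl⟩
    exact fun e => hk (σ.injective e)
  · intro hj
    refine ⟨σ.symm j, fun e => hj ?_, by simp⟩
    rw [← e]; simp

theorem IsHalf.sum_side {M : Type*} [AddCommMonoid M] (h : T.IsHalf hT a b C)
    (ν : Set (E d) → M) :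
    ∑ i, ν (C.side i) = ∑ i, ν (T.bend hT a b '' T.side i) := by
  obtain ⟨σ, -, hσ⟩ := h.exists_perm
  simp_rw [hσ]
  exact Equiv.sum_comp σ fun i => ν (T.bend hT a b '' T.side i)

end IsHalf

/-- On the overlap the coordinates of `a` and `b` agree. A small move in direction `x_a - x_b` would
stay in an open overlap but separates them. -/
theorem IsHalf.disjoint_interior {hT : AffineIndependent ℝ T.vtx} {a b : Fin (d + 1)}
    {C C' : TaggedSimplex d} (h : T.IsHalf hT a b C) (h' : T.IsHalf hT b a C') (hab : a ≠ b) :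
    Disjoint (interior C.body) (interior C'.body) := by
  rw [Set.disjoint_iff]
  rintro x ⟨hx, hx'⟩
  have hU : interior C.body ∩ interior C'.body ∈ 𝓝 x :=
    (isOpen_interior.inter isOpen_interior).mem_nhds ⟨hx, hx'⟩
  have hc : Tendsto (fun t : ℝ => t • (T.vtx a - T.vtx b) + x) (𝓝 0) (𝓝 x) := by
    have : Continuous (fun t : ℝ => t • (T.vtx a - T.vtx b) + x) := by fun_prop
    simpa using this.tendsto 0
  have h1 : ∀ᶠ t : ℝ in 𝓝[>] 0, t • (T.vtx a - T.vtx b) + x ∈ interior C.body ∩ interior C'.body :=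
    (hc.eventually hU).filter_mono nhdsWithin_le_nhds
  obtain ⟨t, ht, ht0⟩ := (h1.and self_mem_nhdsWithin).exists
  have key : ∀ y ∈ interior C.body ∩ interior C'.body,
      (T.basis hT).coord a y = (T.basis hT).coord b y := by
    rintro y ⟨hy, hy'⟩
    have h1 := interior_subset hy
    have h2 := interior_subset hy'
    rw [h.body_eq, bend_image_body hT hab] at h1
    rw [h'.body_eq, bend_image_body hT hab.symm] at h2
    exact le_antisymm h1.2 h2.2
  have e1 := key x ⟨hx, hx'⟩
  have e2 := key _ ht
  rw [coord_smul_sub_add, coord_smul_sub_add, coord_self, coord_self, coord_ne hT hab, coord_ne hT hab.symm, e1] at e2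
  simp at e2 ht0
  linarith

theorem IsHalf.body_union {hT : AffineIndependent ℝ T.vtx} {a b : Fin (d + 1)}
    {C C' : TaggedSimplex d} (h : T.IsHalf hT a b C) (h' : T.IsHalf hT b a C') (hab : a ≠ b) :
    C.body ∪ C'.body = T.body := by
  rw [h.body_eq, h'.body_eq, bend_image_body hT hab, bend_image_body hT hab.symm]
  ext x
  have := le_total ((T.basis hT).coord a x) ((T.basis hT).coord b x)
  simp only [mem_union, mem_ofPred_eq]
  tauto

/-- The side measures of the two halves add up to at most the side measures of the simplex, if the
new side is negligible. -/
theorem IsHalf.sum_measure_side_le {hT : AffineIndependent ℝ T.vtx}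
    {a b : Fin (d + 1)} {C C' : TaggedSimplex d} (h : T.IsHalf hT a b C) (h' : T.IsHalf hT b a C')
    (hab : a ≠ b) (ν : Measure (E d)) (hν : ν ≪ μHE[d - 1])
    (hnew : ν {x ∈ T.body | (T.basis hT).coord a x = (T.basis hT).coord b x} = 0) :
    ∑ i, ν (C.side i) + ∑ i, ν (C'.side i) ≤ ∑ i, ν (T.side i) := by
  rw [h.sum_side, h'.sum_side, ← Finset.sum_add_distrib]
  refine Finset.sum_le_sum fun k _ => ?_
  -- Side `b` becomes the new, negligible side of the first half and can be kept only by the second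
  -- one; side `a` behaves in the mirrored way. Every other side is cut into two pieces.
  by_cases hb : k = b
  · subst hb
    rw [bend_image_side_other hT hab, hnew, zero_add]
    exact measure_mono (bend_image_side_subset hT hab.symm hab.symm)
  by_cases ha : k = a
  · subst ha
    have hnew' : ν {x ∈ T.body | (T.basis hT).coord b x = (T.basis hT).coord k x} = 0 := by
      rw [← hnew]; congr 1; ext x; simp [eq_comm]
    rw [bend_image_side_other hT hab.symm, hnew', add_zero]
    exact measure_mono (bend_image_side_subset hT hab hab)
  have hmeas : MeasurableSet (T.bend hT b a '' T.side k) :=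
    ((isCompact_side k).image (T.bend hT b a).continuous_of_finiteDimensional).measurableSet
  -- The two pieces meet only in the new side, hence in the intersection of two different sides of
  -- `C`.
  have hdis : AEDisjoint ν (T.bend hT a b '' T.side k) (T.bend hT b a '' T.side k) := by
    apply hν
    obtain ⟨σ, -, hσ⟩ := h.exists_perm
    have hne : σ.symm k ≠ σ.symm b := fun e => hb (σ.symm.injective e)
    refine measure_mono_null ?_ (measure_side_inter_side (h.affineIndependent hab) hne)
    rw [hσ, hσ, Equiv.apply_symm_apply, Equiv.apply_symm_apply]
    rintro x ⟨h1, h2⟩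
    refine ⟨h1, ?_⟩
    rw [bend_image_side_other hT hab]
    have g1 := image_mono (f := T.bend hT a b) (side_subset_body k) h1
    have g2 := image_mono (f := T.bend hT b a) (side_subset_body k) h2
    rw [bend_image_body hT hab] at g1
    rw [bend_image_body hT hab.symm] at g2
    exact ⟨g1.1, le_antisymm g1.2 g2.2⟩
  rw [← measure_union₀ hmeas.nullMeasurableSet hdis]
  exact measure_mono (union_subset (bend_image_side_subset hT hab hb)
    (bend_image_side_subset hT hab.symm ha))

/-- The new side of a bisected simplex contained in `R` meets the sides of `R` in null sets. -/
theorem IsHalf.measure_new_inter_side {hT : AffineIndependent ℝ T.vtx} {a b : Fin (d + 1)}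
    {C R : TaggedSimplex d} (h : T.IsHalf hT a b C) (hab : a ≠ b)
    (hR : AffineIndependent ℝ R.vtx) (hTR : T.body ⊆ R.body) (i : Fin (d + 1)) :
    (μHE[d - 1] : Measure (E d))
      ({x ∈ T.body | (T.basis hT).coord a x = (T.basis hT).coord b x} ∩ R.side i) = 0 := by
  set l := (R.basis hR).coord i
  obtain ⟨σ, hvtx, hσ⟩ := h.exists_perm
  have hC := h.affineIndependent hab
  have hl : ∀ x ∈ T.body, 0 ≤ l x := fun x hx => (mem_body_iff hR).1 (hTR hx) i
  have hCT : C.body ⊆ T.body := by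
    rw [h.body_eq, bend_image_body hT hab]; exact sep_subset _ _
  obtain ⟨j, hj⟩ : ∃ j, σ j = b := σ.surjective b
  rw [← bend_image_side_other hT hab]
  have hside := hσ j
  rw [hj] at hside
  rw [← hside]
  have hfin : (C.sideVtx j).Finite := (finite_range C.vtx).subset (sideVtx_subset j)
  -- Otherwise `l`, nonnegative at both ends of the bisected edge and zero at its midpoint, would
  -- vanish at all vertices of `T`. But `T` has interior points, where `l` is positive.
  have hpos : ∃ v ∈ C.sideVtx j, l v ≠ 0 := by
    by_contra! hall
    have h1 : ∀ k, k ≠ b → l (T.bend hT a b (T.vtx k)) = 0 := by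
      intro k hk
      have := hall _ (vtx_mem_sideVtx (T := C) (i := j) (j := σ.symm k)
        (fun e => hk (by rw [← hj, ← e, Equiv.apply_symm_apply])))
      rwa [hvtx, Equiv.apply_symm_apply] at this
    have h2 : ∀ k, l (T.vtx k) = 0 := by
      have hm := h1 a hab
      rw [bend_vtx_self, AffineMap.map_midpoint, midpoint_eq_smul_add] at hm
      have ha := hl _ (vtx_mem_body a)
      have hb := hl _ (vtx_mem_body b)
      simp at hm
      intro k
      by_cases hka : k = a
      · subst hka; linarith
      by_cases hkb : k = b
      · subst hkb; linarith
      have := h1 k hkb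
      rwa [bend_vtx_of_ne hT (Ne.symm hka)] at this
    obtain ⟨x, hx⟩ := interior_nonempty hT
    have h3 : 0 < l x := (mem_interior_iff hR).1 (interior_mono hTR hx) i
    have h4 := affine_nonneg_of_mem_convexHull (-l) (A := range T.vtx) (by
      rintro _ ⟨k, rfl⟩; simp [h2 k]) (interior_subset hx)
    simp at h4
    linarith
  obtain ⟨v, hv, hv0⟩ := hpos
  refine measure_mono_null (t := convexHull ℝ {v ∈ C.sideVtx j | l v = 0}) ?_
    (euclideanHausdorffMeasure_convexHull_eq_zero (hfin.subset (sep_subset _ _)) ?_)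
  · rintro x ⟨hx, hx'⟩
    exact mem_convexHull_of_affine_eq_zero l
      (fun y hy => hl y (hCT (side_subset_body j (sideVtx_subset_side j hy)))) hx
      (coord_eq_zero_of_mem_side hR hx')
  · have : {v ∈ C.sideVtx j | l v = 0} ⊆ C.sideVtx j \ {v} := by
      rintro w ⟨hw, h0⟩
      refine ⟨hw, ?_⟩
      rintro rfl
      exact hv0 h0
    refine (ncard_le_ncard this (hfin.subset sdiff_subset)).trans ?_
    rw [ncard_sdiff_singleton_of_mem hv, ncard_sideVtx hC]

/-- A type in `Fin d` exists only if `d` is positive, which also makes the refinement edge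
nondegenerate. -/
theorem zero_ne_last (T : TaggedSimplex d) : (0 : Fin (d + 1)) ≠ Fin.last d := by
  have := T.typ.pos
  intro h
  have := congrArg Fin.val h
  simp at this
  omega

/-- A family with the same range as an injective family on the same finite index set is a
rearrangement of it. -/
theorem exists_perm_of_range_eq {n : ℕ} {X : Type*} {f g : Fin n → X}
    (hg : Function.Injective g) (h : range g ⊆ range f) :
    ∃ σ : Equiv.Perm (Fin n), f = g ∘ σ := by
  have h1 : ∀ i, ∃ j, f j = g i := fun i => h (mem_range_self i)
  choose τ hτ using h1
  have hinj : Function.Injective τ := fun i j e => hg (by rw [← hτ, ← hτ, e])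
  let e := Equiv.ofBijective τ (Finite.injective_iff_bijective.1 hinj)
  refine ⟨e.symm, funext fun i => ?_⟩
  have : e (e.symm i) = i := e.apply_symm_apply i
  conv_lhs => rw [← this]
  exact hτ _

theorem isHalf_child₀ (hT : AffineIndependent ℝ T.vtx) :
    T.IsHalf hT (Fin.last d) 0 T.child₀ := by
  have hd := T.typ.pos
  refine exists_perm_of_range_eq (((bend_injective hT T.zero_ne_last.symm)).comp hT.injective) ?_
  rintro _ ⟨i, rfl⟩
  rw [Function.comp_apply]
  by_cases hi : i = Fin.last d
  · subst hi
    rw [bend_vtx_self]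
    refine ⟨⟨1, by omega⟩, ?_⟩
    simp [child₀, mid, midpoint_comm]
  rw [bend_vtx_of_ne hT (Ne.symm hi)]
  have hlt : i.val < d := by
    have := i.isLt; have : i.val ≠ d := fun e => hi (Fin.ext e); omega
  by_cases h0 : i.val = 0
  · refine ⟨0, ?_⟩
    have : i = 0 := Fin.ext h0
    simp [child₀, this]
  · refine ⟨⟨i.val + 1, by omega⟩, ?_⟩
    simp [child₀, h0]

theorem isHalf_child₁ (hT : AffineIndependent ℝ T.vtx) :
    T.IsHalf hT 0 (Fin.last d) T.child₁ := by
  have hd := T.typ.pos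
  have ht := T.typ.isLt
  refine exists_perm_of_range_eq (((bend_injective hT T.zero_ne_last)).comp hT.injective) ?_
  rintro _ ⟨i, rfl⟩
  rw [Function.comp_apply]
  by_cases hi : i = 0
  · subst hi
    rw [bend_vtx_self]
    refine ⟨⟨1, by omega⟩, ?_⟩
    simp [child₁, mid]
  rw [bend_vtx_of_ne hT (Ne.symm hi)]
  have h0 : i.val ≠ 0 := fun e => hi (Fin.ext e)
  have hlt := i.isLt
  by_cases hl : i.val = d
  · refine ⟨0, ?_⟩
    have : i = Fin.last d := Fin.ext hl
    simp [child₁, this]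
  by_cases h2 : i.val ≤ T.typ.val
  · refine ⟨⟨i.val + 1, by omega⟩, ?_⟩
    simp [child₁, h0, h2]
  -- The second child lists the vertices after `x_γ` in reversed order; the index reversal is its
  -- own inverse.
  · refine ⟨⟨d + 1 + T.typ.val - i.val, by omega⟩, ?_⟩
    have e1 : ¬ (d + 1 + T.typ.val - i.val = 0) := by omega
    have e2 : ¬ (d + 1 + T.typ.val - i.val = 1) := by omega
    have e3 : ¬ (d + 1 + T.typ.val - i.val ≤ T.typ.val + 1) := by omega
    simp only [child₁, e1, e2, e3, dite_false]
    congr 1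
    ext
    simp only
    omega

end TaggedSimplex
open TaggedSimplex

variable {d : ℕ}

/-! ### Lipschitz domains -/

/-- The domain lies locally on one side of its boundary. Moving from a boundary point against `ν`
leads strictly below the graph, where there are no points of `Ω` nearby, so a boundary point is not
interior to the closure. This places the open elements inside `Ω` itself, where `α` is controlled.
-/
theorem IsBoundedLipschitzDomain.interior_closure {Ω : Set (E d)}
    (hΩ : IsBoundedLipschitzDomain Ω) : interior (closure Ω) = Ω := by
  refine Subset.antisymm (fun p hp => ?_) (hΩ.isOpen.subset_interior_iff.2 subset_closure)
  by_contra hpΩ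
  have hfr : p ∈ frontier Ω := ⟨interior_subset hp, fun h => hpΩ (interior_subset h)⟩
  obtain ⟨ν, r, K, g, hν, hr, hg, h⟩ := hΩ.lipschitz p hfr
  set P := (Submodule.span ℝ {ν})ᗮ.starProjection with hP
  have hPν : P ν = 0 := by
    rw [hP, Submodule.starProjection_apply_eq_zero_iff, Submodule.orthogonal_orthogonal]
    exact Submodule.mem_span_singleton_self ν
  have hcont : Continuous fun x => g (P x) - ⟪ν, x⟫ := by
    have := hg.continuous
    fun_prop
  have h0 : 0 ≤ g (P p) - ⟪ν, p⟫ := by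
    by_contra! hlt
    exact hpΩ ((h p (Metric.mem_ball_self hr)).2 (by linarith))
  have ht : Tendsto (fun t : ℝ => p - t • ν) (𝓝[>] 0) (𝓝 p) := by
    have : Continuous fun t : ℝ => p - t • ν := by fun_prop
    have := this.tendsto 0
    simp only [zero_smul, sub_zero] at this
    exact this.mono_left nhdsWithin_le_nhds
  obtain ⟨t, ⟨ht1, ht2⟩, ht0⟩ := (((ht.eventually (Metric.ball_mem_nhds p hr)).and
    (ht.eventually (isOpen_interior.mem_nhds hp))).and self_mem_nhdsWithin).exists
  have hpos : 0 < g (P (p - t • ν)) - ⟪ν, p - t • ν⟫ := by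
    have ht0 : 0 < t := ht0
    rw [map_sub, map_smul, hPν, smul_zero, sub_zero, inner_sub_right, inner_smul_right,
      real_inner_self_eq_norm_sq, hν]
    linarith
  have hU : Metric.ball p r ∩ {x | 0 < g (P x) - ⟪ν, x⟫} ∈ 𝓝 (p - t • ν) :=
    (Metric.isOpen_ball.inter (isOpen_lt continuous_const hcont)).mem_nhds ⟨ht1, hpos⟩
  obtain ⟨x, ⟨hx1, hx2⟩, hx3⟩ := mem_closure_iff_nhds.1 (interior_subset ht2) _ hU
  have := (h x hx1).1 hx3
  have hx2 : 0 < g (P x) - ⟪ν, x⟫ := hx2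
  linarith

/-! ### Descendants -/

theorem aedisjoint_body {T T' : TaggedSimplex d} (h : Disjoint (interior T.body) (interior T'.body)) :
    AEDisjoint volume T.body T'.body :=
  h.aedisjoint.congr body_ae_eq_interior body_ae_eq_interior

namespace TaggedSimplex

variable {T T' C : TaggedSimplex d}

theorem IsChild.exists_isHalf (hT : AffineIndependent ℝ T.vtx) (h : T.IsChild C) :
    ∃ a b, a ≠ b ∧ T.IsHalf hT a b C := by
  rcases h with rfl | rfl
  · exact ⟨_, _, T.zero_ne_last.symm, isHalf_child₀ hT⟩
  · exact ⟨_, _, T.zero_ne_last, isHalf_child₁ hT⟩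

theorem IsHalf.body_subset {hT : AffineIndependent ℝ T.vtx} {a b : Fin (d + 1)}
    (h : T.IsHalf hT a b C) (hab : a ≠ b) : C.body ⊆ T.body := by
  rw [h.body_eq, bend_image_body hT hab]; exact sep_subset _ _

theorem IsDescendant.affineIndependent {k : ℕ} (h : IsDescendant k T T')
    (hT : AffineIndependent ℝ T.vtx) : AffineIndependent ℝ T'.vtx := by
  induction h with
  | refl => exact hT
  | step _ hc ih =>
    obtain ⟨a, b, hab, h⟩ := hc.exists_isHalf (ih hT)
    exact h.affineIndependent hab

theorem IsDescendant.body_subset {k : ℕ} (h : IsDescendant k T T')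
    (hT : AffineIndependent ℝ T.vtx) : T'.body ⊆ T.body := by
  induction h with
  | refl => exact Subset.rfl
  | step h' hc ih =>
    obtain ⟨a, b, hab, h⟩ := hc.exists_isHalf (h'.affineIndependent hT)
    exact (h.body_subset hab).trans (ih hT)

theorem IsDescendant.size_eq {k : ℕ} (h : IsDescendant k T T')
    (hT : AffineIndependent ℝ T.vtx) : T'.size = (2 : ℝ) ^ (-(k : ℝ) / d) * T.size := by
  induction h with
  | refl => simp
  | step h' hc ih =>
    obtain ⟨a, b, hab, h⟩ := hc.exists_isHalf (h'.affineIndependent hT)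
    rw [h.size_eq hab, ih hT, ← mul_assoc, ← Real.rpow_add (by norm_num)]
    congr 2
    push_cast
    ring

theorem size_nonneg : 0 ≤ T.size := Real.rpow_nonneg ENNReal.toReal_nonneg _

/-- The measures of the bodies of the two children add up to at most that of the parent. -/
theorem measure_body_children_le (hT : AffineIndependent ℝ T.vtx) (ν : Measure (E d))
    (hν : ν ≪ volume) : ν T.child₀.body + ν T.child₁.body ≤ ν T.body := by
  have h0 := isHalf_child₀ hT
  have h1 := isHalf_child₁ hT
  have hdis : AEDisjoint ν T.child₀.body T.child₁.body :=
    hν (aedisjoint_body (h0.disjoint_interior h1 T.zero_ne_last.symm))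
  rw [← measure_union₀ measurableSet_body.nullMeasurableSet hdis]
  exact measure_mono (union_subset (h0.body_subset T.zero_ne_last.symm)
    (h1.body_subset T.zero_ne_last))

/-- The measures of the sides of the two children add up to at most those of the parent, if the
measure lives on the sides of a simplex containing the parent. -/
theorem measure_side_children_le {R : TaggedSimplex d} (hT : AffineIndependent ℝ T.vtx)
    (hR : AffineIndependent ℝ R.vtx) (hTR : T.body ⊆ R.body) (ν : Measure (E d))
    (hν : ν ≪ μHE[d - 1]) (hνR : ν (⋃ i, R.side i)ᶜ = 0) :
    ∑ i, ν (T.child₀.side i) + ∑ i, ν (T.child₁.side i) ≤ ∑ i, ν (T.side i) := by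
  have h0 := isHalf_child₀ hT
  have h1 := isHalf_child₁ hT
  refine h0.sum_measure_side_le h1 T.zero_ne_last.symm ν hν ?_
  refine measure_mono_null (t := (⋃ i, R.side i)ᶜ ∪
    ⋃ i, ({x ∈ T.body | (T.basis hT).coord (Fin.last d) x = (T.basis hT).coord 0 x} ∩
      R.side i)) ?_ ?_
  · intro x hx
    by_cases h : x ∈ ⋃ i, R.side i
    · right
      obtain ⟨i, hi⟩ := mem_iUnion.1 h
      exact mem_iUnion.2 ⟨i, hx, hi⟩
    · exact Or.inl h
  · refine measure_union_null hνR (measure_iUnion_null fun i => hν ?_)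
    exact h0.measure_new_inter_side T.zero_ne_last.symm hR hTR i

end TaggedSimplex

/-! ### Partitions and their refinements -/

/-- A not necessarily conforming partition of `Ω` into simplices. -/
structure IsPartition (Ω : Set (E d)) (𝒯 : Mesh d) : Prop where
  nondegenerate : ∀ T ∈ 𝒯, AffineIndependent ℝ T.vtx
  covers : (⋃ T ∈ 𝒯, T.body) = closure Ω
  disjoint : ∀ T ∈ 𝒯, ∀ T' ∈ 𝒯, T ≠ T' → Disjoint (interior T.body) (interior T'.body)

theorem IsTriangulation.isPartition {Ω : Set (E d)} {𝒯 : Mesh d} (h : IsTriangulation Ω 𝒯) :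
    IsPartition Ω 𝒯 := ⟨h.nondegenerate, h.covers, h.disjoint⟩

theorem IsPartition.bisectStep {Ω : Set (E d)} {𝒯 𝒯' : Mesh d} (h : IsPartition Ω 𝒯)
    (hs : BisectStep 𝒯 𝒯') : IsPartition Ω 𝒯' := by
  obtain ⟨T, hT⟩ := hs
  have hTn := h.nondegenerate T hT
  have h0 := isHalf_child₀ hTn
  have h1 := isHalf_child₁ hTn
  have hs0 := h0.body_subset T.zero_ne_last.symm
  have hs1 := h1.body_subset T.zero_ne_last
  refine ⟨?_, ?_, ?_⟩
  · intro S hS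
    rw [Finset.mem_insert, Finset.mem_insert] at hS
    rcases hS with rfl | rfl | hS
    · exact h0.affineIndependent T.zero_ne_last.symm
    · exact h1.affineIndependent T.zero_ne_last
    · exact h.nondegenerate S (Finset.mem_of_mem_erase hS)
  · rw [Finset.set_biUnion_insert, Finset.set_biUnion_insert, ← union_assoc,
      h0.body_union h1 T.zero_ne_last.symm, ← h.covers, ← Finset.set_biUnion_insert,
      Finset.insert_erase hT]
  · have hd01 := h0.disjoint_interior h1 T.zero_ne_last.symm
    have hother : ∀ S ∈ 𝒯.erase T, Disjoint (interior T.body) (interior S.body) := fun S hS =>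
      h.disjoint T hT S (Finset.mem_of_mem_erase hS) (Finset.ne_of_mem_erase hS).symm
    intro S hS S' hS' hne
    rw [Finset.mem_insert, Finset.mem_insert] at hS hS'
    rcases hS with rfl | rfl | hS <;> rcases hS' with rfl | rfl | hS'
    · exact absurd rfl hne
    · exact hd01
    · exact (hother _ hS').mono_left (interior_mono hs0)
    · exact hd01.symm
    · exact absurd rfl hne
    · exact (hother _ hS').mono_left (interior_mono hs1)
    · exact ((hother _ hS).mono_left (interior_mono hs0)).symm
    · exact ((hother _ hS).mono_left (interior_mono hs1)).symm
    · exact h.disjoint S (Finset.mem_of_mem_erase hS) S' (Finset.mem_of_mem_erase hS') hne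

theorem IsPartition.refinement {Ω : Set (E d)} {𝒯 𝒯' : Mesh d} (h : IsPartition Ω 𝒯)
    (hs : IsRefinement 𝒯 𝒯') : IsPartition Ω 𝒯' := by
  induction hs with
  | refl => exact h
  | tail _ hs ih => exact ih.bisectStep hs

theorem IsPartition.eq_of_interior_inter {Ω : Set (E d)} {𝒯 : Mesh d} (h : IsPartition Ω 𝒯)
    {T T' : TaggedSimplex d} (hT : T ∈ 𝒯) (hT' : T' ∈ 𝒯) {x : E d} (hx : x ∈ interior T.body)
    (hx' : x ∈ interior T'.body) : T = T' := by
  by_contra hne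
  exact Set.disjoint_left.1 (h.disjoint T hT T' hT' hne) hx hx'

theorem IsTriangulation.of_mem_family {Ω : Set (E d)} {𝒯₀ 𝒯 : Mesh d} (h : IsTriangulation Ω 𝒯₀)
    (h𝒯 : 𝒯 ∈ Family 𝒯₀) : IsTriangulation Ω 𝒯 := by
  have := h.isPartition.refinement h𝒯.1
  exact ⟨this.nondegenerate, this.covers, this.disjoint, h𝒯.2⟩

theorem IsRefinement.exists_ancestor {𝒯 𝒯' : Mesh d} (h : IsRefinement 𝒯 𝒯') :
    ∀ T' ∈ 𝒯', ∃ T ∈ 𝒯, ∃ k, IsDescendant k T T' := by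
  induction h with
  | refl => exact fun T hT => ⟨T, hT, 0, .refl T⟩
  | tail _ hs ih =>
    obtain ⟨S, hS⟩ := hs
    intro T' hT'
    rw [Finset.mem_insert, Finset.mem_insert] at hT'
    obtain ⟨T, hT, k, hk⟩ := ih S hS
    rcases hT' with rfl | rfl | hT'
    · exact ⟨T, hT, k + 1, .step hk (Or.inl rfl)⟩
    · exact ⟨T, hT, k + 1, .step hk (Or.inr rfl)⟩
    · exact ih T' (Finset.mem_of_mem_erase hT')

open scoped Classical in
/-- The elements of `𝒯'` which descend from `T`. -/
noncomputable def descendants (𝒯' : Mesh d) (T : TaggedSimplex d) : Mesh d :=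
  𝒯'.filter fun T' => ∃ k, IsDescendant k T T'

theorem mem_descendants {𝒯' : Mesh d} {T T' : TaggedSimplex d} :
    T' ∈ descendants 𝒯' T ↔ T' ∈ 𝒯' ∧ ∃ k, IsDescendant k T T' := by
  classical
  simp [descendants]

/-- A functional which does not increase under bisection does not increase under refinement. -/
theorem sum_descendants_le {Ω : Set (E d)} {𝒯 𝒯' : Mesh d} (h : IsPartition Ω 𝒯)
    (hr : IsRefinement 𝒯 𝒯') {T : TaggedSimplex d} (hT : T ∈ 𝒯) (m : TaggedSimplex d → ℝ≥0∞)
    (hm : ∀ k T', IsDescendant k T T' → m T'.child₀ + m T'.child₁ ≤ m T') :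
    ∑ T' ∈ descendants 𝒯' T, m T' ≤ m T := by
  have hTn := h.nondegenerate T hT
  induction hr with
  | refl =>
    -- A descendant of `T` in the same partition overlaps with `T`, hence is `T`.
    have : descendants 𝒯 T ⊆ {T} := by
      intro T' hT'
      obtain ⟨h1, k, hk⟩ := mem_descendants.1 hT'
      obtain ⟨x, hx⟩ := interior_nonempty (h.nondegenerate T' h1)
      rw [Finset.mem_singleton]
      exact h.eq_of_interior_inter h1 hT hx (interior_mono (hk.body_subset hTn) hx)
    exact (Finset.sum_le_sum_of_subset this).trans (by simp)
  | @tail 𝒮 𝒮' hr hs ih =>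
    obtain ⟨S, hS⟩ := hs
    have hSn := (h.refinement hr).nondegenerate S hS
    by_cases hST : ∃ k, IsDescendant k T S
    · obtain ⟨k, hk⟩ := hST
      have hsub : descendants (insert S.child₀ (insert S.child₁ (𝒮.erase S))) T ⊆
          insert S.child₀ (insert S.child₁ ((descendants 𝒮 T).erase S)) := by
        intro T' hT'
        obtain ⟨h1, h2⟩ := mem_descendants.1 hT'
        rw [Finset.mem_insert, Finset.mem_insert, Finset.mem_erase] at h1 ⊢
        rw [mem_descendants]
        tauto
      have hmem : S ∈ descendants 𝒮 T := mem_descendants.2 ⟨hS, k, hk⟩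
      -- A child might already be present in the set; as the values are nonnegative, an inequality
      -- is enough.
      have hins : ∀ (s : Mesh d) (C : TaggedSimplex d),
          ∑ T' ∈ insert C s, m T' ≤ m C + ∑ T' ∈ s, m T' := by
        intro s C
        by_cases hC : C ∈ s
        · rw [Finset.insert_eq_of_mem hC]; exact le_add_self
        · rw [Finset.sum_insert hC]
      calc _ ≤ ∑ T' ∈ insert S.child₀ (insert S.child₁ ((descendants 𝒮 T).erase S)), m T' :=
            Finset.sum_le_sum_of_subset hsub
        _ ≤ m S.child₀ + (m S.child₁ + ∑ T' ∈ (descendants 𝒮 T).erase S, m T') :=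
            (hins _ _).trans (add_le_add le_rfl (hins _ _))
        _ ≤ m S + ∑ T' ∈ (descendants 𝒮 T).erase S, m T' := by
            rw [← add_assoc]; exact add_le_add (hm k S hk) le_rfl
        _ = ∑ T' ∈ descendants 𝒮 T, m T' := Finset.add_sum_erase _ _ hmem
        _ ≤ m T := ih
    · have hsub : descendants (insert S.child₀ (insert S.child₁ (𝒮.erase S))) T ⊆
          descendants 𝒮 T := by
        intro T' hT'
        obtain ⟨h1, k, hk⟩ := mem_descendants.1 hT'
        obtain ⟨T₁, hT₁, k₁, hk₁⟩ := IsRefinement.exists_ancestor hr S hS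
        -- If a child of `S` came from `T`, the ancestor `T₁` of `S` would overlap with `T` and
        -- equal it, so that `S` itself would descend from `T`.
        have hne : ¬ S.IsChild T' := by
          intro hc
          have hk' := IsDescendant.step hk₁ hc
          have hT₁n := h.nondegenerate T₁ hT₁
          obtain ⟨x, hx⟩ := interior_nonempty (hk'.affineIndependent hT₁n)
          have := h.eq_of_interior_inter hT₁ hT (interior_mono (hk'.body_subset hT₁n) hx)
            (interior_mono (hk.body_subset hTn) hx)
          exact hST ⟨k₁, this ▸ hk₁⟩
        rw [Finset.mem_insert, Finset.mem_insert] at h1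
        rcases h1 with rfl | rfl | h1
        · exact absurd (Or.inl rfl) hne
        · exact absurd (Or.inr rfl) hne
        · exact mem_descendants.2 ⟨Finset.mem_of_mem_erase h1, k, hk⟩
      exact (Finset.sum_le_sum_of_subset hsub).trans ih

/-- A sum over a refinement is bounded by the sums over the descendants of the coarse elements. -/
theorem sum_le_sum_descendants {𝒯 𝒯' : Mesh d} (hr : IsRefinement 𝒯 𝒯')
    (m : TaggedSimplex d → ℝ) (hm : ∀ T, 0 ≤ m T) :
    ∑ T' ∈ 𝒯', m T' ≤ ∑ T ∈ 𝒯, ∑ T' ∈ descendants 𝒯' T, m T' := by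
  classical
  simp_rw [descendants, Finset.sum_filter]
  rw [Finset.sum_comm]
  refine Finset.sum_le_sum fun T' hT' => ?_
  obtain ⟨T, hT, hk⟩ := hr.exists_ancestor T' hT'
  calc m T' = if ∃ k, IsDescendant k T T' then m T' else 0 := (if_pos hk).symm
    _ ≤ _ := Finset.single_le_sum
      (f := fun T => if ∃ k, IsDescendant k T T' then m T' else 0)
      (fun T _ => by split_ifs <;> [exact hm T'; exact le_rfl]) hT

/-! ### Partitions and the domain -/

section Domain

variable {Ω : Set (E d)} {𝒯 : Mesh d}

theorem IsPartition.body_subset (h : IsPartition Ω 𝒯) {T : TaggedSimplex d} (hT : T ∈ 𝒯) :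
    T.body ⊆ closure Ω := by
  rw [← h.covers]; exact subset_biUnion_of_mem (u := fun T : TaggedSimplex d => T.body) hT

theorem IsPartition.interior_subset (h : IsPartition Ω 𝒯) (hΩ : IsBoundedLipschitzDomain Ω)
    {T : TaggedSimplex d} (hT : T ∈ 𝒯) : interior T.body ⊆ Ω := by
  rw [← hΩ.interior_closure]; exact interior_mono (h.body_subset hT)

/-- Frontiers of convex sets are null, so integrals over `Ω` only see the open elements, on which
discrete gradients are constant. -/
theorem IsPartition.ae_eq (h : IsPartition Ω 𝒯) (hΩ : IsBoundedLipschitzDomain Ω) :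
    Ω =ᵐ[volume] ⋃ T ∈ 𝒯, interior T.body := by
  have h1 : (⋃ T ∈ 𝒯, interior T.body) ⊆ Ω := iUnion₂_subset fun T hT => h.interior_subset hΩ hT
  refine Filter.EventuallyLE.antisymm ?_ (LE.le.eventuallyLE h1)
  have h2 : volume (⋃ T ∈ 𝒯, frontier T.body) = 0 :=
    (measure_biUnion_null_iff 𝒯.countable_toSet).2 fun T _ =>
      convex_body.addHaar_frontier volume
  have h3 : Ω \ (⋃ T ∈ 𝒯, interior T.body) ⊆ ⋃ T ∈ 𝒯, frontier T.body := by
    rintro x ⟨hx, hx'⟩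
    have : x ∈ ⋃ T ∈ 𝒯, T.body := by rw [h.covers]; exact subset_closure hx
    obtain ⟨T, hT, hxT⟩ := mem_iUnion₂.1 this
    refine mem_iUnion₂.2 ⟨T, hT, subset_closure hxT, fun hi => hx' (mem_iUnion₂.2 ⟨T, hT, hi⟩)⟩
  exact ae_le_set.2 (measure_mono_null h3 h2)

/-- Integrals over the domain of functions which are integrable on each element. -/
theorem IsPartition.setIntegral_eq_sum (h : IsPartition Ω 𝒯) (hΩ : IsBoundedLipschitzDomain Ω)
    {F : E d → ℝ} (hF : ∀ T ∈ 𝒯, IntegrableOn F (interior T.body)) :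
    ∫ x in Ω, F x = ∑ T ∈ 𝒯, ∫ x in interior T.body, F x := by
  rw [setIntegral_congr_set (h.ae_eq hΩ)]
  exact integral_biUnion_finset 𝒯 (fun T _ => isOpen_interior.measurableSet)
    (fun T hT T' hT' hne => h.disjoint T hT T' hT' hne) hF

end Domain

/-! ### Sides and normals -/

namespace TaggedSimplex

variable {T T' : TaggedSimplex d}

theorem coord_linear_eq_zero (hT : AffineIndependent ℝ T.vtx) {i : Fin (d + 1)} {v : E d}
    (hv : v ∈ vectorSpan ℝ (T.sideVtx i)) : ((T.basis hT).coord i).linear v = 0 := by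
  have : vectorSpan ℝ (T.sideVtx i) ≤ LinearMap.ker ((T.basis hT).coord i).linear := by
    rw [vectorSpan_def, Submodule.span_le]
    rintro _ ⟨x, ⟨j, hj, rfl⟩, y, ⟨k, hk, rfl⟩, rfl⟩
    change ((T.basis hT).coord i).linear (T.vtx j - T.vtx k) = 0
    rw [coord_linear_sub, coord_ne hT (Ne.symm hj), coord_ne hT (Ne.symm hk), sub_zero]
  exact this hv

/-- Going from vertex `i` to vertex `i + 1` (cyclically, and a different one since `d > 0`) lowers
the `i`-th coordinate by one. Removing the component parallel to the side does not affect this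
coordinate, so the projection is nonzero and points outward. -/
theorem normal_spec (hT : AffineIndependent ℝ T.vtx) (i : Fin (d + 1)) :
    ‖T.normal i‖ = 1 ∧ T.normal i ∈ (vectorSpan ℝ (T.sideVtx i))ᗮ ∧
      ((T.basis hT).coord i).linear (T.normal i) < 0 := by
  have hd := T.typ.pos
  set D := vectorSpan ℝ (T.sideVtx i) with hD
  set v := Dᗮ.starProjection (T.vtx (i + 1) - T.vtx i) with hv
  have hn : T.normal i = ‖v‖⁻¹ • v := rfl
  have hvD : v ∈ Dᗮ := Submodule.starProjection_apply_mem _ _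
  have hi : i ≠ i + 1 := by
    intro h
    have h1 : (1 : Fin (d + 1)) = 0 := by simpa using h.symm
    have := congrArg Fin.val h1
    rw [Fin.coe_ofNat_eq_mod, Fin.val_zero, Nat.mod_eq_of_lt (by omega)] at this
    omega
  have hc : ((T.basis hT).coord i).linear v = -1 := by
    have h1 : (T.vtx (i + 1) - T.vtx i) - v ∈ D := by
      have := Submodule.sub_starProjection_mem_orthogonal (K := Dᗮ) (T.vtx (i + 1) - T.vtx i)
      rwa [Submodule.orthogonal_orthogonal] at this
    have h2 := coord_linear_eq_zero hT h1
    rw [map_sub, coord_linear_sub, coord_ne hT hi, coord_self] at h2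
    linarith
  have hv0 : v ≠ 0 := by
    intro h; rw [h, map_zero] at hc; norm_num at hc
  have hpos : 0 < ‖v‖⁻¹ := inv_pos.2 (norm_pos_iff.2 hv0)
  refine ⟨?_, ?_, ?_⟩
  · rw [hn, norm_smul, norm_inv, norm_norm, inv_mul_cancel₀ (norm_ne_zero_iff.2 hv0)]
  · rw [hn]; exact Submodule.smul_mem _ _ hvD
  · rw [hn, map_smul, hc]; simpa using hv0

theorem norm_normal (hT : AffineIndependent ℝ T.vtx) (i : Fin (d + 1)) : ‖T.normal i‖ = 1 :=
  (normal_spec hT i).1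

/-- The unit normal of a side is determined up to its sign by the direction of the side. -/
theorem normal_eq_or_eq_neg (hT : AffineIndependent ℝ T.vtx) (hT' : AffineIndependent ℝ T'.vtx)
    {i j : Fin (d + 1)} (h : vectorSpan ℝ (T'.sideVtx j) = vectorSpan ℝ (T.sideVtx i)) :
    T'.normal j = T.normal i ∨ T'.normal j = -T.normal i := by
  have hd := T.typ.pos
  obtain ⟨h1, h2, -⟩ := normal_spec hT i
  obtain ⟨h1', h2', -⟩ := normal_spec hT' j
  rw [h] at h2'
  have hfr : Module.finrank ℝ (vectorSpan ℝ (T.sideVtx i))ᗮ = 1 := by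
    have := (vectorSpan ℝ (T.sideVtx i)).finrank_add_finrank_orthogonal
    rw [finrank_vectorSpan_sideVtx hd hT, finrank_euclideanSpace, Fintype.card_fin] at this
    omega
  have h0 : (⟨T.normal i, h2⟩ : (vectorSpan ℝ (T.sideVtx i))ᗮ) ≠ 0 := by
    intro h
    have := congrArg Subtype.val h
    simp only [ZeroMemClass.coe_zero] at this
    rw [this, norm_zero] at h1
    norm_num at h1
  obtain ⟨c, hc⟩ := (finrank_eq_one_iff_of_nonzero' _ h0).1 hfr ⟨T'.normal j, h2'⟩
  have hc := congrArg Subtype.val hc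
  simp only [SetLike.val_smul] at hc
  have habs : |c| = 1 := by
    have := congrArg norm hc
    rwa [norm_smul, h1, h1', mul_one, Real.norm_eq_abs] at this
  rcases eq_or_eq_neg_of_abs_eq habs with rfl | rfl
  · left; simpa using hc.symm
  · right; simpa using hc.symm

/-- The barycentre of the side works. It stands for the relative interior: an element of a
conforming mesh which contains it has the whole side. -/
theorem exists_side_center (hT : AffineIndependent ℝ T.vtx) (i : Fin (d + 1)) :
    ∃ c ∈ T.side i, ∀ k, k ≠ i → 0 < (T.basis hT).coord k c := by
  have hd := T.typ.pos
  have hcard : (Finset.univ.erase i).card = d := by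
    rw [Finset.card_erase_of_mem (Finset.mem_univ _)]; simp
  have hne : ((Finset.univ.erase i).card : ℝ) ≠ 0 := by rw [hcard]; positivity
  have hpos : ∀ k, k ≠ i → 0 < (T.basis hT).coord k ((Finset.univ.erase i).centroid ℝ T.vtx) := by
    intro k hk
    have := (T.basis hT).coord_apply_centroid (s := Finset.univ.erase i) (i := k) (by simpa using hk)
    rw [coe_basis] at this
    rw [this, hcard]
    positivity
  have hzero : (T.basis hT).coord i ((Finset.univ.erase i).centroid ℝ T.vtx) = 0 := by
    have := (T.basis hT).coord_apply_combination_of_notMem (s := Finset.univ.erase i) (i := i)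
      (by simp) ((Finset.univ.erase i).sum_centroidWeights_eq_one_of_cast_card_ne_zero hne)
    rwa [coe_basis] at this
  refine ⟨_, (mem_side_iff hT).2 ⟨(mem_body_iff hT).2 fun k => ?_, hzero⟩, hpos⟩
  by_cases hk : k = i
  · rw [hk, hzero]
  · exact (hpos k hk).le

theorem vtx_mem_of_coord_ne_zero (hT : AffineIndependent ℝ T.vtx) {A : Set (E d)}
    (hA : A ⊆ range T.vtx) {x : E d} (hx : x ∈ convexHull ℝ A) {k : Fin (d + 1)}
    (hk : (T.basis hT).coord k x ≠ 0) : T.vtx k ∈ A := by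
  by_contra hkA
  have hsub : A ⊆ T.sideVtx k := by
    intro a ha
    obtain ⟨j, rfl⟩ := hA ha
    refine vtx_mem_sideVtx ?_
    rintro rfl
    exact hkA ha
  exact hk (coord_eq_zero_of_mem_side hT (convexHull_mono hsub hx))

theorem vtx_notMem_sideVtx (hT : AffineIndependent ℝ T.vtx) (i : Fin (d + 1)) :
    T.vtx i ∉ T.sideVtx i := by
  rintro ⟨j, hj, h⟩
  exact hj (hT.injective h)

theorem sideVtx_injective (hT : AffineIndependent ℝ T.vtx) :
    Function.Injective T.sideVtx := by
  intro i j h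
  by_contra hne
  have := vtx_mem_sideVtx (T := T) (i := j) (j := i) hne
  rw [← h] at this
  exact vtx_notMem_sideVtx hT i this

/-- The two simplices may number the common vertices differently. If a coordinate vanished, the
point would be a combination of fewer vertices, against the positivity of all its weights in `T`. -/
theorem side_center_of_sideVtx_eq (hT : AffineIndependent ℝ T.vtx)
    (hT' : AffineIndependent ℝ T'.vtx) {i j : Fin (d + 1)} (h : T'.sideVtx j = T.sideVtx i)
    {c : E d} (hc : c ∈ T.side i) (hpos : ∀ k, k ≠ i → 0 < (T.basis hT).coord k c) :
    ∀ k, k ≠ j → 0 < (T'.basis hT').coord k c := by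
  intro k hk
  have hc' : c ∈ T'.side j := by rwa [side, h]
  refine lt_of_le_of_ne ((mem_body_iff hT').1 (side_subset_body j hc') k) fun h0 => ?_
  have h1 := mem_convexHull_of_affine_eq_zero ((T'.basis hT').coord k) (A := T'.sideVtx j)
    (fun a ha => (mem_body_iff hT').1 (side_subset_body j (sideVtx_subset_side j ha)) k) hc' h0.symm
  have hkT : T'.vtx k ∈ T.sideVtx i := h ▸ vtx_mem_sideVtx hk
  obtain ⟨l, hl, hlk⟩ := hkT
  have h2 : T.vtx l ∈ {a ∈ T'.sideVtx j | (T'.basis hT').coord k a = 0} := by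
    refine vtx_mem_of_coord_ne_zero hT ?_ h1 (hpos l hl).ne'
    rw [h]; exact (sep_subset _ _).trans (sideVtx_subset i)
  have h3 := h2.2
  rw [hlk, coord_self] at h3
  norm_num at h3

/-- The coordinate of the side grows from zero when moving inward along the normal, and the others
remain positive for a short while. -/
theorem eventually_mem_interior (hT : AffineIndependent ℝ T.vtx) {i : Fin (d + 1)} {c : E d}
    (hc : c ∈ T.side i) (hpos : ∀ k, k ≠ i → 0 < (T.basis hT).coord k c) :
    ∀ᶠ t : ℝ in 𝓝[>] 0, c - t • T.normal i ∈ interior T.body := by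
  have hform : ∀ (k : Fin (d + 1)) (t : ℝ), (T.basis hT).coord k (c - t • T.normal i) =
      (T.basis hT).coord k c - t * ((T.basis hT).coord k).linear (T.normal i) := by
    intro k t
    have e : c - t • T.normal i = (-(t • T.normal i)) +ᵥ c := by
      rw [vadd_eq_add]; abel
    rw [e, AffineMap.map_vadd, map_neg, map_smul]
    simp only [smul_eq_mul, vadd_eq_add]
    ring
  have hall : ∀ k, ∀ᶠ t : ℝ in 𝓝[>] 0, 0 < (T.basis hT).coord k (c - t • T.normal i) := by
    intro k
    by_cases hk : k = i
    · subst hk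
      filter_upwards [self_mem_nhdsWithin] with t ht
      rw [hform, coord_eq_zero_of_mem_side hT hc]
      have := mul_neg_of_pos_of_neg (show (0 : ℝ) < t from ht) (normal_spec hT k).2.2
      linarith
    · have hcont : Continuous fun t : ℝ => (T.basis hT).coord k c -
          t * ((T.basis hT).coord k).linear (T.normal i) := by fun_prop
      have ht := hcont.tendsto 0
      simp only [zero_mul, sub_zero] at ht
      have := (ht.eventually (lt_mem_nhds (hpos k hk))).filter_mono
        (nhdsWithin_le_nhds (s := Ioi (0 : ℝ)))
      filter_upwards [this] with t ht
      rwa [hform]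
  filter_upwards [eventually_all.2 hall] with t ht
  exact (mem_interior_iff hT).2 ht

/-- The outward normals of two nonoverlapping simplices on a common side are opposite. -/
theorem normal_eq_neg (hT : AffineIndependent ℝ T.vtx) (hT' : AffineIndependent ℝ T'.vtx)
    (hdis : Disjoint (interior T.body) (interior T'.body)) {i j : Fin (d + 1)}
    (h : T'.sideVtx j = T.sideVtx i) : T'.normal j = -T.normal i := by
  refine (normal_eq_or_eq_neg hT hT' (by rw [h])).resolve_left fun heq => ?_
  -- With equal normals, a short step inward from the centre would end in both interiors.
  obtain ⟨c, hc, hpos⟩ := exists_side_center hT i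
  have hc' : c ∈ T'.side j := by rwa [side, h]
  obtain ⟨t, h1, h2⟩ := ((eventually_mem_interior hT hc hpos).and
    (eventually_mem_interior hT' hc' (side_center_of_sideVtx_eq hT hT' h hc hpos))).exists
  rw [heq] at h2
  exact Set.disjoint_left.1 hdis h1 h2

theorem eq_sideVtx_of_le_ncard (hT : AffineIndependent ℝ T.vtx) {A : Set (E d)}
    (hA : A ⊆ range T.vtx) (hne : A ≠ range T.vtx) (hcard : d ≤ A.ncard) :
    ∃ i, A = T.sideVtx i := by
  obtain ⟨_, ⟨i, rfl⟩, hi⟩ := exists_of_ssubset (hA.ssubset_of_ne hne)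
  have hsub : A ⊆ T.sideVtx i := by
    intro a ha
    obtain ⟨j, rfl⟩ := hA ha
    refine vtx_mem_sideVtx ?_
    rintro rfl
    exact hi ha
  exact ⟨i, eq_of_subset_of_ncard_le hsub (by rwa [ncard_sideVtx hT])
    ((finite_range _).subset (sideVtx_subset i))⟩

end TaggedSimplex

/-! ### Neighbours in a mesh -/

section Neighbours

variable {Ω : Set (E d)} {𝒯 : Mesh d} {T T' : TaggedSimplex d}

theorem IsPartition.not_body_subset (h : IsPartition Ω 𝒯) (hT : T ∈ 𝒯) (hT' : T' ∈ 𝒯)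
    (hne : T ≠ T') : ¬ T.body ⊆ T'.body := fun hsub => by
  obtain ⟨x, hx⟩ := interior_nonempty (h.nondegenerate T hT)
  exact hne (h.eq_of_interior_inter hT hT' hx (interior_mono hsub hx))

theorem IsPartition.inter_range_ne (h : IsPartition Ω 𝒯) (hT : T ∈ 𝒯) (hT' : T' ∈ 𝒯)
    (hne : T ≠ T') : range T.vtx ∩ range T'.vtx ≠ range T.vtx := fun heq =>
  h.not_body_subset hT hT' hne (convexHull_mono (inter_eq_left.1 heq))

theorem IsPartition.common_sideVtx (h : IsPartition Ω 𝒯) (hT : T ∈ 𝒯) (hT' : T' ∈ 𝒯)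
    (hne : T ≠ T') (hcard : d ≤ (range T.vtx ∩ range T'.vtx).ncard) :
    ∃ i j, range T.vtx ∩ range T'.vtx = T.sideVtx i ∧
      range T.vtx ∩ range T'.vtx = T'.sideVtx j := by
  obtain ⟨i, hi⟩ := eq_sideVtx_of_le_ncard (h.nondegenerate T hT) inter_subset_left
    (h.inter_range_ne hT hT' hne) hcard
  obtain ⟨j, hj⟩ := eq_sideVtx_of_le_ncard (h.nondegenerate T' hT') inter_subset_right
    (by rw [inter_comm]; exact h.inter_range_ne hT' hT hne.symm) hcard
  exact ⟨i, j, hi, hj⟩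

/-- If two elements of a conforming mesh meet in a set which contains a side of some simplex, then
they have a common side, which contains that set. -/
theorem IsTriangulation.exists_common_side (h : IsTriangulation Ω 𝒯) (hT : T ∈ 𝒯) (hT' : T' ∈ 𝒯)
    (hne : T ≠ T') {S : TaggedSimplex d} (hS : AffineIndependent ℝ S.vtx) {k : Fin (d + 1)}
    (hsub : S.side k ⊆ T.body ∩ T'.body) :
    ∃ i j, T'.sideVtx j = T.sideVtx i ∧ S.side k ⊆ T.side i := by
  have hd := S.typ.pos
  rw [h.conforming T hT T' hT' hne] at hsub
  set A := range T.vtx ∩ range T'.vtx with hA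
  have hfin : A.Finite := (finite_range T.vtx).subset inter_subset_left
  have hne' : A.Nonempty := by
    obtain ⟨x, hx⟩ := sideVtx_nonempty hd hS k
    exact convexHull_nonempty_iff.1 ⟨x, hsub (sideVtx_subset_side k hx)⟩
  -- A hull that contains a side has at least its dimension `d - 1`, which needs at least `d`
  -- generators.
  have hcard : d ≤ A.ncard := by
    have h1 : vectorSpan ℝ (S.sideVtx k) ≤ vectorSpan ℝ A := by
      rw [← direction_affineSpan, ← direction_affineSpan]
      refine AffineSubspace.direction_le (affineSpan_le.2 ?_)
      exact (sideVtx_subset_side k).trans (hsub.trans (convexHull_subset_affineSpan A))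
    have h2 := Submodule.finrank_mono h1
    rw [finrank_vectorSpan_sideVtx hd hS] at h2
    have : Fintype A := hfin.fintype
    have hpos : 0 < A.ncard := (Set.ncard_pos hfin).2 hne'
    have h3 := finrank_vectorSpan_range_le ℝ (fun x : A => (x : E d)) (n := A.ncard - 1) (by
      rw [← Nat.card_eq_fintype_card, Nat.card_coe_set_eq]; omega)
    rw [Subtype.range_coe] at h3
    omega
  obtain ⟨i, j, hi, hj⟩ := h.isPartition.common_sideVtx hT hT' hne hcard
  refine ⟨i, j, hj.symm.trans hi, ?_⟩
  have : T.side i = convexHull ℝ A := by rw [side, ← hi]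
  rw [this]
  exact hsub

/-- An element of a conforming mesh which contains a relative interior point of a side of another
element shares that side. -/
theorem IsTriangulation.sideVtx_eq_of_mem (h : IsTriangulation Ω 𝒯) (hT : T ∈ 𝒯) (hT' : T' ∈ 𝒯)
    (hne : T ≠ T') {i : Fin (d + 1)} {c : E d} (hc : c ∈ T.side i)
    (hpos : ∀ k, k ≠ i → 0 < (T.basis (h.nondegenerate T hT)).coord k c) (hc' : c ∈ T'.body) :
    ∃ j, T'.sideVtx j = T.sideVtx i := by
  have hTn := h.nondegenerate T hT
  have hmem : c ∈ convexHull ℝ (range T.vtx ∩ range T'.vtx) := by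
    rw [← h.conforming T hT T' hT' hne]; exact ⟨side_subset_body i hc, hc'⟩
  have hsub : T.sideVtx i ⊆ range T.vtx ∩ range T'.vtx := by
    rintro _ ⟨k, hk, rfl⟩
    exact vtx_mem_of_coord_ne_zero hTn inter_subset_left hmem (hpos k hk).ne'
  have hcard : d ≤ (range T.vtx ∩ range T'.vtx).ncard := by
    have := ncard_le_ncard hsub ((finite_range T.vtx).subset inter_subset_left)
    rwa [ncard_sideVtx hTn] at this
  obtain ⟨i', j, hi, hj⟩ := h.isPartition.common_sideVtx hT hT' hne hcard
  refine ⟨j, hj.symm.trans (hi.trans ?_)⟩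
  refine (eq_of_subset_of_ncard_le (hi ▸ hsub) ?_
    ((finite_range _).subset (sideVtx_subset i'))).symm
  rw [ncard_sideVtx hTn, ncard_sideVtx hTn]

/-- Three elements at one side would have three unit normals, each opposite to the other two. This
makes the double sum defining the jump collapse to one term. -/
theorem IsPartition.eq_of_common_side (h : IsPartition Ω 𝒯) (hT : T ∈ 𝒯) (hT' : T' ∈ 𝒯)
    (hne : T' ≠ T) {S : TaggedSimplex d} (hS : S ∈ 𝒯) (hSne : S ≠ T) {i j k : Fin (d + 1)}
    (hj : T'.sideVtx j = T.sideVtx i) (hk : S.sideVtx k = T.sideVtx i) : S = T' := by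
  by_contra hST'
  have hTn := h.nondegenerate T hT
  have hT'n := h.nondegenerate T' hT'
  have hSn := h.nondegenerate S hS
  have e1 := normal_eq_neg hTn hT'n (h.disjoint T hT T' hT' hne.symm) hj
  have e2 := normal_eq_neg hTn hSn (h.disjoint T hT S hS hSne.symm) hk
  have e3 := normal_eq_neg hT'n hSn (h.disjoint T' hT' S hS (Ne.symm hST')) (hk.trans hj.symm)
  rw [e2, e1, neg_neg] at e3
  have h0 : T.normal i = 0 := by
    have : (2 : ℝ) • T.normal i = 0 := by rw [two_smul]; nth_rewrite 1 [← e3]; simp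
    simpa using this
  have := norm_normal hTn i
  rw [h0, norm_zero] at this
  norm_num at this

theorem IsPartition.jumpRes_eq (h : IsPartition Ω 𝒯) (hT : T ∈ 𝒯) (hT' : T' ∈ 𝒯)
    (hne : T' ≠ T) {i j : Fin (d + 1)} (hj : T'.sideVtx j = T.sideVtx i)
    (α : E d → ℝ → ℝ) (V : E d → ℝ) (x : E d) :
    jumpRes α 𝒯 V T i x =
      1 / 2 * ⟪fluxTrace α V T x - fluxTrace α V T' x, T.normal i⟫ := by
  have hTn := h.nondegenerate T hT
  have hT'n := h.nondegenerate T' hT'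
  rw [jumpRes, Finset.sum_eq_single_of_mem T' (Finset.mem_erase.2 ⟨hne, hT'⟩),
    Finset.sum_eq_single_of_mem j (Finset.mem_univ _), if_pos hj,
    normal_eq_neg hTn hT'n (h.disjoint T hT T' hT' hne.symm) hj, inner_neg_right, inner_sub_left]
  · ring
  · intro k _ hk
    rw [if_neg]
    intro hk'
    exact hk (sideVtx_injective hT'n (hk'.trans hj.symm))
  · intro S hS hST'
    refine Finset.sum_eq_zero fun k _ => if_neg fun hk => hST' ?_
    exact h.eq_of_common_side hT hT' hne (Finset.mem_of_mem_erase hS) (Finset.ne_of_mem_erase hS)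
      hj hk

theorem jumpRes_eq_zero {i : Fin (d + 1)}
    (hno : ∀ T' ∈ 𝒯, T' ≠ T → ∀ j, T'.sideVtx j ≠ T.sideVtx i)
    (α : E d → ℝ → ℝ) (V : E d → ℝ) (x : E d) : jumpRes α 𝒯 V T i x = 0 := by
  rw [jumpRes]
  refine Finset.sum_eq_zero fun S hS => Finset.sum_eq_zero fun k _ => if_neg ?_
  exact hno S (Finset.mem_of_mem_erase hS) (Finset.ne_of_mem_erase hS) k

end Neighbours

/-! ### Traces and jumps under refinement -/

/-- The flux has a trace on the boundary of `T`. -/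
def HasTrace (α : E d → ℝ → ℝ) (V : E d → ℝ) (T : TaggedSimplex d) : Prop :=
  ∀ x ∈ T.body, ∃ y, Tendsto (flux α V) (𝓝[interior T.body] x) (𝓝 y)

section Refinement

variable {α : E d → ℝ → ℝ} {V : E d → ℝ} {T T' : TaggedSimplex d}

theorem HasTrace.tendsto (h : HasTrace α V T) {x : E d} (hx : x ∈ T.body) :
    Tendsto (flux α V) (𝓝[interior T.body] x) (𝓝 (fluxTrace α V T x)) :=
  tendsto_extendFrom (h x hx)

/-- Approaching from the smaller interior is a special case of approaching from the larger one, so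
fine elements see the traces of their coarse ancestors. -/
theorem HasTrace.fluxTrace_eq (h : HasTrace α V T) (hT' : AffineIndependent ℝ T'.vtx)
    (hsub : T'.body ⊆ T.body) {x : E d} (hx : x ∈ T'.body) :
    fluxTrace α V T' x = fluxTrace α V T x := by
  refine extendFrom_eq (by rw [closure_interior_body hT']; exact hx) ?_
  exact (h.tendsto (hsub hx)).mono_left (nhdsWithin_mono x (interior_mono hsub))

theorem HasTrace.continuousOn (h : HasTrace α V T) (hT : AffineIndependent ℝ T.vtx) :
    ContinuousOn (fluxTrace α V T) T.body :=
  continuousOn_extendFrom (closure_interior_body hT).ge h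

variable {Ω : Set (E d)} {𝒯 𝒯' : Mesh d}

/-- On a side of an element of a refinement, the jump of a coarse function vanishes or agrees up to
its sign with the jump on the side of the coarse element which contains it. -/
theorem IsTriangulation.jumpRes_refinement (h : IsTriangulation Ω 𝒯) (h' : IsTriangulation Ω 𝒯')
    (hr : IsRefinement 𝒯 𝒯') (hV : ∀ T ∈ 𝒯, HasTrace α V T) (hT : T ∈ 𝒯) (hT' : T' ∈ 𝒯')
    (hsub : T'.body ⊆ T.body) (k : Fin (d + 1)) :
    (∀ x ∈ T'.side k, jumpRes α 𝒯' V T' k x = 0) ∨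
      ∃ i, T'.side k ⊆ T.side i ∧
        ∀ x ∈ T'.side k, (jumpRes α 𝒯' V T' k x) ^ 2 = (jumpRes α 𝒯 V T i x) ^ 2 := by
  have hTn := h.nondegenerate T hT
  have hT'n := h'.nondegenerate T' hT'
  by_cases hno : ∀ S ∈ 𝒯', S ≠ T' → ∀ j, S.sideVtx j ≠ T'.sideVtx k
  · exact Or.inl fun x _ => jumpRes_eq_zero hno α V x
  push Not at hno
  obtain ⟨S, hS, hST', j, hj⟩ := hno
  have hSn := h'.nondegenerate S hS
  have hside : S.side j = T'.side k := by rw [side, side, hj]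
  obtain ⟨R, hR, m, hm⟩ := hr.exists_ancestor S hS
  have hRn := h.nondegenerate R hR
  have hSR := hm.body_subset hRn
  have hform := h'.isPartition.jumpRes_eq hT' hS hST' hj α V
  -- If both elements at the side descend from `T`, the two traces are values of one continuous flux
  -- and cancel. Otherwise the side lies in a common side of two coarse elements.
  by_cases hRT : R = T
  · subst hRT
    left
    intro x hx
    have hx' : x ∈ S.body := by rw [← hside] at hx; exact side_subset_body j hx
    rw [hform, (hV R hR).fluxTrace_eq hT'n hsub (side_subset_body k hx),
      (hV R hR).fluxTrace_eq hSn hSR hx', sub_self, inner_zero_left, mul_zero]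
  · right
    have hinter : T'.side k ⊆ T.body ∩ R.body :=
      subset_inter ((side_subset_body k).trans hsub)
        (hside ▸ (side_subset_body j).trans hSR)
    obtain ⟨i, l, hl, hsi⟩ := h.exists_common_side hT hR (Ne.symm hRT) hT'n hinter
    refine ⟨i, hsi, fun x hx => ?_⟩
    have hx' : x ∈ S.body := by rw [← hside] at hx; exact side_subset_body j hx
    rw [hform, h.isPartition.jumpRes_eq hT hR hRT hl,
      (hV T hT).fluxTrace_eq hT'n hsub (side_subset_body k hx),
      (hV R hR).fluxTrace_eq hSn hSR hx']
    -- A piece of a side spans the same directions, so the normals agree up to sign, which the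
    -- square ignores.
    have hspan : vectorSpan ℝ (T'.sideVtx k) = vectorSpan ℝ (T.sideVtx i) := by
      have hd := T.typ.pos
      refine Submodule.eq_of_le_of_finrank_eq ?_ (by
        rw [finrank_vectorSpan_sideVtx hd hTn, finrank_vectorSpan_sideVtx hd hT'n])
      rw [← direction_affineSpan, ← direction_affineSpan]
      refine AffineSubspace.direction_le (affineSpan_le.2 ?_)
      exact (sideVtx_subset_side k).trans (hsi.trans (convexHull_subset_affineSpan _))
    rcases normal_eq_or_eq_neg hTn hT'n hspan with e | e
    · rw [e]
    · rw [e, inner_neg_right]; ring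

/-- The children cover their parent, so a point can be followed through the bisections. -/
theorem IsRefinement.exists_descendant_mem (h : IsPartition Ω 𝒯) (hr : IsRefinement 𝒯 𝒯')
    (hT : T ∈ 𝒯) {x : E d} (hx : x ∈ T.body) :
    ∃ T' ∈ 𝒯', (∃ k, IsDescendant k T T') ∧ x ∈ T'.body := by
  induction hr with
  | refl => exact ⟨T, hT, ⟨0, .refl T⟩, hx⟩
  | @tail 𝒮 𝒮' hr hs ih =>
    obtain ⟨S, hS⟩ := hs
    obtain ⟨R, hR, ⟨k, hk⟩, hxR⟩ := ih
    by_cases hRS : R = S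
    · subst hRS
      have hRn := (h.refinement hr).nondegenerate R hR
      have := (isHalf_child₀ hRn).body_union (isHalf_child₁ hRn) R.zero_ne_last.symm
      rw [← this] at hxR
      rcases hxR with hx | hx
      · exact ⟨_, Finset.mem_insert_self _ _, ⟨k + 1, .step hk (Or.inl rfl)⟩, hx⟩
      · exact ⟨_, Finset.mem_insert_of_mem (Finset.mem_insert_self _ _),
          ⟨k + 1, .step hk (Or.inr rfl)⟩, hx⟩
    · exact ⟨R, Finset.mem_insert_of_mem (Finset.mem_insert_of_mem
        (Finset.mem_erase.2 ⟨hRS, hR⟩)), ⟨k, hk⟩, hxR⟩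

/-- The jump of a coarse function on an element which is not refined does not change. -/
theorem IsTriangulation.jumpRes_eq_of_mem_inter (h : IsTriangulation Ω 𝒯)
    (h' : IsTriangulation Ω 𝒯') (hr : IsRefinement 𝒯 𝒯') (hV : ∀ T ∈ 𝒯, HasTrace α V T)
    (hT : T ∈ 𝒯) (hT' : T ∈ 𝒯') (i : Fin (d + 1)) {x : E d} (hx : x ∈ T.side i) :
    jumpRes α 𝒯 V T i x = jumpRes α 𝒯' V T i x := by
  have hTn := h.nondegenerate T hT
  -- The centre identifies neighbours in both meshes. The coarse ancestor of a fine neighbour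
  -- contains it and is therefore a coarse neighbour; conversely, some descendant of a coarse
  -- neighbour contains it.
  obtain ⟨c, hc, hpos⟩ := exists_side_center hTn i
  by_cases hno : ∀ S ∈ 𝒯, S ≠ T → ∀ j, S.sideVtx j ≠ T.sideVtx i
  · rw [jumpRes_eq_zero hno, jumpRes_eq_zero]
    intro S hS hST j hj
    obtain ⟨R, hR, m, hm⟩ := hr.exists_ancestor S hS
    have hSR := hm.body_subset (h.nondegenerate R hR)
    have hRT : R ≠ T := by
      rintro rfl
      exact h'.isPartition.not_body_subset hS hT' hST hSR
    have hcR : c ∈ R.body := hSR (side_subset_body j (by rwa [side, hj]))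
    obtain ⟨l, hl⟩ := h.sideVtx_eq_of_mem hT hR hRT.symm hc hpos hcR
    exact hno R hR hRT l hl
  push Not at hno
  obtain ⟨R, hR, hRT, j, hj⟩ := hno
  have hRn := h.nondegenerate R hR
  have hcR : c ∈ R.body := side_subset_body j (by rwa [side, hj])
  obtain ⟨S, hS, ⟨m, hm⟩, hcS⟩ := hr.exists_descendant_mem h.isPartition hR hcR
  have hSR := hm.body_subset hRn
  have hSn := h'.nondegenerate S hS
  have hST : S ≠ T := by
    rintro rfl
    exact h.isPartition.not_body_subset hT hR hRT.symm hSR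
  obtain ⟨l, hl⟩ := h'.sideVtx_eq_of_mem hT' hS hST.symm hc hpos hcS
  rw [h.isPartition.jumpRes_eq hT hR hRT hj, h'.isPartition.jumpRes_eq hT' hS hST hl,
    (hV R hR).fluxTrace_eq hSn hSR (side_subset_body l (by rwa [side, hl]))]

end Refinement

/-! ### The nonlinear flux -/

/-- The vector field `ξ ↦ a(|ξ|²) ξ` is Lipschitz if `a` and `s a'(s)` are bounded. -/
theorem norm_radial_sub_le {a : ℝ → ℝ} {A B : ℝ} (hA : ∀ s, 0 < s → |a s| ≤ A)
    (hd : ∀ s, 0 < s → DifferentiableAt ℝ a s)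
    (hB : ∀ s, 0 < s → |2 * s * deriv a s| ≤ B) (ξ ζ : E d) :
    ‖a (‖ξ‖ ^ 2) • ξ - a (‖ζ‖ ^ 2) • ζ‖ ≤ (A + B) * ‖ξ - ζ‖ := by
  wlog hle : ‖ζ‖ ≤ ‖ξ‖ generalizing ξ ζ with H
  · rw [norm_sub_rev, norm_sub_rev ξ]
    exact H ζ ξ (le_of_not_ge hle)
  have hB0 : 0 ≤ B := (abs_nonneg _).trans (hB 1 one_pos)
  -- The bounds hold for positive arguments only. The value `a 0` is multiplied by the zero vector
  -- and does not matter.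
  rcases eq_or_ne ξ 0 with rfl | hξ
  · have : ζ = 0 := by simpa using hle
    simp [this]
  have hξ0 : 0 < ‖ξ‖ := norm_pos_iff.2 hξ
  have h1 : ‖a (‖ξ‖ ^ 2) • (ξ - ζ)‖ ≤ A * ‖ξ - ζ‖ := by
    rw [norm_smul, Real.norm_eq_abs]
    exact mul_le_mul_of_nonneg_right (hA _ (by positivity)) (norm_nonneg _)
  have h2 : ‖(a (‖ξ‖ ^ 2) - a (‖ζ‖ ^ 2)) • ζ‖ ≤ B * ‖ξ - ζ‖ := by
    rcases eq_or_ne ζ 0 with rfl | hζ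
    · simp only [smul_zero, norm_zero]; positivity
    have hζ0 : 0 < ‖ζ‖ := norm_pos_iff.2 hζ
    have hder : ∀ t ∈ Icc ‖ζ‖ ‖ξ‖, HasDerivWithinAt (fun t => a (t ^ 2))
        (deriv a (t ^ 2) * (2 * t)) (Icc ‖ζ‖ ‖ξ‖) t := by
      intro t ht
      have ht0 : 0 < t := hζ0.trans_le ht.1
      have h := (hd (t ^ 2) (by positivity)).hasDerivAt.comp t (hasDerivAt_pow 2 t)
      exact (h.congr_deriv (by simp)).hasDerivWithinAt
    -- The derivative of `t ↦ a (t ^ 2)` is at most `B / t`; as `ζ` is the shorter vector, the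
    -- factor `‖ζ‖` compensates its largest value.
    have hbd : ∀ t ∈ Icc ‖ζ‖ ‖ξ‖, ‖deriv a (t ^ 2) * (2 * t)‖ ≤ B / ‖ζ‖ := by
      intro t ht
      have ht0 : 0 < t := hζ0.trans_le ht.1
      have h := hB (t ^ 2) (by positivity)
      have e : 2 * t ^ 2 * deriv a (t ^ 2) = deriv a (t ^ 2) * (2 * t) * t := by ring
      rw [e, abs_mul, abs_of_pos ht0] at h
      rw [Real.norm_eq_abs, le_div_iff₀ hζ0]
      exact (mul_le_mul_of_nonneg_left ht.1 (abs_nonneg _)).trans h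
    have h := (convex_Icc ‖ζ‖ ‖ξ‖).norm_image_sub_le_of_norm_hasDerivWithin_le hder hbd
      (left_mem_Icc.2 hle) (right_mem_Icc.2 hle)
    rw [norm_smul]
    calc ‖a (‖ξ‖ ^ 2) - a (‖ζ‖ ^ 2)‖ * ‖ζ‖ ≤ (B / ‖ζ‖ * ‖‖ξ‖ - ‖ζ‖‖) * ‖ζ‖ :=
          mul_le_mul_of_nonneg_right h (norm_nonneg _)
      _ = B * ‖‖ξ‖ - ‖ζ‖‖ := by field_simp
      _ ≤ B * ‖ξ - ζ‖ := mul_le_mul_of_nonneg_left (abs_norm_sub_norm_le _ _) hB0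
  have e : a (‖ξ‖ ^ 2) • ξ - a (‖ζ‖ ^ 2) • ζ =
      a (‖ξ‖ ^ 2) • (ξ - ζ) + (a (‖ξ‖ ^ 2) - a (‖ζ‖ ^ 2)) • ζ := by module
  rw [e, add_mul]
  exact (norm_add_le _ _).trans (add_le_add h1 h2)

/-- Bounds for the coefficient on an open set. -/
structure IsRegularOn (α : E d → ℝ → ℝ) (C : ℝ) (L : ℝ≥0) (U : Set (E d)) : Prop where
  isOpen : IsOpen U
  nonneg : 0 ≤ C
  differentiableAt : ∀ x ∈ U, ∀ s, 0 < s → DifferentiableAt ℝ (α x) s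
  abs_le : ∀ x ∈ U, ∀ s, 0 < s → |α x s| ≤ C
  abs_deriv_le : ∀ x ∈ U, ∀ s, 0 < s → |2 * s * deriv (α x) s| ≤ C
  lipschitz : ∀ s, 0 < s → LipschitzOnWith L (fun x => α x s) U
  lipschitz_deriv : ∀ s, 0 < s → LipschitzOnWith L (fun x => s * deriv (α x) s) U

theorem IsRegularOn.mono {α : E d → ℝ → ℝ} {C : ℝ} {L : ℝ≥0} {U U' : Set (E d)}
    (h : IsRegularOn α C L U) (hU' : IsOpen U') (hsub : U' ⊆ U) : IsRegularOn α C L U' :=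
  ⟨hU', h.nonneg, fun x hx => h.differentiableAt x (hsub hx), fun x hx => h.abs_le x (hsub hx),
    fun x hx => h.abs_deriv_le x (hsub hx), fun s hs => (h.lipschitz s hs).mono hsub,
    fun s hs => (h.lipschitz_deriv s hs).mono hsub⟩

/-- The function `t ↦ α(x,t²) t` vanishes at zero and its derivative is the expression lying in
`[c_a, C_a]`. By the mean value theorem `α(x,s)` is a value of this derivative, and `2 s D₂α(x,s)`
is a difference of two such values. -/
theorem IsAdmissibleCoefficient.bounds {Ω : Set (E d)} {α : E d → ℝ → ℝ} {c_a C_a : ℝ}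
    (h : IsAdmissibleCoefficient Ω α c_a C_a) (hc : 0 < c_a) {x : E d} (hx : x ∈ Ω) {s : ℝ}
    (hs : 0 < s) : DifferentiableAt ℝ (α x) s ∧ |α x s| ≤ C_a ∧ |2 * s * deriv (α x) s| ≤ C_a := by
  obtain ⟨hC1, hb⟩ := h x hx
  have hdiff : ∀ s, 0 < s → DifferentiableAt ℝ (α x) s := fun s hs =>
    (hC1.differentiableOn one_ne_zero).differentiableAt (Ici_mem_nhds hs)
  set r := Real.sqrt s with hr
  have hr0 : 0 < r := Real.sqrt_pos.2 hs
  have hrs : r ^ 2 = s := Real.sq_sqrt hs.le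
  have hder : ∀ t, 0 < t → HasDerivAt (fun t => α x (t ^ 2) * t)
      (α x (t ^ 2) + 2 * t ^ 2 * deriv (α x) (t ^ 2)) t := by
    intro t ht
    have h1 := (hdiff (t ^ 2) (by positivity)).hasDerivAt.comp t (hasDerivAt_pow 2 t)
    have h2 := h1.mul (hasDerivAt_id t)
    exact h2.congr_deriv (by simp; ring)
  have hcont : ContinuousOn (fun t => α x (t ^ 2) * t) (Icc 0 r) := by
    refine ContinuousOn.mul (hC1.continuousOn.comp (by fun_prop) ?_) continuousOn_id
    intro t _
    exact sq_nonneg t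
  obtain ⟨t, ht, hslope⟩ := exists_hasDerivAt_eq_slope (fun t => α x (t ^ 2) * t) _ hr0 hcont
    (fun t ht => hder t ht.1)
  have hval : α x s = α x (t ^ 2) + 2 * t ^ 2 * deriv (α x) (t ^ 2) := by
    rw [hslope, hrs]; simp [hr0.ne']
  have hbt := hb t ht.1
  have hbr := hb r hr0
  rw [hrs] at hbr
  rw [← hval] at hbt
  refine ⟨hdiff s hs, abs_le.2 ⟨by linarith, by linarith⟩, abs_le.2 ⟨by linarith, by linarith⟩⟩

theorem IsAdmissibleCoefficient.isRegularOn {Ω : Set (E d)} {α : E d → ℝ → ℝ} {c_a C_a : ℝ}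
    (h : IsAdmissibleCoefficient Ω α c_a C_a) (hc : 0 < c_a) (hC : 0 ≤ C_a) {𝒯₀ : Mesh d}
    {L : ℝ≥0}
    (hL : IsPiecewiseLipschitz α 𝒯₀ L) {T : TaggedSimplex d} (hT : T ∈ 𝒯₀)
    (hsub : interior T.body ⊆ Ω) : IsRegularOn α C_a L (interior T.body) :=
  ⟨isOpen_interior, hC, fun _ hx _ hs => (h.bounds hc (hsub hx) hs).1,
    fun _ hx _ hs => (h.bounds hc (hsub hx) hs).2.1, fun _ hx _ hs => (h.bounds hc (hsub hx) hs).2.2,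
    fun s hs => (hL T hT s hs).1, fun s hs => (hL T hT s hs).2⟩

/-- The flux of a function with constant gradient `g`. -/
noncomputable def constFlux (α : E d → ℝ → ℝ) (g : E d) (x : E d) : E d := α x (‖g‖ ^ 2) • g

section ConstFlux

variable {α : E d → ℝ → ℝ} {C : ℝ} {L : ℝ≥0} {U : Set (E d)}

theorem IsRegularOn.norm_constFlux_sub_le (h : IsRegularOn α C L U) {x : E d} (hx : x ∈ U)
    (g g' : E d) : ‖constFlux α g x - constFlux α g' x‖ ≤ 2 * C * ‖g - g'‖ := by
  have := norm_radial_sub_le (h.abs_le x hx) (h.differentiableAt x hx) (h.abs_deriv_le x hx) g g'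
  rwa [← two_mul] at this

/-- For fixed `x` and `y` the radial estimate applies to `s ↦ α(x,s) - α(y,s)` with bounds `A = L |x
- y|` and `B = 2 L |x - y|`, which add up to the factor three. Linearity in `g - g'` is what the
perturbation estimate needs. -/
theorem IsRegularOn.lipschitzOnWith_constFlux_sub (h : IsRegularOn α C L U) (g g' : E d) :
    LipschitzOnWith (3 * L * ‖g - g'‖₊) (fun x => constFlux α g x - constFlux α g' x) U := by
  refine LipschitzOnWith.of_dist_le_mul fun x hx y hy => ?_
  have key := norm_radial_sub_le (a := fun s => α x s - α y s) (A := L * dist x y)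
    (B := 2 * (L * dist x y)) ?_ ?_ ?_ g g'
  · rw [dist_eq_norm]
    have e : constFlux α g x - constFlux α g' x - (constFlux α g y - constFlux α g' y) =
      (α x (‖g‖ ^ 2) - α y (‖g‖ ^ 2)) • g - (α x (‖g'‖ ^ 2) - α y (‖g'‖ ^ 2)) • g' := by
      simp only [constFlux]; module
    rw [e]
    refine key.trans (le_of_eq ?_)
    push_cast
    ring
  · intro s hs
    have := (h.lipschitz s hs).dist_le_mul x hx y hy
    rwa [Real.dist_eq] at this
  · exact fun s hs => (h.differentiableAt x hx s hs).sub (h.differentiableAt y hy s hs)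
  · intro s hs
    have := (h.lipschitz_deriv s hs).dist_le_mul x hx y hy
    rw [Real.dist_eq] at this
    have e : deriv (fun s => α x s - α y s) s = deriv (α x) s - deriv (α y) s :=
      deriv_fun_sub (h.differentiableAt x hx s hs) (h.differentiableAt y hy s hs)
    rw [e, mul_assoc, abs_mul, abs_two, mul_sub]
    linarith

theorem IsRegularOn.lipschitzOnWith_constFlux (h : IsRegularOn α C L U) (g : E d) :
    LipschitzOnWith (3 * L * ‖g‖₊) (constFlux α g) U := by
  have := h.lipschitzOnWith_constFlux_sub g 0
  change LipschitzOnWith _ (fun x => constFlux α g x) U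
  simpa [constFlux] using this

theorem abs_div_le {G : E d → E d} {K : ℝ} {x : E d} (hK : ‖fderiv ℝ G x‖ ≤ K) :
    |div G x| ≤ d * K := by
  rw [div]
  refine (Finset.abs_sum_le_sum_abs _ _).trans ?_
  have : ∀ i ∈ (Finset.univ : Finset (Fin d)),
      |(fderiv ℝ G x (EuclideanSpace.single i 1)) i| ≤ K := by
    intro i _
    calc |(fderiv ℝ G x (EuclideanSpace.single i 1)) i|
        ≤ ‖fderiv ℝ G x (EuclideanSpace.single i 1)‖ :=
          PiLp.norm_apply_le (fderiv ℝ G x (EuclideanSpace.single i 1)) i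
      _ ≤ ‖fderiv ℝ G x‖ * ‖EuclideanSpace.single i (1 : ℝ)‖ := ContinuousLinearMap.le_opNorm _ _
      _ ≤ K := by simpa using hK
  refine (Finset.sum_le_sum this).trans ?_
  simp

theorem measurable_div (G : E d → E d) : Measurable (div G) := by
  refine Finset.measurable_fun_sum _ fun i _ => ?_
  have h := measurable_fderiv_apply_const ℝ G (EuclideanSpace.single i (1 : ℝ))
  exact ((EuclideanSpace.proj (𝕜 := ℝ) i).continuous.measurable).comp h

theorem IsRegularOn.abs_div_constFlux_le (h : IsRegularOn α C L U) (g : E d) {x : E d}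
    (hx : x ∈ U) : |div (constFlux α g) x| ≤ d * (3 * L * ‖g‖) :=
  abs_div_le (norm_fderiv_le_of_lipschitzOn ℝ (h.isOpen.mem_nhds hx)
    (h.lipschitzOnWith_constFlux g))

/-- The derivative of a difference splits only where both fluxes are differentiable, that is almost
everywhere by Rademacher's theorem. There the Lipschitz constant of the difference bounds its
derivative. -/
theorem IsRegularOn.ae_abs_div_constFlux_sub_le (h : IsRegularOn α C L U) (g g' : E d) :
    ∀ᵐ x ∂(volume.restrict U),
      |div (constFlux α g) x - div (constFlux α g') x| ≤ d * (3 * L * ‖g - g'‖) := by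
  rw [ae_restrict_iff' h.isOpen.measurableSet]
  filter_upwards [(h.lipschitzOnWith_constFlux g).ae_differentiableWithinAt_of_mem (μ := volume),
    (h.lipschitzOnWith_constFlux g').ae_differentiableWithinAt_of_mem (μ := volume)] with x h1 h2 hx
  have hU := h.isOpen.mem_nhds hx
  have h1 := (h1 hx).differentiableAt hU
  have h2 := (h2 hx).differentiableAt hU
  have e : div (constFlux α g) x - div (constFlux α g') x =
      div (fun x => constFlux α g x - constFlux α g' x) x := by
    simp only [div, ← Finset.sum_sub_distrib]
    rw [fderiv_fun_sub h1 h2]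
    simp
  rw [e]
  exact abs_div_le (norm_fderiv_le_of_lipschitzOn ℝ hU (h.lipschitzOnWith_constFlux_sub g g'))

end ConstFlux

/-! ### Finite element functions -/

/-- `V` has the constant gradient `g` in the interior of `T`. -/
def HasConstGradient (V : E d → ℝ) (T : TaggedSimplex d) (g : E d) : Prop :=
  ∀ x ∈ interior T.body, HasGradientAt V g x

section ConstGradient

variable {α : E d → ℝ → ℝ} {f : E d → ℝ} {C : ℝ} {L : ℝ≥0} {V W : E d → ℝ}
  {T : TaggedSimplex d} {g g' : E d}

theorem exists_hasConstGradient {A : E d →ᵃ[ℝ] ℝ} (hA : ∀ x ∈ T.body, V x = A x) :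
    ∃ g, HasConstGradient V T g := by
  let l : E d →L[ℝ] ℝ := LinearMap.toContinuousLinearMap A.linear
  refine ⟨(InnerProductSpace.toDual ℝ (E d)).symm l, fun x hx => ?_⟩
  rw [hasGradientAt_iff_hasFDerivAt, LinearIsometryEquiv.apply_symm_apply]
  have h1 : HasFDerivAt (fun y => l y + A 0) l x := l.hasFDerivAt.add_const _
  refine h1.congr_of_eventuallyEq ?_
  filter_upwards [isOpen_interior.mem_nhds hx] with y hy
  rw [hA y (interior_subset hy), A.decomp]
  simp [l]

theorem HasConstGradient.gradient_eq (h : HasConstGradient V T g) {x : E d}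
    (hx : x ∈ interior T.body) : gradient V x = g := (h x hx).gradient

theorem HasConstGradient.gradient_sub_eq (h : HasConstGradient V T g)
    (h' : HasConstGradient W T g') {x : E d} (hx : x ∈ interior T.body) :
    gradient (fun x => V x - W x) x = g - g' := by
  refine HasGradientAt.gradient ?_
  have h1 := (h x hx).hasFDerivAt
  have h2 := (h' x hx).hasFDerivAt
  rw [hasGradientAt_iff_hasFDerivAt, map_sub]
  exact h1.sub h2

theorem HasConstGradient.flux_eq (h : HasConstGradient V T g) {x : E d}
    (hx : x ∈ interior T.body) : flux α V x = constFlux α g x := by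
  rw [flux, h.gradient_eq hx, constFlux]

theorem HasConstGradient.div_flux_eq (h : HasConstGradient V T g) {x : E d}
    (hx : x ∈ interior T.body) : div (flux α V) x = div (constFlux α g) x := by
  have : flux α V =ᶠ[𝓝 x] constFlux α g := by
    filter_upwards [isOpen_interior.mem_nhds hx] with y hy
    exact h.flux_eq hy
  rw [div, div, this.fderiv_eq]

/-- A Lipschitz map on the open element extends continuously to the whole space. -/
theorem IsRegularOn.hasTrace (hα : IsRegularOn α C L (interior T.body))
    (h : HasConstGradient V T g) : HasTrace α V T := by
  intro x _
  obtain ⟨G, hG, hEq⟩ := (hα.lipschitzOnWith_constFlux g).extend_finite_dimension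
  refine ⟨G x, (hG.continuous.continuousAt.tendsto.mono_left
    (nhdsWithin_le_nhds (s := interior T.body))).congr' ?_⟩
  filter_upwards [self_mem_nhdsWithin] with y hy
  rw [h.flux_eq hy, hEq hy]

theorem IsRegularOn.norm_fluxTrace_sub_le (hα : IsRegularOn α C L (interior T.body))
    (hT : AffineIndependent ℝ T.vtx) (h : HasConstGradient V T g) (h' : HasConstGradient W T g')
    {x : E d} (hx : x ∈ T.body) :
    ‖fluxTrace α V T x - fluxTrace α W T x‖ ≤ 2 * C * ‖g - g'‖ := by
  have h1 := (hα.hasTrace h).tendsto hx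
  have h2 := (hα.hasTrace h').tendsto hx
  have : (𝓝[interior T.body] x).NeBot := by
    rw [← mem_closure_iff_nhdsWithin_neBot, closure_interior_body hT]; exact hx
  refine le_of_tendsto (h1.sub h2).norm ?_
  filter_upwards [self_mem_nhdsWithin] with y hy
  rw [h.flux_eq hy, h'.flux_eq hy]
  exact hα.norm_constFlux_sub_le hy g g'

theorem IsRegularOn.memLp_elemRes (hα : IsRegularOn α C L (interior T.body))
    (h : HasConstGradient V T g) (hf : MemLp f 2 (volume.restrict (interior T.body))) :
    MemLp (elemRes α f V) 2 (volume.restrict T.body) := by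
  rw [Measure.restrict_congr_set body_ae_eq_interior]
  have : IsFiniteMeasure (volume.restrict (interior T.body)) :=
    ⟨by rw [Measure.restrict_apply_univ]
        exact (measure_mono interior_subset).trans_lt volume_body_lt_top⟩
  have h1 : MemLp (div (flux α V)) 2 (volume.restrict (interior T.body)) := by
    refine MemLp.of_bound (measurable_div _).aestronglyMeasurable (d * (3 * L * ‖g‖)) ?_
    rw [ae_restrict_iff' isOpen_interior.measurableSet]
    filter_upwards with x hx
    rw [h.div_flux_eq hx]
    exact hα.abs_div_constFlux_le g hx
  exact h1.neg.sub hf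

theorem IsRegularOn.ae_abs_elemRes_sub_le (hα : IsRegularOn α C L (interior T.body))
    (h : HasConstGradient V T g) (h' : HasConstGradient W T g') :
    ∀ᵐ x ∂(volume.restrict T.body),
      |elemRes α f V x - elemRes α f W x| ≤ d * (3 * L * ‖g - g'‖) := by
  rw [Measure.restrict_congr_set body_ae_eq_interior]
  filter_upwards [hα.ae_abs_div_constFlux_sub_le g g',
    ae_restrict_mem isOpen_interior.measurableSet] with x hx hmem
  have e : elemRes α f V x - elemRes α f W x =
      -(div (constFlux α g) x - div (constFlux α g') x) := by
    rw [elemRes, elemRes, h.div_flux_eq hmem, h'.div_flux_eq hmem]; ring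
  rw [e, abs_neg]
  exact hx

end ConstGradient

/-! ### Consequences of shape regularity -/

namespace TaggedSimplex

variable {T T' : TaggedSimplex d}

theorem dist_le_diam_body {x y : E d} (hx : x ∈ T.body) (hy : y ∈ T.body) :
    dist x y ≤ Metric.diam T.body :=
  Metric.dist_le_diam_of_mem isCompact_body.isBounded hx hy

/-- A ball in a simplex is not larger than any of the sides. -/
theorem two_mul_radius_le_diam_side (hd : 2 ≤ d) (hT : AffineIndependent ℝ T.vtx)
    (i : Fin (d + 1)) {x : E d} {r : ℝ} (hr : 0 ≤ r) (hball : Metric.closedBall x r ⊆ T.body) :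
    2 * r ≤ Metric.diam (T.side i) := by
  have hcard : 1 < (T.sideVtx i).ncard := by rw [ncard_sideVtx hT]; omega
  obtain ⟨a, b, ha, hb, hab⟩ := (Set.one_lt_ncard_iff
    ((finite_range T.vtx).subset (sideVtx_subset i))).1 hcard
  set u : E d := ‖a - b‖⁻¹ • (a - b) with hu
  have hab0 : ‖a - b‖ ≠ 0 := norm_ne_zero_iff.2 (sub_ne_zero.2 hab)
  have hu1 : ‖u‖ = 1 := by
    rw [hu, norm_smul, norm_inv, norm_norm, inv_mul_cancel₀ hab0]
  have hcu : ((T.basis hT).coord i).linear u = 0 := by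
    rw [hu, map_smul, ← vsub_eq_sub, coord_linear_eq_zero hT (vsub_mem_vectorSpan ℝ ha hb), smul_zero]
  have hc : ∀ t : ℝ, (T.basis hT).coord i (t • u + x) = (T.basis hT).coord i x := by
    intro t
    change (T.basis hT).coord i (t • u +ᵥ x) = _
    rw [AffineMap.map_vadd, map_smul, hcu, smul_zero, zero_vadd]
  have hmem : ∀ t : ℝ, |t| ≤ r → t • u + x ∈ T.body := by
    intro t ht
    refine hball ?_
    rw [Metric.mem_closedBall, dist_eq_norm, add_sub_cancel_right, norm_smul, hu1, mul_one]
    exact ht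
  have hp := hmem r (by rw [abs_of_nonneg hr])
  have hm := hmem (-r) (by rw [abs_neg, abs_of_nonneg hr])
  set l := (T.basis hT).coord i x with hl
  have hdist : ‖(r • u + x) - (-r • u + x)‖ = 2 * r := by
    have : (r • u + x) - (-r • u + x) = (2 * r) • u := by module
    rw [this, norm_smul, hu1, mul_one, Real.norm_eq_abs, abs_of_nonneg (by positivity)]
  have hl0 : 0 ≤ l := by rw [← hc r]; exact (mem_body_iff hT).1 hp i
  -- The ball has a diameter parallel to an edge of the side, at constant height `l`. Projection
  -- from the opposite vertex onto the side stretches it by `(1 - l)⁻¹ ≥ 1`. At height one the level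
  -- set is just the vertex, and the ball is a point.
  rcases lt_or_ge l 1 with hl1 | hl1
  · have h1l : 0 < 1 - l := by linarith
    have key : ∀ y ∈ T.body, (T.basis hT).coord i y = l →
        (1 - l)⁻¹ • (y - T.vtx i) + T.vtx i ∈ T.side i := by
      intro y hy hyl
      rw [mem_side_iff hT, mem_body_iff hT]
      have hi : (T.basis hT).coord i ((1 - l)⁻¹ • (y - T.vtx i) + T.vtx i) = 0 := by
        rw [coord_smul_sub_add, coord_self, hyl]
        field_simp
        ring
      refine ⟨fun k => ?_, hi⟩
      by_cases hk : k = i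
      · rw [hk, hi]
      · rw [coord_smul_sub_add, coord_ne hT hk]
        have := (mem_body_iff hT).1 hy k
        rw [zero_add, sub_zero]
        positivity
    have h1 := Metric.dist_le_diam_of_mem (isCompact_side i).isBounded (key _ hp (hc r))
      (key _ hm (hc (-r)))
    rw [dist_eq_norm] at h1
    have e : (1 - l)⁻¹ • (r • u + x - T.vtx i) + T.vtx i -
        ((1 - l)⁻¹ • (-r • u + x - T.vtx i) + T.vtx i) =
        (1 - l)⁻¹ • ((r • u + x) - (-r • u + x)) := by module
    rw [e, norm_smul, hdist, norm_inv, Real.norm_of_nonneg h1l.le] at h1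
    refine le_trans ?_ h1
    have : 1 ≤ (1 - l)⁻¹ := (one_le_inv₀ h1l).2 (by linarith)
    nlinarith
  · have key : ∀ y ∈ T.body, (T.basis hT).coord i y = l → y = T.vtx i := by
      intro y hy hyl
      have hsum := (T.basis hT).sum_coord_apply_eq_one y
      rw [← Finset.add_sum_erase _ _ (Finset.mem_univ i), hyl] at hsum
      have hnn : ∀ k ∈ Finset.univ.erase i, 0 ≤ (T.basis hT).coord k y :=
        fun k _ => (mem_body_iff hT).1 hy k
      have h0 := (Finset.sum_eq_zero_iff_of_nonneg hnn).1
        (le_antisymm (by linarith) (Finset.sum_nonneg hnn))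
      refine (T.basis hT).ext_elem fun k => ?_
      by_cases hk : k = i
      · subst hk
        rw [coord_self, hyl]
        have := Finset.sum_nonneg hnn
        linarith
      · rw [coord_ne hT hk]
        exact h0 k (by simpa using hk)
    rw [key _ hp (hc r), key _ hm (hc (-r)), sub_self, norm_zero] at hdist
    rw [← hdist]
    exact Metric.diam_nonneg

theorem inradius_le {M : ℝ} (hM : 0 ≤ M)
    (h : ∀ r x, 0 ≤ r → Metric.closedBall x r ⊆ T.body → r ≤ M) : T.inradius ≤ M :=
  Real.sSup_le (by rintro r ⟨hr, x, hx⟩; exact h r x hr hx) hM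

theorem inradius_nonneg : 0 ≤ T.inradius :=
  Real.sSup_nonneg (by rintro r ⟨hr, -⟩; exact hr)

/-- The volume of the unit ball. -/
noncomputable def unitBallVol (n : ℕ) : ℝ := (volume (Metric.ball (0 : E n) 1)).toReal

theorem unitBallVol_pos (n : ℕ) : 0 < unitBallVol n :=
  ENNReal.toReal_pos (Metric.measure_ball_pos _ _ one_pos).ne' measure_ball_lt_top.ne

theorem volume_closedBall_toReal (x : E d) {r : ℝ} (hr : 0 ≤ r) :
    (volume (Metric.closedBall x r)).toReal = r ^ d * unitBallVol d := by
  rw [Measure.addHaar_closedBall _ _ hr, ENNReal.toReal_mul, finrank_euclideanSpace,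
    Fintype.card_fin, ENNReal.toReal_ofReal (by positivity), unitBallVol]

theorem radius_le (hd : 0 < d) {r : ℝ} (hr : 0 ≤ r) {x : E d}
    (hx : Metric.closedBall x r ⊆ T.body) :
    r ≤ ((volume T.body).toReal / unitBallVol d) ^ (1 / (d : ℝ)) := by
  have h1 := ENNReal.toReal_mono volume_body_lt_top.ne (measure_mono (μ := volume) hx)
  rw [volume_closedBall_toReal x hr] at h1
  rw [one_div, Real.le_rpow_inv_iff_of_pos hr (div_nonneg ENNReal.toReal_nonneg
    (unitBallVol_pos d).le) (by positivity), Real.rpow_natCast, le_div_iff₀ (unitBallVol_pos d)]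
  exact h1

/-- Comparing volumes bounds the admissible radii; without a bound the supremum would be zero by
convention. -/
theorem le_inradius (hd : 0 < d) {r : ℝ} (hr : 0 ≤ r) {x : E d}
    (hx : Metric.closedBall x r ⊆ T.body) : r ≤ T.inradius :=
  le_csSup ⟨_, by rintro _ ⟨hr, x, hx⟩; exact radius_le hd hr hx⟩ ⟨hr, x, hx⟩

theorem inradius_pow_mul_le (hd : 0 < d) :
    T.inradius ^ d * unitBallVol d ≤ (volume T.body).toReal := by
  have hω := unitBallVol_pos d
  have hv : 0 ≤ (volume T.body).toReal / unitBallVol d := by positivity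
  have h : T.inradius ≤ ((volume T.body).toReal / unitBallVol d) ^ (1 / (d : ℝ)) :=
    inradius_le (by positivity) fun r x hr hx => radius_le hd hr hx
  rw [one_div, Real.le_rpow_inv_iff_of_pos inradius_nonneg hv (by positivity), Real.rpow_natCast,
    le_div_iff₀ hω] at h
  exact h

theorem size_le_diam (hd : 0 < d) :
    T.size ≤ unitBallVol d ^ (1 / (d : ℝ)) * Metric.diam T.body := by
  have hD : 0 ≤ Metric.diam T.body := Metric.diam_nonneg
  have hsub : T.body ⊆ Metric.closedBall (T.vtx 0) (Metric.diam T.body) := fun x hx =>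
    dist_le_diam_body hx (vtx_mem_body 0)
  have h := ENNReal.toReal_mono measure_closedBall_lt_top.ne (measure_mono (μ := volume) hsub)
  rw [volume_closedBall_toReal _ hD] at h
  have hω := (unitBallVol_pos d).le
  calc T.size ≤ (Metric.diam T.body ^ d * unitBallVol d) ^ (1 / (d : ℝ)) :=
        Real.rpow_le_rpow ENNReal.toReal_nonneg h (by positivity)
    _ = _ := by
        rw [Real.mul_rpow (by positivity) hω, one_div, Real.pow_rpow_inv_natCast hD hd.ne', mul_comm]

/-- The constant in the scaling estimate for neighbouring elements. -/
noncomputable def sideConst (d : ℕ) (κ : ℝ) : ℝ :=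
  unitBallVol d ^ (1 / (d : ℝ)) * unitBallVol (d - 1) * κ ^ (d + 1) / unitBallVol d

theorem sideConst_nonneg {κ : ℝ} (hκ : 0 ≤ κ) : 0 ≤ sideConst d κ := by
  have := (unitBallVol_pos d).le
  have := (unitBallVol_pos (d - 1)).le
  unfold sideConst
  positivity

/-- Everything is compared with the diameter `D` of the common side: `H_T` is at most a multiple of
`diam T ≤ κ ρ_T ≤ κ D`, the side has measure at most a multiple of `D^(d-1)`, and `D ≤ diam T' ≤ κ
ρ_T'` with a ball of radius `ρ_T'` fitting into the volume of `T'`. This is used for the neighbour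
as well as for `T' = T`. -/
theorem size_mul_measure_side_le (hd : 2 ≤ d) (hT : AffineIndependent ℝ T.vtx)
    {κ : ℝ} (hκ : 0 ≤ κ) (h : Metric.diam T.body ≤ κ * T.inradius)
    (h' : Metric.diam T'.body ≤ κ * T'.inradius) {i j : Fin (d + 1)}
    (hj : T'.sideVtx j = T.sideVtx i) :
    T.size * (μHE[d - 1] (T.side i)).toReal ≤ sideConst d κ * (volume T'.body).toReal := by
  have hω := unitBallVol_pos d
  have hω' := unitBallVol_pos (d - 1)
  set D := Metric.diam (T.side i) with hD
  have hD0 : 0 ≤ D := Metric.diam_nonneg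
  have hin : T.inradius ≤ D := inradius_le hD0 fun r x hr hx => by
    have := two_mul_radius_le_diam_side hd hT i hr hx
    linarith
  have hDT' : D ≤ Metric.diam T'.body := by
    have : T.side i = T'.side j := by rw [side, side, hj]
    rw [hD, this]
    exact Metric.diam_mono (side_subset_body j) isCompact_body.isBounded
  have hS : (μHE[d - 1] (T.side i)).toReal ≤ D ^ (d - 1) * unitBallVol (d - 1) := by
    have h1 := measure_side_le (by omega) hT i (r := D) fun x hx y hy =>
      Metric.dist_le_diam_of_mem (isCompact_side i).isBounded hx hy
    have h2 := ENNReal.toReal_mono (ENNReal.mul_lt_top ENNReal.ofReal_lt_top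
      measure_ball_lt_top).ne h1
    rwa [ENNReal.toReal_mul, ENNReal.toReal_ofReal (by positivity)] at h2
  have hsize : T.size ≤ unitBallVol d ^ (1 / (d : ℝ)) * (κ * D) :=
    (size_le_diam (by omega)).trans (mul_le_mul_of_nonneg_left
      (h.trans (mul_le_mul_of_nonneg_left hin hκ)) (by positivity))
  have hvol : D ^ d ≤ κ ^ d * ((volume T'.body).toReal / unitBallVol d) := by
    calc D ^ d ≤ (κ * T'.inradius) ^ d := pow_le_pow_left₀ hD0 (hDT'.trans h') d
      _ = κ ^ d * T'.inradius ^ d := mul_pow _ _ _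
      _ ≤ _ := by
        refine mul_le_mul_of_nonneg_left ?_ (by positivity)
        rw [le_div_iff₀ hω]
        exact inradius_pow_mul_le (by omega)
  calc T.size * (μHE[d - 1] (T.side i)).toReal
      ≤ (unitBallVol d ^ (1 / (d : ℝ)) * (κ * D)) * (D ^ (d - 1) * unitBallVol (d - 1)) :=
        mul_le_mul hsize hS ENNReal.toReal_nonneg (by positivity)
    _ = unitBallVol d ^ (1 / (d : ℝ)) * unitBallVol (d - 1) * κ * D ^ d := by
        obtain ⟨n, rfl⟩ : ∃ n, d = n + 1 := ⟨d - 1, by omega⟩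
        rw [Nat.add_sub_cancel, pow_succ D n]; ring
    _ ≤ unitBallVol d ^ (1 / (d : ℝ)) * unitBallVol (d - 1) * κ *
          (κ ^ d * ((volume T'.body).toReal / unitBallVol d)) :=
        mul_le_mul_of_nonneg_left hvol (by positivity)
    _ = sideConst d κ * (volume T'.body).toReal := by
        rw [sideConst, pow_succ]; ring

/-- A quadratic form which dominates the squares of the barycentric coordinates and is dominated by
the edges bounds the shape of a simplex. -/
theorem diam_div_inradius_le (hd : 0 < d) (hT : AffineIndependent ℝ T.vtx) (M : E d →ₗ[ℝ] E d)
    {K N s : ℝ} (hs : 0 < s) (hN : 0 < N) (hK : ∀ v, ‖v‖ ≤ K * ‖M v‖) (hMN : ∀ v, ‖M v‖ ≤ N * ‖v‖)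
    (hedge : ∀ i j, ‖M (T.vtx i - T.vtx j)‖ ^ 2 ≤ 3 * s)
    (hcoord : ∀ x y k, s * ((T.basis hT).coord k x - (T.basis hT).coord k y) ^ 2 ≤
      8 * ‖M (x - y)‖ ^ 2) :
    Metric.diam T.body / T.inradius ≤ K * Real.sqrt 24 * N * (d + 1) := by
  have hK0 : 0 ≤ K := by
    have hne : T.vtx 0 - T.vtx (Fin.last d) ≠ 0 :=
      sub_ne_zero.2 fun e => T.zero_ne_last (hT.injective e)
    by_contra! hlt
    have h1 := hK (T.vtx 0 - T.vtx (Fin.last d))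
    have h2 := norm_pos_iff.2 hne
    have h3 := norm_nonneg (M (T.vtx 0 - T.vtx (Fin.last d)))
    nlinarith
  have hdiam : Metric.diam T.body ≤ K * Real.sqrt (3 * s) := by
    rw [body, convexHull_diam]
    refine Metric.diam_le_of_forall_dist_le (by positivity) ?_
    rintro _ ⟨i, rfl⟩ _ ⟨j, rfl⟩
    rw [dist_eq_norm]
    refine (hK _).trans (mul_le_mul_of_nonneg_left ?_ hK0)
    exact Real.le_sqrt_of_sq_le (hedge i j)
  -- Within this distance of the barycentre no coordinate changes by more than its value `1 / (d +
  -- 1)` there. Together with the bound `√(3 s)` for the edges this gives `√24`.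
  set r := Real.sqrt (s / 8) / (N * (d + 1)) with hr
  have hr0 : 0 < r := by positivity
  obtain ⟨c, hc⟩ : ∃ c, ∀ k, (T.basis hT).coord k c = 1 / (d + 1) := by
    refine ⟨Finset.univ.centroid ℝ T.vtx, fun k => ?_⟩
    have := (T.basis hT).coord_apply_centroid (s := Finset.univ) (Finset.mem_univ k)
    rw [coe_basis] at this
    rw [this]
    simp
  have hball : Metric.closedBall c r ⊆ T.body := by
    intro x hx
    rw [Metric.mem_closedBall, dist_eq_norm] at hx
    rw [mem_body_iff hT]
    intro k
    have h1 := hcoord x c k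
    have h2 : ‖M (x - c)‖ ≤ Real.sqrt (s / 8) / (d + 1) := by
      refine (hMN _).trans ((mul_le_mul_of_nonneg_left hx hN.le).trans (le_of_eq ?_))
      rw [hr]; field_simp
    have h3 : ‖M (x - c)‖ ^ 2 ≤ s / 8 / (d + 1) ^ 2 := by
      calc _ ≤ (Real.sqrt (s / 8) / (d + 1)) ^ 2 := pow_le_pow_left₀ (norm_nonneg _) h2 2
        _ = _ := by rw [div_pow, Real.sq_sqrt (by positivity)]
    have h4 : ((T.basis hT).coord k x - 1 / (d + 1)) ^ 2 ≤ (1 / (d + 1 : ℝ)) ^ 2 := by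
      rw [hc] at h1
      have e : 8 * (s / 8 / ((d : ℝ) + 1) ^ 2) = s * (1 / (d + 1 : ℝ)) ^ 2 := by
        field_simp
      have : s * ((T.basis hT).coord k x - 1 / (d + 1)) ^ 2 ≤ s * (1 / (d + 1 : ℝ)) ^ 2 := by
        linarith
      exact le_of_mul_le_mul_left this hs
    have h5 := abs_le_of_sq_le_sq h4 (by positivity)
    linarith [(abs_le.1 h5).1]
  have hin : r ≤ T.inradius := le_inradius hd hr0.le hball
  rw [div_le_iff₀ (hr0.trans_le hin)]
  refine hdiam.trans ?_
  calc K * Real.sqrt (3 * s) = K * Real.sqrt 24 * N * (d + 1) * r := by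
        have e : 3 * s = 24 * (s / 8) := by ring
        rw [e, Real.sqrt_mul (by norm_num), hr]
        field_simp
    _ ≤ _ := mul_le_mul_of_nonneg_left hin (by positivity)

theorem inradius_pos (hd : 0 < d) (hT : AffineIndependent ℝ T.vtx) : 0 < T.inradius := by
  obtain ⟨x, hx⟩ := interior_nonempty hT
  obtain ⟨r, hr, hball⟩ := Metric.nhds_basis_closedBall.mem_iff.1 (isOpen_interior.mem_nhds hx)
  exact hr.trans_le (le_inradius hd hr.le (hball.trans interior_subset))

end TaggedSimplex
/-! ### Shape regularity of bisection in two and three dimensions -/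

/-- Squared length in the metric pulled back along `M`. -/
noncomputable def sqLen (M : E d →ₗ[ℝ] E d) (v : E d) : ℝ := ‖M v‖ ^ 2

theorem sqLen_sub_comm (M : E d →ₗ[ℝ] E d) (v w : E d) : sqLen M (v - w) = sqLen M (w - v) := by
  rw [sqLen, sqLen, map_sub, map_sub, norm_sub_rev]

theorem sqLen_midpoint_sub (M : E d →ₗ[ℝ] E d) (a b z : E d) :
    sqLen M (midpoint ℝ a b - z) =
      1 / 2 * sqLen M (a - z) + 1 / 2 * sqLen M (b - z) - 1 / 4 * sqLen M (a - b) := by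
  have e1 : M (midpoint ℝ a b - z) = (1 / 2 : ℝ) • (M (a - z) + M (b - z)) := by
    rw [← map_add, ← map_smul, midpoint_eq_smul_add, invOf_eq_inv]
    congr 1; module
  have e2 : M (a - b) = M (a - z) - M (b - z) := by rw [← map_sub]; congr 1; abel
  rw [sqLen, sqLen, sqLen, sqLen, e1, e2, norm_smul, mul_pow, norm_add_sq_real, norm_sub_sq_real]
  norm_num
  ring

/-- By polarization the inner products of the edges at `p` are determined by squared lengths, so
edge lengths alone give the whole quadratic form. -/
theorem sqLen_combination (M : E d →ₗ[ℝ] E d) (p a b c : E d) (r s t : ℝ) :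
    sqLen M (r • (a - p) + s • (b - p) + t • (c - p)) =
      r ^ 2 * sqLen M (p - a) + s ^ 2 * sqLen M (p - b) + t ^ 2 * sqLen M (p - c)
      + r * s * (sqLen M (p - a) + sqLen M (p - b) - sqLen M (a - b))
      + r * t * (sqLen M (p - a) + sqLen M (p - c) - sqLen M (a - c))
      + s * t * (sqLen M (p - b) + sqLen M (p - c) - sqLen M (b - c)) := by
  have e : ∀ v w : E d, M (v - w) = M (v - p) - M (w - p) := by
    intro v w; rw [← map_sub]; congr 1; abel
  rw [sqLen_sub_comm M p a, sqLen_sub_comm M p b, sqLen_sub_comm M p c]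
  simp only [sqLen]
  rw [e a b, e a c, e b c, map_add, map_add, map_smul, map_smul, map_smul]
  generalize M (a - p) = u
  generalize M (b - p) = v
  generalize M (c - p) = w
  simp only [norm_sub_sq_real, norm_add_sq_real, inner_add_left, inner_smul_left, inner_smul_right,
    norm_smul, mul_pow, Real.norm_eq_abs, sq_abs, conj_trivial]
  ring

namespace TaggedSimplex

/-- The edges from one vertex form a basis, so their images can be prescribed. In the metric pulled
back along `M` the simplex is then congruent to the reference simplex, and since midpoints are
affine this persists under bisection. -/
theorem exists_linearMap_vtx {T : TaggedSimplex d} (hT : AffineIndependent ℝ T.vtx)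
    (ref : Fin (d + 1) → E d) :
    ∃ M : E d →ₗ[ℝ] E d, ∀ i j, M (T.vtx i - T.vtx j) = ref i - ref j := by
  let b := (T.basis hT).basisOf 0
  let M : E d →ₗ[ℝ] E d := b.constr ℝ fun j => ref j - ref 0
  have h0 : ∀ i, M (T.vtx i - T.vtx 0) = ref i - ref 0 := by
    intro i
    by_cases hi : i = 0
    · simp [hi]
    · have := b.constr_basis ℝ (fun j => ref j - ref 0) ⟨i, hi⟩
      have e : b ⟨i, hi⟩ = T.vtx i - T.vtx 0 := by
        simp [b]
      rwa [e] at this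
  refine ⟨M, fun i j => ?_⟩
  have : T.vtx i - T.vtx j = (T.vtx i - T.vtx 0) - (T.vtx j - T.vtx 0) := by abel
  rw [this, map_sub, h0, h0]
  abel

/-- The difference of two points in terms of the differences of their barycentric coordinates. -/
theorem sub_eq_sum_coord {T : TaggedSimplex d} (hT : AffineIndependent ℝ T.vtx) (x y : E d) :
    x - y = ∑ k, ((T.basis hT).coord k x - (T.basis hT).coord k y) • (T.vtx k - T.vtx 0) ∧
      ∑ k, ((T.basis hT).coord k x - (T.basis hT).coord k y) = 0 := by
  have hs : ∑ k, ((T.basis hT).coord k x - (T.basis hT).coord k y) = 0 := by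
    rw [Finset.sum_sub_distrib, AffineBasis.sum_coord_apply_eq_one,
      AffineBasis.sum_coord_apply_eq_one, sub_self]
  refine ⟨?_, hs⟩
  simp_rw [smul_sub]
  rw [Finset.sum_sub_distrib, ← Finset.sum_smul, hs, zero_smul, sub_zero]
  simp_rw [sub_smul]
  rw [Finset.sum_sub_distrib]
  have h := (T.basis hT).linear_combination_coord_eq_self
  rw [coe_basis] at h
  rw [h, h]

/-- The condition that an invariant of the bisection has to meet to bound the shape: up to a factor,
the metric pulled back along `M` is comparable to the simplex. -/
def IsShaped (M : E d →ₗ[ℝ] E d) (T : TaggedSimplex d) : Prop :=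
  ∃ s : ℝ, 0 < s ∧ (∀ i j, sqLen M (T.vtx i - T.vtx j) ≤ 3 * s) ∧
    ∀ (hT : AffineIndependent ℝ T.vtx) x y k,
      s * ((T.basis hT).coord k x - (T.basis hT).coord k y) ^ 2 ≤ 8 * sqLen M (x - y)

/-- The squared lengths of the edges of a triangle. -/
def TrianglePattern (M : E 2 →ₗ[ℝ] E 2) (s : ℝ) (T : TaggedSimplex 2) : Prop :=
  sqLen M (T.vtx 0 - T.vtx 1) = s ∧ sqLen M (T.vtx 0 - T.vtx 2) = 2 * s ∧
    sqLen M (T.vtx 1 - T.vtx 2) = s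

/-- The squared lengths of the edges of a tetrahedron. -/
def EdgeLengths (M : E 3 →ₗ[ℝ] E 3) (T : TaggedSimplex 3) (l₀₁ l₀₂ l₀₃ l₁₂ l₁₃ l₂₃ : ℝ) : Prop :=
  sqLen M (T.vtx 0 - T.vtx 1) = l₀₁ ∧ sqLen M (T.vtx 0 - T.vtx 2) = l₀₂ ∧
    sqLen M (T.vtx 0 - T.vtx 3) = l₀₃ ∧ sqLen M (T.vtx 1 - T.vtx 2) = l₁₂ ∧
    sqLen M (T.vtx 1 - T.vtx 3) = l₁₃ ∧ sqLen M (T.vtx 2 - T.vtx 3) = l₂₃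

/-- The possible edge lengths of the descendants of a Kuhn simplex. -/
def TetrahedronPattern (M : E 3 →ₗ[ℝ] E 3) (s : ℝ) (T : TaggedSimplex 3) : Prop :=
  (T.typ = 0 ∧ EdgeLengths M T s (2 * s) (3 * s) s (2 * s) s) ∨
  (T.typ = 1 ∧ EdgeLengths M T (3 / 4 * s) s (2 * s) (3 / 4 * s) (3 / 4 * s) s) ∨
  (T.typ = 2 ∧ EdgeLengths M T (1 / 2 * s) (3 / 4 * s) s (1 / 4 * s) (1 / 2 * s) (3 / 4 * s))

/-! ### Triangles: halves of right isosceles triangles -/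

section Two

variable {T C : TaggedSimplex 2} {M : E 2 →ₗ[ℝ] E 2} {s : ℝ}

/-- For legs of squared length `s` the quadratic form is `s ((w₁ + w₂)² + w₂²)`, which controls
`w₁`, `w₂` and `w₀ = -(w₁ + w₂)`. -/
theorem TrianglePattern.isShaped (hs : 0 < s) (h : TrianglePattern M s T) : IsShaped M T := by
  obtain ⟨h01, h02, h12⟩ := h
  refine ⟨s, hs, ?_, ?_⟩
  · have h10 := (sqLen_sub_comm M (T.vtx 1) (T.vtx 0)).trans h01
    have h20 := (sqLen_sub_comm M (T.vtx 2) (T.vtx 0)).trans h02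
    have h21 := (sqLen_sub_comm M (T.vtx 2) (T.vtx 1)).trans h12
    intro i j
    fin_cases i <;> fin_cases j <;>
      first
        | (simp only [Fin.zero_eta, Fin.mk_one, Fin.reduceFinMk, *]; linarith)
        | (simp [sqLen]; linarith)
  · intro hT x y k
    obtain ⟨e, hsum⟩ := sub_eq_sum_coord hT x y
    obtain ⟨w, hw⟩ : ∃ w : Fin 3 → ℝ, ∀ k, (T.basis hT).coord k x - (T.basis hT).coord k y = w k :=
      ⟨_, fun _ => rfl⟩
    simp_rw [hw] at e hsum ⊢
    rw [Fin.sum_univ_three] at e hsum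
    have hq := sqLen_combination M (T.vtx 0) (T.vtx 1) (T.vtx 2) (T.vtx 0) (w 1) (w 2) 0
    rw [show w 1 • (T.vtx 1 - T.vtx 0) + w 2 • (T.vtx 2 - T.vtx 0) +
      (0 : ℝ) • (T.vtx 0 - T.vtx 0) = x - y by rw [e]; module, h01, h02, h12] at hq
    have hw0 : w 0 = -(w 1 + w 2) := by linarith
    have key : w k ^ 2 ≤ 8 * ((w 1 + w 2) ^ 2 + w 2 ^ 2) := by
      fin_cases k <;> simp only [Fin.zero_eta, Fin.mk_one, Fin.reduceFinMk, hw0] <;>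
        nlinarith [sq_nonneg (w 1 + w 2), sq_nonneg (w 2), sq_nonneg (w 1 + 2 * w 2)]
    rw [hq]
    calc s * w k ^ 2 ≤ s * (8 * ((w 1 + w 2) ^ 2 + w 2 ^ 2)) :=
          mul_le_mul_of_nonneg_left key hs.le
      _ = _ := by ring

theorem sqLen_mid_sub_zero (M : E d →ₗ[ℝ] E d) (T : TaggedSimplex d) :
    sqLen M (T.vtx 0 - T.mid) = 1 / 4 * sqLen M (T.vtx 0 - T.vtx (Fin.last d)) := by
  rw [sqLen_sub_comm, mid, sqLen_midpoint_sub, sqLen_sub_comm M (T.vtx (Fin.last d))]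
  simp [sqLen]
  ring

theorem sqLen_mid_sub_last (M : E d →ₗ[ℝ] E d) (T : TaggedSimplex d) :
    sqLen M (T.vtx (Fin.last d) - T.mid) = 1 / 4 * sqLen M (T.vtx 0 - T.vtx (Fin.last d)) := by
  rw [sqLen_sub_comm, mid, sqLen_midpoint_sub]
  simp [sqLen]
  ring

/-- The refinement edge is the hypotenuse and each leg becomes the hypotenuse, and refinement edge,
of a child. In two dimensions the type does not influence the order of the vertices. -/
theorem TrianglePattern.child (h : TrianglePattern M s T) (hC : T.IsChild C) :
    TrianglePattern M (1 / 2 * s) C := by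
  obtain ⟨h01, h02, h12⟩ := h
  have h21 := (sqLen_sub_comm M (T.vtx 2) (T.vtx 1)).trans h12
  have hm0 : sqLen M (T.vtx 0 - T.mid) = 1 / 2 * s := by
    rw [sqLen_mid_sub_zero]
    change 1 / 4 * sqLen M (T.vtx 0 - T.vtx 2) = _
    rw [h02]; ring
  have hm2 : sqLen M (T.vtx 2 - T.mid) = 1 / 2 * s := by
    refine (sqLen_mid_sub_last M T).trans ?_
    change 1 / 4 * sqLen M (T.vtx 0 - T.vtx 2) = _
    rw [h02]; ring
  have hm1 : sqLen M (T.mid - T.vtx 1) = 1 / 2 * s := by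
    rw [mid, sqLen_midpoint_sub]
    change 1 / 2 * _ + 1 / 2 * sqLen M (T.vtx 2 - T.vtx 1) - 1 / 4 * sqLen M (T.vtx 0 - T.vtx 2) = _
    rw [h01, h21, h02]; ring
  rcases hC with rfl | rfl
  · exact ⟨hm0, by change sqLen M (T.vtx 0 - T.vtx 1) = _; rw [h01]; ring, hm1⟩
  · have e2 : T.child₁.vtx 2 = T.vtx 1 := by
      obtain ⟨v, t⟩ := T
      fin_cases t <;> rfl
    exact ⟨hm2, by rw [e2]; change sqLen M (T.vtx 2 - T.vtx 1) = _; rw [h21]; ring,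
      by rw [e2]; exact hm1⟩

end Two

/-! ### Tetrahedra: the three patterns of a Kuhn simplex -/

section Three

variable {T C : TaggedSimplex 3} {M : E 3 →ₗ[ℝ] E 3} {s : ℝ}

/-- The hypothesis `hq` certifies that the form given by the edge lengths dominates the coordinate
differences. The difference at vertex `0` is `-(a + b + c)`, as all four add up to zero. -/
theorem EdgeLengths.isShaped {l₀₁ l₀₂ l₀₃ l₁₂ l₁₃ l₂₃ : ℝ} (hs : 0 < s)
    (h : EdgeLengths M T l₀₁ l₀₂ l₀₃ l₁₂ l₁₃ l₂₃)
    (hle : l₀₁ ≤ 3 * s ∧ l₀₂ ≤ 3 * s ∧ l₀₃ ≤ 3 * s ∧ l₁₂ ≤ 3 * s ∧ l₁₃ ≤ 3 * s ∧ l₂₃ ≤ 3 * s)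
    (hq : ∀ a b c : ℝ, ∃ q : ℝ, a ^ 2 * l₀₁ + b ^ 2 * l₀₂ + c ^ 2 * l₀₃ +
      a * b * (l₀₁ + l₀₂ - l₁₂) + a * c * (l₀₁ + l₀₃ - l₁₃) + b * c * (l₀₂ + l₀₃ - l₂₃) = s * q ∧
      a ^ 2 ≤ 8 * q ∧ b ^ 2 ≤ 8 * q ∧ c ^ 2 ≤ 8 * q ∧ (a + b + c) ^ 2 ≤ 8 * q) :
    IsShaped M T := by
  obtain ⟨h01, h02, h03, h12, h13, h23⟩ := h
  refine ⟨s, hs, ?_, ?_⟩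
  · have h10 := (sqLen_sub_comm M (T.vtx 1) (T.vtx 0)).trans h01
    have h20 := (sqLen_sub_comm M (T.vtx 2) (T.vtx 0)).trans h02
    have h30 := (sqLen_sub_comm M (T.vtx 3) (T.vtx 0)).trans h03
    have h21 := (sqLen_sub_comm M (T.vtx 2) (T.vtx 1)).trans h12
    have h31 := (sqLen_sub_comm M (T.vtx 3) (T.vtx 1)).trans h13
    have h32 := (sqLen_sub_comm M (T.vtx 3) (T.vtx 2)).trans h23
    obtain ⟨g1, g2, g3, g4, g5, g6⟩ := hle
    intro i j
    fin_cases i <;> fin_cases j <;>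
      first
        | (simp only [Fin.zero_eta, Fin.mk_one, Fin.reduceFinMk, h01, h10, h02, h20, h03, h30, h12,
            h21, h13, h31, h23, h32]; linarith)
        | (simp [sqLen]; linarith)
  · intro hT x y k
    obtain ⟨e, hsum⟩ := sub_eq_sum_coord hT x y
    obtain ⟨w, hw⟩ : ∃ w : Fin 4 → ℝ, ∀ k, (T.basis hT).coord k x - (T.basis hT).coord k y = w k :=
      ⟨_, fun _ => rfl⟩
    simp_rw [hw] at e hsum ⊢
    rw [Fin.sum_univ_four] at e hsum
    have hc := sqLen_combination M (T.vtx 0) (T.vtx 1) (T.vtx 2) (T.vtx 3) (w 1) (w 2) (w 3)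
    obtain ⟨q, hq, q1, q2, q3, q0⟩ := hq (w 1) (w 2) (w 3)
    rw [show w 1 • (T.vtx 1 - T.vtx 0) + w 2 • (T.vtx 2 - T.vtx 0) + w 3 • (T.vtx 3 - T.vtx 0) =
      x - y by rw [e]; module, h01, h02, h03, h12, h13, h23, hq] at hc
    have hw0 : w 0 = -(w 1 + w 2 + w 3) := by linarith
    have key : w k ^ 2 ≤ 8 * q := by
      fin_cases k
      · change w 0 ^ 2 ≤ _
        rw [hw0, neg_sq]; exact q0
      · exact q1
      · exact q2
      · exact q3
    rw [hc]
    calc s * w k ^ 2 ≤ s * (8 * q) := mul_le_mul_of_nonneg_left key hs.le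
      _ = _ := by ring

/-- The three squares are the Cartesian coordinates of `M (x - y)` for the reference simplices of
`exists_shape_bound_three`. The factor `8` is attained in type two, where `a` is twice the
difference of two of these coordinates. -/
theorem TetrahedronPattern.isShaped (hs : 0 < s) (h : TetrahedronPattern M s T) :
    IsShaped M T := by
  have sums : ∀ x y z : ℝ, (x - y) ^ 2 ≤ 2 * (x ^ 2 + y ^ 2 + z ^ 2) ∧
      (x + y) ^ 2 ≤ 2 * (x ^ 2 + y ^ 2 + z ^ 2) ∧ x ^ 2 ≤ x ^ 2 + y ^ 2 + z ^ 2 := fun x y z =>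
    ⟨by nlinarith [sq_nonneg (x + y), sq_nonneg z], by nlinarith [sq_nonneg (x - y), sq_nonneg z],
      by nlinarith [sq_nonneg y, sq_nonneg z]⟩
  rcases h with ⟨-, h⟩ | ⟨-, h⟩ | ⟨-, h⟩
  · refine h.isShaped hs (by refine ⟨?_, ?_, ?_, ?_, ?_, ?_⟩ <;> linarith) fun a b c => ?_
    refine ⟨(a + b + c) ^ 2 + (b + c) ^ 2 + c ^ 2, by ring, ?_, ?_, ?_, ?_⟩
    · nlinarith [(sums (a + b + c) (b + c) c).1]
    · nlinarith [(sums (b + c) c (a + b + c)).1]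
    · nlinarith [(sums c (a + b + c) (b + c)).2.2]
    · nlinarith [(sums (a + b + c) (b + c) c).2.2]
  · refine h.isShaped hs (by refine ⟨?_, ?_, ?_, ?_, ?_, ?_⟩ <;> linarith) fun a b c => ?_
    refine ⟨(1 / 2 * a + b + c) ^ 2 + (1 / 2 * a + c) ^ 2 + (1 / 2 * a) ^ 2, by ring, ?_, ?_, ?_, ?_⟩
    · nlinarith [(sums (1 / 2 * a) (1 / 2 * a + b + c) (1 / 2 * a + c)).2.2]
    · nlinarith [(sums (1 / 2 * a + b + c) (1 / 2 * a + c) (1 / 2 * a)).1]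
    · nlinarith [(sums (1 / 2 * a + c) (1 / 2 * a) (1 / 2 * a + b + c)).1]
    · nlinarith [(sums (1 / 2 * a + b + c) (1 / 2 * a) (1 / 2 * a + c)).2.1]
  · refine h.isShaped hs (by refine ⟨?_, ?_, ?_, ?_, ?_, ?_⟩ <;> linarith) fun a b c => ?_
    refine ⟨(1 / 2 * a + 1 / 2 * b + c) ^ 2 + (1 / 2 * a + 1 / 2 * b) ^ 2 + (1 / 2 * b) ^ 2,
      by ring, ?_, ?_, ?_, ?_⟩
    · nlinarith [(sums (1 / 2 * a + 1 / 2 * b) (1 / 2 * b) (1 / 2 * a + 1 / 2 * b + c)).1]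
    · nlinarith [(sums (1 / 2 * b) (1 / 2 * a + 1 / 2 * b) (1 / 2 * a + 1 / 2 * b + c)).2.2]
    · nlinarith [(sums (1 / 2 * a + 1 / 2 * b + c) (1 / 2 * a + 1 / 2 * b) (1 / 2 * b)).1]
    · nlinarith [(sums (1 / 2 * a + 1 / 2 * b + c) (1 / 2 * a + 1 / 2 * b) (1 / 2 * b)).2.1]

theorem EdgeLengths.child₀ {l₀₁ l₀₂ l₀₃ l₁₂ l₁₃ l₂₃ : ℝ}
    (h : EdgeLengths M T l₀₁ l₀₂ l₀₃ l₁₂ l₁₃ l₂₃) :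
    EdgeLengths M T.child₀ (1 / 4 * l₀₃) l₀₁ l₀₂ (1 / 2 * l₀₁ + 1 / 2 * l₁₃ - 1 / 4 * l₀₃)
      (1 / 2 * l₀₂ + 1 / 2 * l₂₃ - 1 / 4 * l₀₃) l₁₂ := by
  obtain ⟨h01, h02, h03, h12, h13, h23⟩ := h
  refine ⟨?_, h01, h02, ?_, ?_, h12⟩
  · change sqLen M (T.vtx 0 - T.mid) = _
    rw [sqLen_mid_sub_zero, ← h03]; rfl
  · change sqLen M (T.mid - T.vtx 1) = _
    rw [mid, sqLen_midpoint_sub, h01, ← h03, ← h13, sqLen_sub_comm M (T.vtx 1)]; rfl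
  · change sqLen M (T.mid - T.vtx 2) = _
    rw [mid, sqLen_midpoint_sub, h02, ← h03, ← h23, sqLen_sub_comm M (T.vtx 2)]; rfl

/-- In type zero the second child reverses the tail `x₁, x₂`. -/
theorem EdgeLengths.child₁_of_typ_eq_zero {l₀₁ l₀₂ l₀₃ l₁₂ l₁₃ l₂₃ : ℝ} (ht : T.typ = 0)
    (h : EdgeLengths M T l₀₁ l₀₂ l₀₃ l₁₂ l₁₃ l₂₃) :
    EdgeLengths M T.child₁ (1 / 4 * l₀₃) l₂₃ l₁₃ (1 / 2 * l₀₂ + 1 / 2 * l₂₃ - 1 / 4 * l₀₃)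
      (1 / 2 * l₀₁ + 1 / 2 * l₁₃ - 1 / 4 * l₀₃) l₁₂ := by
  obtain ⟨h01, h02, h03, h12, h13, h23⟩ := h
  have e2 : T.child₁.vtx 2 = T.vtx 2 := by
    obtain ⟨v, t⟩ := T
    subst ht; rfl
  have e3 : T.child₁.vtx 3 = T.vtx 1 := by
    obtain ⟨v, t⟩ := T
    subst ht; rfl
  rw [EdgeLengths, e2, e3]
  refine ⟨?_, ?_, ?_, ?_, ?_, ?_⟩
  · change sqLen M (T.vtx (Fin.last 3) - T.mid) = _
    rw [sqLen_mid_sub_last, ← h03]; rfl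
  · change sqLen M (T.vtx 3 - T.vtx 2) = _
    rw [sqLen_sub_comm, h23]
  · change sqLen M (T.vtx 3 - T.vtx 1) = _
    rw [sqLen_sub_comm, h13]
  · change sqLen M (T.mid - T.vtx 2) = _
    rw [mid, sqLen_midpoint_sub, h02, ← h03, ← h23, sqLen_sub_comm M (T.vtx 2)]; rfl
  · change sqLen M (T.mid - T.vtx 1) = _
    rw [mid, sqLen_midpoint_sub, h01, ← h03, ← h13, sqLen_sub_comm M (T.vtx 1)]; rfl
  · rw [sqLen_sub_comm, h12]

/-- For the other types the reversal concerns at most one vertex, so the tail keeps its order. -/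
theorem EdgeLengths.child₁_of_typ_ne_zero {l₀₁ l₀₂ l₀₃ l₁₂ l₁₃ l₂₃ : ℝ}
    (ht : T.typ = 1 ∨ T.typ = 2) (h : EdgeLengths M T l₀₁ l₀₂ l₀₃ l₁₂ l₁₃ l₂₃) :
    EdgeLengths M T.child₁ (1 / 4 * l₀₃) l₁₃ l₂₃ (1 / 2 * l₀₁ + 1 / 2 * l₁₃ - 1 / 4 * l₀₃)
      (1 / 2 * l₀₂ + 1 / 2 * l₂₃ - 1 / 4 * l₀₃) l₁₂ := by
  obtain ⟨h01, h02, h03, h12, h13, h23⟩ := h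
  have e2 : T.child₁.vtx 2 = T.vtx 1 := by
    obtain ⟨v, t⟩ := T
    rcases ht with ht | ht <;> (subst ht; rfl)
  have e3 : T.child₁.vtx 3 = T.vtx 2 := by
    obtain ⟨v, t⟩ := T
    rcases ht with ht | ht <;> (subst ht; rfl)
  rw [EdgeLengths, e2, e3]
  refine ⟨?_, ?_, ?_, ?_, ?_, h12⟩
  · change sqLen M (T.vtx (Fin.last 3) - T.mid) = _
    rw [sqLen_mid_sub_last, ← h03]; rfl
  · change sqLen M (T.vtx 3 - T.vtx 1) = _
    rw [sqLen_sub_comm, h13]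
  · change sqLen M (T.vtx 3 - T.vtx 2) = _
    rw [sqLen_sub_comm, h23]
  · change sqLen M (T.mid - T.vtx 1) = _
    rw [mid, sqLen_midpoint_sub, h01, ← h03, ← h13, sqLen_sub_comm M (T.vtx 1)]; rfl
  · change sqLen M (T.mid - T.vtx 2) = _
    rw [mid, sqLen_midpoint_sub, h02, ← h03, ← h23, sqLen_sub_comm M (T.vtx 2)]; rfl

/-- The types run through a cycle of length three, and both children always have the same edge
lengths. After a full cycle all lengths are halved, hence `s` is divided by four. -/
theorem TetrahedronPattern.child (h : TetrahedronPattern M s T) (hC : T.IsChild C) :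
    TetrahedronPattern M s C ∨ TetrahedronPattern M (1 / 4 * s) C := by
  have htyp : C.typ = T.nextTyp := by rcases hC with rfl | rfl <;> rfl
  have hnext : ∀ t, T.typ = t → C.typ = t + 1 := by
    rintro t rfl
    rw [htyp]
    ext
    simp [nextTyp, Fin.val_add]
  rcases h with ⟨ht, h⟩ | ⟨ht, h⟩ | ⟨ht, h⟩
  · refine Or.inl (Or.inr (Or.inl ⟨hnext _ ht, ?_⟩))
    rcases hC with rfl | rfl
    · convert h.child₀ using 1 <;> ring
    · convert h.child₁_of_typ_eq_zero ht using 1 <;> ring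
  · refine Or.inl (Or.inr (Or.inr ⟨hnext _ ht, ?_⟩))
    rcases hC with rfl | rfl
    · convert h.child₀ using 1 <;> ring
    · convert h.child₁_of_typ_ne_zero (Or.inl ht) using 1 <;> ring
  · refine Or.inr (Or.inl ⟨hnext _ ht, ?_⟩)
    rcases hC with rfl | rfl
    · convert h.child₀ using 1 <;> ring
    · convert h.child₁_of_typ_ne_zero (Or.inr ht) using 1 <;> ring

end Three

/-- An invariant of bisection which bounds the shape yields a bound for all descendants. -/
theorem exists_shape_bound {T : TaggedSimplex d} (hT : AffineIndependent ℝ T.vtx)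
    (M : E d →ₗ[ℝ] E d) (hM : ∀ k T', IsDescendant k T T' → IsShaped M T') :
    ∃ K : ℝ, ∀ k T', IsDescendant k T T' → Metric.diam T'.body / T'.inradius ≤ K := by
  -- The form dominates the coordinates, which separate points; an injective linear map is
  -- antilipschitz, and that provides `K`.
  have hinj : LinearMap.ker M = ⊥ := by
    obtain ⟨s, hs, -, hc⟩ := hM 0 T (.refl T)
    rw [LinearMap.ker_eq_bot']
    intro v hv
    refine (T.basis hT).ext_elem fun k => ?_
    have h := hc hT v 0 k
    rw [sqLen, sub_zero, hv, norm_zero] at h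
    have h2 : ((T.basis hT).coord k v - (T.basis hT).coord k 0) ^ 2 ≤ 0 := by
      by_contra! hlt
      have := mul_pos hs hlt
      linarith
    have := pow_eq_zero_iff (two_ne_zero) |>.1 (le_antisymm h2 (sq_nonneg _))
    linarith
  obtain ⟨K, hK, hanti⟩ := LinearMap.exists_antilipschitzWith M hinj
  let M' := LinearMap.toContinuousLinearMap M
  refine ⟨K * Real.sqrt 24 * (‖M'‖ + 1) * (d + 1), fun k T' hk => ?_⟩
  obtain ⟨s, hs, he, hc⟩ := hM k T' hk
  have hT' := hk.affineIndependent hT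
  refine diam_div_inradius_le T.typ.pos hT' M (K := K) hs (by positivity) (fun v => ?_) (fun v => ?_)
    he (hc hT')
  · have := hanti.le_mul_dist v 0
    simpa [dist_eq_norm] using this
  · have h1 : ‖M' v‖ ≤ ‖M'‖ * ‖v‖ := M'.le_opNorm v
    have h2 : M' v = M v := rfl
    rw [← h2]
    nlinarith [norm_nonneg v]

theorem exists_shape_bound_two {T : TaggedSimplex 2} (hT : AffineIndependent ℝ T.vtx) :
    ∃ K : ℝ, ∀ k T', IsDescendant k T T' → Metric.diam T'.body / T'.inradius ≤ K := by
  obtain ⟨M, hM⟩ := exists_linearMap_vtx hT ![0, !₂[1, 0], !₂[1, 1]]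
  refine exists_shape_bound hT M fun k T' hk => ?_
  suffices ∃ s : ℝ, 0 < s ∧ TrianglePattern M s T' by
    obtain ⟨s, hs, h⟩ := this
    exact h.isShaped hs
  induction hk with
  | refl =>
    refine ⟨1, one_pos, ?_, ?_, ?_⟩ <;>
      simp [sqLen, hM, EuclideanSpace.norm_sq_eq, -map_sub]
    norm_num
  | step _ hc ih =>
    obtain ⟨s, hs, h⟩ := ih hT hM
    exact ⟨_, by positivity, h.child hc⟩

theorem exists_shape_bound_three {T : TaggedSimplex 3} (hT : AffineIndependent ℝ T.vtx) :
    ∃ K : ℝ, ∀ k T', IsDescendant k T T' → Metric.diam T'.body / T'.inradius ≤ K := by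
  obtain ⟨M, hM⟩ : ∃ M : E 3 →ₗ[ℝ] E 3, TetrahedronPattern M 1 T := by
    obtain ⟨t, ht⟩ : ∃ t, T.typ = t := ⟨_, rfl⟩
    fin_cases t
    · obtain ⟨M, hM⟩ := exists_linearMap_vtx hT ![0, !₂[1, 0, 0], !₂[1, 1, 0], !₂[1, 1, 1]]
      refine ⟨M, Or.inl ⟨ht, ?_, ?_, ?_, ?_, ?_, ?_⟩⟩ <;>
        simp [sqLen, hM, EuclideanSpace.norm_sq_eq, Fin.sum_univ_three, -map_sub]
      <;> norm_num
    · obtain ⟨M, hM⟩ := exists_linearMap_vtx hT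
        ![0, !₂[1 / 2, 1 / 2, 1 / 2], !₂[1, 0, 0], !₂[1, 1, 0]]
      refine ⟨M, Or.inr (Or.inl ⟨ht, ?_, ?_, ?_, ?_, ?_, ?_⟩)⟩ <;>
        simp [sqLen, hM, EuclideanSpace.norm_sq_eq, Fin.sum_univ_three, -map_sub]
      <;> norm_num
    · obtain ⟨M, hM⟩ := exists_linearMap_vtx hT
        ![0, !₂[1 / 2, 1 / 2, 0], !₂[1 / 2, 1 / 2, 1 / 2], !₂[1, 0, 0]]
      refine ⟨M, Or.inr (Or.inr ⟨ht, ?_, ?_, ?_, ?_, ?_, ?_⟩)⟩ <;>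
        simp [sqLen, hM, EuclideanSpace.norm_sq_eq, Fin.sum_univ_three, -map_sub]
      <;> norm_num
  refine exists_shape_bound hT M fun k T' hk => ?_
  suffices ∃ s : ℝ, 0 < s ∧ TetrahedronPattern M s T' by
    obtain ⟨s, hs, h⟩ := this
    exact h.isShaped hs
  induction hk with
  | refl => exact ⟨1, one_pos, hM⟩
  | step _ hc ih =>
    obtain ⟨s, hs, h⟩ := ih hT hM
    rcases h.child hc with h | h
    · exact ⟨_, hs, h⟩
    · exact ⟨_, by positivity, h⟩

end TaggedSimplex

/-- The shape regularity constant is finite. -/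
theorem shapeConst_ne_top (hd : d = 2 ∨ d = 3) {Ω : Set (E d)} {𝒯₀ : Mesh d}
    (h : IsTriangulation Ω 𝒯₀) : shapeConst 𝒯₀ ≠ ⊤ := by
  have hb : ∀ T ∈ 𝒯₀, ∃ K : ℝ, ∀ k T', IsDescendant k T T' →
      Metric.diam T'.body / T'.inradius ≤ K := by
    intro T hT
    rcases hd with rfl | rfl
    · exact exists_shape_bound_two (h.nondegenerate T hT)
    · exact exists_shape_bound_three (h.nondegenerate T hT)
  choose! K hK using hb
  -- The initial mesh is finite; summing the bounds replaces taking their maximum.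
  refine ne_top_of_le_ne_top (b := ∑ T ∈ 𝒯₀, ENNReal.ofReal (K T)) ?_ ?_
  · exact (ENNReal.sum_lt_top.2 fun _ _ => ENNReal.ofReal_lt_top).ne
  · refine iSup₂_le fun 𝒯 h𝒯 => iSup₂_le fun T hT => ?_
    obtain ⟨T₀, hT₀, k, hk⟩ := h𝒯.1.exists_ancestor T hT
    exact (ENNReal.ofReal_le_ofReal (hK T₀ hT₀ k T hk)).trans
      (Finset.single_le_sum (f := fun T => ENNReal.ofReal (K T)) (fun _ _ => zero_le) hT₀)

/-- The elements of all meshes of the family are shape regular. -/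
theorem diam_le_shapeConst_mul (hd : d = 2 ∨ d = 3) {Ω : Set (E d)} {𝒯₀ 𝒯 : Mesh d}
    (h : IsTriangulation Ω 𝒯₀) (h𝒯 : 𝒯 ∈ Family 𝒯₀) {T : TaggedSimplex d} (hT : T ∈ 𝒯) :
    Metric.diam T.body ≤ (shapeConst 𝒯₀).toReal * T.inradius := by
  have hpos := inradius_pos T.typ.pos ((h.of_mem_family h𝒯).nondegenerate T hT)
  rw [← div_le_iff₀ hpos]
  have h1 : ENNReal.ofReal (Metric.diam T.body / T.inradius) ≤ shapeConst 𝒯₀ :=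
    le_iSup₂_of_le 𝒯 h𝒯 (le_iSup₂_of_le T hT le_rfl)
  exact (ENNReal.ofReal_le_iff_le_toReal (shapeConst_ne_top hd h)).1 h1

/-! ### Square integrable functions -/

section L2

variable {X : Type*} [MeasurableSpace X] {μ : Measure X} {a b : X → ℝ}

/-- Pointwise, the right side exceeds the left by `(δ b - (a - b))² / δ`. -/
theorem integral_sq_le_add (ha : MemLp a 2 μ) (hb : MemLp b 2 μ) {δ : ℝ} (hδ : 0 < δ) :
    ∫ x, a x ^ 2 ∂μ ≤ (1 + δ) * ∫ x, b x ^ 2 ∂μ + (1 + δ⁻¹) * ∫ x, (a x - b x) ^ 2 ∂μ := by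
  have hab : Integrable (fun x => (a x - b x) ^ 2) μ := (ha.sub hb).integrable_sq
  rw [← integral_const_mul, ← integral_const_mul, ← integral_add (hb.integrable_sq.const_mul _)
    (hab.const_mul _)]
  refine integral_mono ha.integrable_sq ((hb.integrable_sq.const_mul _).add (hab.const_mul _))
    fun x => ?_
  change a x ^ 2 ≤ (1 + δ) * b x ^ 2 + (1 + δ⁻¹) * (a x - b x) ^ 2
  have hs : 0 ≤ (δ * b x - (a x - b x)) ^ 2 * δ⁻¹ := by positivity
  have e : (1 + δ) * b x ^ 2 + (1 + δ⁻¹) * (a x - b x) ^ 2 - a x ^ 2 =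
      (δ * b x - (a x - b x)) ^ 2 * δ⁻¹ := by field_simp; ring
  linarith

theorem integral_sub_average_sq_le [IsFiniteMeasure μ] (ha : MemLp a 2 μ) :
    ∫ x, (a x - ⨍ y, a y ∂μ) ^ 2 ∂μ ≤ ∫ x, a x ^ 2 ∂μ := by
  set c := ⨍ y, a y ∂μ with hc
  have hint : Integrable a μ := ha.integrable one_le_two
  have h1 : ∫ x, a x ∂μ = μ.real univ * c := by
    have := measure_smul_average μ a
    rw [← this, smul_eq_mul]
  have e : ∀ x, (a x - c) ^ 2 = a x ^ 2 - 2 * c * a x + c ^ 2 := fun x => by ring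
  have hI : Integrable (fun x => a x ^ 2 - 2 * c * a x) μ :=
    ha.integrable_sq.sub (hint.const_mul _)
  simp_rw [e]
  rw [integral_add hI (integrable_const _), integral_sub ha.integrable_sq (hint.const_mul _), integral_const_mul, h1, integral_const,
    smul_eq_mul]
  nlinarith [mul_nonneg (measureReal_nonneg (μ := μ) (s := univ)) (sq_nonneg c)]

/-- The mean value is linear, so the difference of the centred functions is the centred difference,
whose norm is at most that of the difference itself. -/
theorem integral_sub_average_sq_le_add [IsFiniteMeasure μ] (ha : MemLp a 2 μ) (hb : MemLp b 2 μ) :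
    ∫ x, (a x - ⨍ y, a y ∂μ) ^ 2 ∂μ ≤
      2 * ∫ x, (b x - ⨍ y, b y ∂μ) ^ 2 ∂μ + 2 * ∫ x, (a x - b x) ^ 2 ∂μ := by
  have hab := ha.sub hb
  have havg : ⨍ y, (a y - b y) ∂μ = ⨍ y, a y ∂μ - ⨍ y, b y ∂μ := by
    rw [average_eq, average_eq, average_eq, integral_sub (ha.integrable one_le_two)
      (hb.integrable one_le_two), smul_sub]
  have hvar := integral_sub_average_sq_le hab
  simp only [Pi.sub_apply] at hvar
  rw [havg] at hvar
  have h1 : MemLp (fun x => a x - ⨍ y, a y ∂μ) 2 μ := ha.sub (memLp_const _)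
  have h2 : MemLp (fun x => b x - ⨍ y, b y ∂μ) 2 μ := hb.sub (memLp_const _)
  have h := integral_sq_le_add h1 h2 one_pos
  have e : ∀ x, a x - ⨍ y, a y ∂μ - (b x - ⨍ y, b y ∂μ) =
      a x - b x - (⨍ y, a y ∂μ - ⨍ y, b y ∂μ) := fun x => by ring
  simp_rw [e] at h
  norm_num at h
  linarith

theorem integral_sq_le_of_ae_abs_le [IsFiniteMeasure μ] {K : ℝ} (h : ∀ᵐ x ∂μ, |a x| ≤ K) :
    ∫ x, a x ^ 2 ∂μ ≤ K ^ 2 * μ.real univ := by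
  have h1 : ∀ᵐ x ∂μ, ‖a x ^ 2‖ ≤ K ^ 2 := by
    filter_upwards [h] with x hx
    rw [norm_pow, Real.norm_eq_abs]
    exact pow_le_pow_left₀ (abs_nonneg _) hx 2
  exact (le_abs_self _).trans (norm_integral_le_of_norm_le_const h1)

end L2

/-! ### Perturbation of the residuals -/

/-- The data needed on the elements of a mesh: regularity of the coefficient, square integrability
of the load, and the elementwise constant gradient `G` of `V`. -/
structure IsAdapted (α : E d → ℝ → ℝ) (f : E d → ℝ) (C : ℝ) (L : ℝ≥0) (𝒯 : Mesh d)
    (V : E d → ℝ) (G : TaggedSimplex d → E d) : Prop where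
  regular : ∀ T ∈ 𝒯, IsRegularOn α C L (interior T.body)
  memLp : ∀ T ∈ 𝒯, MemLp f 2 (volume.restrict (interior T.body))
  grad : ∀ T ∈ 𝒯, HasConstGradient V T (G T)

section Perturbation

variable {α : E d → ℝ → ℝ} {f : E d → ℝ} {C : ℝ} {L : ℝ≥0} {Ω : Set (E d)} {𝒯 : Mesh d}
  {V W : E d → ℝ} {G H : TaggedSimplex d → E d} {T : TaggedSimplex d}

theorem isFiniteMeasure_restrict_side (hT : AffineIndependent ℝ T.vtx) (i : Fin (d + 1)) :
    IsFiniteMeasure ((μHE[d - 1] : Measure (E d)).restrict (T.side i)) :=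
  ⟨by rw [Measure.restrict_apply_univ]; exact measure_side_lt_top T.typ.pos hT i⟩

theorem isFiniteMeasure_restrict_body : IsFiniteMeasure (volume.restrict T.body) :=
  ⟨by rw [Measure.restrict_apply_univ]; exact volume_body_lt_top⟩

theorem IsAdapted.hasTrace (hV : IsAdapted α f C L 𝒯 V G) (hT : T ∈ 𝒯) : HasTrace α V T :=
  (hV.regular T hT).hasTrace (hV.grad T hT)

theorem IsAdapted.memLp_elemRes (hV : IsAdapted α f C L 𝒯 V G) (hT : T ∈ 𝒯) :
    MemLp (elemRes α f V) 2 (volume.restrict T.body) :=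
  (hV.regular T hT).memLp_elemRes (hV.grad T hT) (hV.memLp T hT)

theorem IsAdapted.continuousOn_jumpRes (hV : IsAdapted α f C L 𝒯 V G) (h : IsPartition Ω 𝒯)
    (hT : T ∈ 𝒯) (i : Fin (d + 1)) : ContinuousOn (jumpRes α 𝒯 V T i) (T.side i) := by
  by_cases hno : ∀ S ∈ 𝒯, S ≠ T → ∀ j, S.sideVtx j ≠ T.sideVtx i
  · exact continuousOn_const.congr fun x _ => jumpRes_eq_zero hno α V x
  push Not at hno
  obtain ⟨S, hS, hST, j, hj⟩ := hno
  refine ContinuousOn.congr ?_ fun x _ => h.jumpRes_eq hT hS hST hj α V x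
  have h1 := ((hV.hasTrace hT).continuousOn (h.nondegenerate T hT)).mono (side_subset_body i)
  have h2 := ((hV.hasTrace hS).continuousOn (h.nondegenerate S hS)).mono (side_subset_body j)
  have e : S.side j = T.side i := by rw [side, side, hj]
  rw [e] at h2
  exact continuousOn_const.mul ((h1.sub h2).inner continuousOn_const)

theorem IsAdapted.memLp_jumpRes (hV : IsAdapted α f C L 𝒯 V G) (h : IsPartition Ω 𝒯)
    (hT : T ∈ 𝒯) (i : Fin (d + 1)) :
    MemLp (jumpRes α 𝒯 V T i) 2 ((μHE[d - 1] : Measure (E d)).restrict (T.side i)) := by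
  have := isFiniteMeasure_restrict_side (h.nondegenerate T hT) i
  have hc := hV.continuousOn_jumpRes h hT i
  obtain ⟨K, hK⟩ := (isCompact_side (T := T) i).exists_bound_of_continuousOn hc
  refine MemLp.of_bound (hc.aestronglyMeasurable (measurableSet_side i)) K ?_
  rw [ae_restrict_iff' (measurableSet_side i)]
  exact Eventually.of_forall hK

/-- Change of the residuals of an element, measured in the same way as in the estimator. -/
noncomputable def resDist (α : E d → ℝ → ℝ) (f : E d → ℝ) (𝒯 : Mesh d) (V W : E d → ℝ)
    (T : TaggedSimplex d) : ℝ :=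
  T.size ^ 2 * (∫ x in T.body, (elemRes α f V x - elemRes α f W x) ^ 2) +
  T.size * ∑ i, ∫ x in T.side i, (jumpRes α 𝒯 V T i x - jumpRes α 𝒯 W T i x) ^ 2
    ∂(μHE[d - 1])

theorem etaSqLoc_le (hV : IsAdapted α f C L 𝒯 V G) (hW : IsAdapted α f C L 𝒯 W H)
    (h : IsPartition Ω 𝒯) (hT : T ∈ 𝒯) {δ : ℝ} (hδ : 0 < δ) :
    etaSqLoc α f 𝒯 V T ≤ (1 + δ) * etaSqLoc α f 𝒯 W T + (1 + δ⁻¹) * resDist α f 𝒯 V W T := by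
  have h1 := mul_le_mul_of_nonneg_left
    (integral_sq_le_add (hV.memLp_elemRes hT) (hW.memLp_elemRes hT) hδ) (sq_nonneg T.size)
  have h2 := mul_le_mul_of_nonneg_left (Finset.sum_le_sum fun i (_ : i ∈ Finset.univ) =>
    integral_sq_le_add (hV.memLp_jumpRes h hT i) (hW.memLp_jumpRes h hT i) hδ) T.size_nonneg
  rw [Finset.sum_add_distrib, ← Finset.mul_sum, ← Finset.mul_sum] at h2
  rw [etaSqLoc, etaSqLoc, resDist]
  refine (add_le_add h1 h2).trans (le_of_eq ?_)
  ring

theorem oscSqLoc_le (hV : IsAdapted α f C L 𝒯 V G) (hW : IsAdapted α f C L 𝒯 W H)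
    (h : IsPartition Ω 𝒯) (hT : T ∈ 𝒯) :
    oscSqLoc α f 𝒯 V T ≤ 2 * oscSqLoc α f 𝒯 W T + 2 * resDist α f 𝒯 V W T := by
  have := isFiniteMeasure_restrict_body (T := T)
  have := fun i => isFiniteMeasure_restrict_side (h.nondegenerate T hT) i
  have h1 := mul_le_mul_of_nonneg_left
    (integral_sub_average_sq_le_add (hV.memLp_elemRes hT) (hW.memLp_elemRes hT))
    (sq_nonneg T.size)
  have h2 := mul_le_mul_of_nonneg_left (Finset.sum_le_sum fun i (_ : i ∈ Finset.univ) =>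
    integral_sub_average_sq_le_add (hV.memLp_jumpRes h hT i) (hW.memLp_jumpRes h hT i))
    T.size_nonneg
  rw [Finset.sum_add_distrib, ← Finset.mul_sum, ← Finset.mul_sum] at h2
  rw [oscSqLoc, oscSqLoc, resDist]
  refine (add_le_add h1 h2).trans (le_of_eq ?_)
  ring

theorem integral_elemRes_sub_sq_le (hV : IsAdapted α f C L 𝒯 V G) (hW : IsAdapted α f C L 𝒯 W H)
    (hT : T ∈ 𝒯) :
    ∫ x in T.body, (elemRes α f V x - elemRes α f W x) ^ 2 ≤
      (3 * d * L) ^ 2 * (‖G T - H T‖ ^ 2 * (volume T.body).toReal) := by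
  have := isFiniteMeasure_restrict_body (T := T)
  refine (integral_sq_le_of_ae_abs_le ((hV.regular T hT).ae_abs_elemRes_sub_le (hV.grad T hT)
    (hW.grad T hT))).trans (le_of_eq ?_)
  rw [measureReal_restrict_apply_univ, measureReal_def]
  ring

open scoped Classical in
/-- The sum of `F T'` over the elements `T'` which share the `i`-th side of `T`. -/
noncomputable def neighbourSum (𝒯 : Mesh d) (F : TaggedSimplex d → ℝ) (T : TaggedSimplex d)
    (i : Fin (d + 1)) : ℝ :=
  ∑ T' ∈ 𝒯.erase T, ∑ j : Fin (d + 1), if T'.sideVtx j = T.sideVtx i then F T' else 0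

theorem IsPartition.neighbourSum_eq (h : IsPartition Ω 𝒯) (hT : T ∈ 𝒯) {T' : TaggedSimplex d}
    (hT' : T' ∈ 𝒯) (hne : T' ≠ T) {i j : Fin (d + 1)} (hj : T'.sideVtx j = T.sideVtx i)
    (F : TaggedSimplex d → ℝ) : neighbourSum 𝒯 F T i = F T' := by
  rw [neighbourSum, Finset.sum_eq_single_of_mem T' (Finset.mem_erase.2 ⟨hne, hT'⟩),
    Finset.sum_eq_single_of_mem j (Finset.mem_univ _), if_pos hj]
  · intro k _ hk
    rw [if_neg]
    intro hk'
    exact hk (sideVtx_injective (h.nondegenerate T' hT') (hk'.trans hj.symm))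
  · intro S hS hST'
    refine Finset.sum_eq_zero fun k _ => if_neg fun hk => hST' ?_
    exact h.eq_of_common_side hT hT' hne (Finset.mem_of_mem_erase hS) (Finset.ne_of_mem_erase hS)
      hj hk

theorem neighbourSum_eq_zero {i : Fin (d + 1)}
    (hno : ∀ T' ∈ 𝒯, T' ≠ T → ∀ j, T'.sideVtx j ≠ T.sideVtx i) (F : TaggedSimplex d → ℝ) :
    neighbourSum 𝒯 F T i = 0 := by
  rw [neighbourSum]
  exact Finset.sum_eq_zero fun S hS => Finset.sum_eq_zero fun k _ =>
    if_neg (hno S (Finset.mem_of_mem_erase hS) (Finset.ne_of_mem_erase hS) k)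

/-- Every element is a neighbour of at most `d + 1` elements. -/
theorem IsPartition.sum_neighbourSum_le (h : IsPartition Ω 𝒯) {F : TaggedSimplex d → ℝ}
    (hF : ∀ T, 0 ≤ F T) :
    ∑ T ∈ 𝒯, ∑ i, neighbourSum 𝒯 F T i ≤ (d + 1) * ∑ T ∈ 𝒯, F T := by
  classical
  -- Sharing a side is symmetric: exchanging the sums counts `F T'` once for each side of `T'` that
  -- has a neighbour.
  have e : ∑ T ∈ 𝒯, ∑ i, neighbourSum 𝒯 F T i =
      ∑ T' ∈ 𝒯, ∑ j, neighbourSum 𝒯 (fun _ => F T') T' j := by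
    have e1 : ∀ T ∈ 𝒯, ∑ i, neighbourSum 𝒯 F T i = ∑ T' ∈ 𝒯, ∑ i, ∑ j : Fin (d + 1),
        if T' ≠ T ∧ T'.sideVtx j = T.sideVtx i then F T' else 0 := by
      intro T _
      rw [Finset.sum_comm]
      refine Finset.sum_congr rfl fun i _ => ?_
      rw [neighbourSum, ← Finset.filter_ne', Finset.sum_filter]
      refine Finset.sum_congr rfl fun T' _ => ?_
      by_cases hne : T' = T <;> simp [hne]
    have e2 : ∀ T' ∈ 𝒯, ∑ j, neighbourSum 𝒯 (fun _ => F T') T' j =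
        ∑ T ∈ 𝒯, ∑ i, ∑ j : Fin (d + 1),
        if T' ≠ T ∧ T'.sideVtx j = T.sideVtx i then F T' else 0 := by
      intro T' _
      simp_rw [neighbourSum]
      rw [Finset.sum_comm, ← Finset.filter_ne', Finset.sum_filter]
      refine Finset.sum_congr rfl fun T _ => ?_
      by_cases hne : T' = T
      · simp [hne]
      · rw [if_pos (Ne.symm hne), Finset.sum_comm]
        refine Finset.sum_congr rfl fun i _ => Finset.sum_congr rfl fun j _ => ?_
        simp [hne, eq_comm]
    rw [Finset.sum_congr rfl e1, Finset.sum_congr rfl e2, Finset.sum_comm]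
  rw [e, Finset.mul_sum]
  refine Finset.sum_le_sum fun T hT => ?_
  calc ∑ j, neighbourSum 𝒯 (fun _ => F T) T j ≤ ∑ _j : Fin (d + 1), F T := by
        refine Finset.sum_le_sum fun i _ => ?_
        by_cases hno : ∀ S ∈ 𝒯, S ≠ T → ∀ j, S.sideVtx j ≠ T.sideVtx i
        · rw [neighbourSum_eq_zero hno]; exact hF T
        push Not at hno
        obtain ⟨S, hS, hST, j, hj⟩ := hno
        rw [h.neighbourSum_eq hT hS hST hj]
    _ = (d + 1) * F T := by simp

/-- Each trace changes by at most `2 C` times the gradient difference on its element, and the jump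
carries the factor `1/2`. The scaled side measure is then bounded by the volume of the element whose
gradient it multiplies. -/
theorem size_mul_integral_jumpRes_sub_sq_le (hd : 2 ≤ d) (hV : IsAdapted α f C L 𝒯 V G)
    (hW : IsAdapted α f C L 𝒯 W H) (h : IsPartition Ω 𝒯) {κ : ℝ} (hκ : 0 ≤ κ)
    (hshape : ∀ T ∈ 𝒯, Metric.diam T.body ≤ κ * T.inradius) (hT : T ∈ 𝒯) (i : Fin (d + 1)) :
    T.size * ∫ x in T.side i, (jumpRes α 𝒯 V T i x - jumpRes α 𝒯 W T i x) ^ 2 ∂(μHE[d - 1]) ≤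
      2 * C ^ 2 * sideConst d κ * (‖G T - H T‖ ^ 2 * (volume T.body).toReal +
        neighbourSum 𝒯 (fun S => ‖G S - H S‖ ^ 2 * (volume S.body).toReal) T i) := by
  have hTn := h.nondegenerate T hT
  have := isFiniteMeasure_restrict_side hTn i
  have hsc := sideConst_nonneg (d := d) hκ
  by_cases hno : ∀ S ∈ 𝒯, S ≠ T → ∀ j, S.sideVtx j ≠ T.sideVtx i
  · rw [neighbourSum_eq_zero hno]
    simp_rw [jumpRes_eq_zero hno]
    simp only [sub_self, ne_eq, OfNat.ofNat_ne_zero, not_false_eq_true, zero_pow, integral_zero,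
      mul_zero, add_zero]
    positivity
  push Not at hno
  obtain ⟨S, hS, hST, j, hj⟩ := hno
  rw [h.neighbourSum_eq hT hS hST hj]
  have hSn := h.nondegenerate S hS
  set eT := ‖G T - H T‖
  set eS := ‖G S - H S‖
  have hC := (hV.regular T hT).nonneg
  have hbd : ∀ᵐ x ∂(μHE[d - 1] : Measure (E d)).restrict (T.side i),
      |jumpRes α 𝒯 V T i x - jumpRes α 𝒯 W T i x| ≤ C * (eT + eS) := by
    rw [ae_restrict_iff' (measurableSet_side i)]
    refine Eventually.of_forall fun x hx => ?_
    have hxT := side_subset_body i hx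
    have hxS : x ∈ S.body := side_subset_body j (by rwa [side, hj])
    have b1 := (hV.regular T hT).norm_fluxTrace_sub_le hTn (hV.grad T hT) (hW.grad T hT) hxT
    have b2 := (hV.regular S hS).norm_fluxTrace_sub_le hSn (hV.grad S hS) (hW.grad S hS) hxS
    have e : jumpRes α 𝒯 V T i x - jumpRes α 𝒯 W T i x =
        1 / 2 * ⟪(fluxTrace α V T x - fluxTrace α W T x) -
          (fluxTrace α V S x - fluxTrace α W S x), T.normal i⟫ := by
      rw [h.jumpRes_eq hT hS hST hj, h.jumpRes_eq hT hS hST hj, ← mul_sub, ← inner_sub_left]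
      congr 2; abel
    have b3 := abs_real_inner_le_norm ((fluxTrace α V T x - fluxTrace α W T x) -
          (fluxTrace α V S x - fluxTrace α W S x)) (T.normal i)
    have b4 := norm_sub_le (fluxTrace α V T x - fluxTrace α W T x)
      (fluxTrace α V S x - fluxTrace α W S x)
    rw [norm_normal hTn, mul_one] at b3
    rw [e, abs_mul, abs_of_pos (by norm_num : (0 : ℝ) < 1 / 2)]
    linarith
  have h1 := integral_sq_le_of_ae_abs_le hbd
  rw [measureReal_restrict_apply_univ, measureReal_def] at h1
  have k1 := size_mul_measure_side_le hd hTn hκ (hshape T hT) (hshape T hT) (rfl : T.sideVtx i = _)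
  have k2 := size_mul_measure_side_le hd hTn hκ (hshape T hT) (hshape S hS) hj
  calc _ ≤ T.size * ((C * (eT + eS)) ^ 2 * (μHE[d - 1] (T.side i)).toReal) :=
        mul_le_mul_of_nonneg_left h1 T.size_nonneg
    _ = C ^ 2 * (eT + eS) ^ 2 * (T.size * (μHE[d - 1] (T.side i)).toReal) := by ring
    _ ≤ C ^ 2 * (2 * (eT ^ 2 + eS ^ 2)) * (T.size * (μHE[d - 1] (T.side i)).toReal) := by
        have h2 : (eT + eS) ^ 2 ≤ 2 * (eT ^ 2 + eS ^ 2) := by nlinarith [sq_nonneg (eT - eS)]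
        have := T.size_nonneg
        gcongr
    _ = 2 * C ^ 2 * (eT ^ 2 * (T.size * (μHE[d - 1] (T.side i)).toReal) +
          eS ^ 2 * (T.size * (μHE[d - 1] (T.side i)).toReal)) := by ring
    _ ≤ 2 * C ^ 2 * (eT ^ 2 * (sideConst d κ * (volume T.body).toReal) +
          eS ^ 2 * (sideConst d κ * (volume S.body).toReal)) := by gcongr
    _ = _ := by ring

/-- The jump terms meet every element at most `d + 1` times from its own sides and `d + 1` times as
a neighbour, hence `4 (d + 1)` in place of `2`. -/
theorem sum_resDist_le (hd : 2 ≤ d) (hV : IsAdapted α f C L 𝒯 V G)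
    (hW : IsAdapted α f C L 𝒯 W H) (h : IsPartition Ω 𝒯) {κ : ℝ} (hκ : 0 ≤ κ)
    (hshape : ∀ T ∈ 𝒯, Metric.diam T.body ≤ κ * T.inradius) {h₀ : ℝ}
    (hsize : ∀ T ∈ 𝒯, T.size ≤ h₀) :
    ∑ T ∈ 𝒯, resDist α f 𝒯 V W T ≤
      (h₀ ^ 2 * (3 * d * L) ^ 2 + 4 * (d + 1) * C ^ 2 * sideConst d κ) *
        ∑ T ∈ 𝒯, ‖G T - H T‖ ^ 2 * (volume T.body).toReal := by
  set F : TaggedSimplex d → ℝ := fun S => ‖G S - H S‖ ^ 2 * (volume S.body).toReal with hF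
  have hF0 : ∀ T, 0 ≤ F T := fun T => by positivity
  have hsc := sideConst_nonneg (d := d) hκ
  have hloc : ∀ T ∈ 𝒯, resDist α f 𝒯 V W T ≤ h₀ ^ 2 * (3 * d * L) ^ 2 * F T +
      2 * C ^ 2 * sideConst d κ * ((d + 1) * F T + ∑ i, neighbourSum 𝒯 F T i) := by
    intro T hT
    have h1 := integral_elemRes_sub_sq_le (f := f) hV hW hT
    have h2 := Finset.sum_le_sum fun i (_ : i ∈ Finset.univ) =>
      size_mul_integral_jumpRes_sub_sq_le hd hV hW h hκ hshape hT i
    rw [← Finset.mul_sum, ← Finset.mul_sum, Finset.sum_add_distrib] at h2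
    simp only [Finset.sum_const, Finset.card_univ, Fintype.card_fin, nsmul_eq_mul] at h2
    push_cast at h2
    rw [resDist]
    refine add_le_add ?_ h2
    have h3 : T.size ^ 2 ≤ h₀ ^ 2 := pow_le_pow_left₀ T.size_nonneg (hsize T hT) 2
    calc _ ≤ h₀ ^ 2 * ((3 * d * L) ^ 2 * F T) :=
          mul_le_mul h3 h1 (integral_nonneg fun x => sq_nonneg _) (sq_nonneg _)
      _ = _ := by ring
  refine (Finset.sum_le_sum hloc).trans ?_
  rw [Finset.sum_add_distrib, ← Finset.mul_sum, ← Finset.mul_sum, Finset.sum_add_distrib,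
    ← Finset.mul_sum]
  have h3 := h.sum_neighbourSum_le hF0
  have h4 := mul_le_mul_of_nonneg_left h3 (by positivity : 0 ≤ 2 * C ^ 2 * sideConst d κ)
  linarith

end Perturbation

/-! ### Reduction of the estimator under refinement -/

section Reduction

variable {α : E d → ℝ → ℝ} {f : E d → ℝ} {C : ℝ} {L : ℝ≥0} {Ω : Set (E d)} {𝒯 𝒯' : Mesh d}
  {V : E d → ℝ} {G : TaggedSimplex d → E d} {T : TaggedSimplex d}

theorem ofReal_integral_sq {X : Type*} [MeasurableSpace X] {μ : Measure X} {a : X → ℝ}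
    (ha : MemLp a 2 μ) :
    ENNReal.ofReal (∫ x, a x ^ 2 ∂μ) = ∫⁻ x, ENNReal.ofReal (a x ^ 2) ∂μ :=
  ofReal_integral_eq_lintegral_ofReal ha.integrable_sq (Eventually.of_forall fun _ => sq_nonneg _)

/-- With the squared residual as density of a measure, the bodies of two children overlap in a null
set, and this passes to all descendants by `sum_descendants_le`. -/
theorem IsAdapted.sum_integral_elemRes_le (hV : IsAdapted α f C L 𝒯 V G) (h : IsPartition Ω 𝒯)
    (hr : IsRefinement 𝒯 𝒯') (hT : T ∈ 𝒯) :
    ∑ T' ∈ descendants 𝒯' T, ∫ x in T'.body, elemRes α f V x ^ 2 ≤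
      ∫ x in T.body, elemRes α f V x ^ 2 := by
  have hTn := h.nondegenerate T hT
  set ν : Measure (E d) := volume.withDensity fun x => ENNReal.ofReal (elemRes α f V x ^ 2) with hν
  have hνB : ∀ S : TaggedSimplex d, S.body ⊆ T.body →
      ν S.body = ENNReal.ofReal (∫ x in S.body, elemRes α f V x ^ 2) := by
    intro S hS
    rw [ofReal_integral_sq ((hV.memLp_elemRes hT).mono_measure (Measure.restrict_mono_set _ hS)),
      hν, withDensity_apply _ measurableSet_body]
  have key := sum_descendants_le h hr hT (fun S => ν S.body) fun k S hS =>
    measure_body_children_le (hS.affineIndependent hTn) ν (withDensity_absolutelyContinuous _ _)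
  have e : ∑ S ∈ descendants 𝒯' T, ν S.body =
      ENNReal.ofReal (∑ S ∈ descendants 𝒯' T, ∫ x in S.body, elemRes α f V x ^ 2) := by
    rw [ENNReal.ofReal_sum_of_nonneg fun S _ => integral_nonneg fun x => sq_nonneg _]
    refine Finset.sum_congr rfl fun S hS => hνB S ?_
    obtain ⟨k, hk⟩ := (mem_descendants.1 hS).2
    exact hk.body_subset hTn
  rw [e, hνB T Subset.rfl] at key
  exact (ENNReal.ofReal_le_ofReal_iff (integral_nonneg fun _ => sq_nonneg _)).1 key

theorem IsAdapted.sum_integral_jumpRes_le (hV : IsAdapted α f C L 𝒯 V G)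
    (h : IsTriangulation Ω 𝒯) (h' : IsTriangulation Ω 𝒯') (hr : IsRefinement 𝒯 𝒯') (hT : T ∈ 𝒯) :
    ∑ T' ∈ descendants 𝒯' T, ∑ k, ∫ x in T'.side k, jumpRes α 𝒯' V T' k x ^ 2 ∂(μHE[d - 1]) ≤
      ∑ k, ∫ x in T.side k, jumpRes α 𝒯 V T k x ^ 2 ∂(μHE[d - 1]) := by
  have hTn := h.nondegenerate T hT
  set J : Fin (d + 1) → E d → ℝ := fun i => jumpRes α 𝒯 V T i with hJ
  -- The measure collects the squared coarse jumps on the boundary of `T`. New sides inside `T` are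
  -- null for it, so its total over the sides does not grow under bisection.
  set ν : Measure (E d) := ∑ i, ((μHE[d - 1] : Measure (E d)).restrict (T.side i)).withDensity
    fun x => ENNReal.ofReal (J i x ^ 2) with hν
  have hνs : ∀ s, MeasurableSet s →
      ν s = ∑ i, ∫⁻ x in s ∩ T.side i, ENNReal.ofReal (J i x ^ 2) ∂(μHE[d - 1]) := by
    intro s hs
    rw [hν, Measure.finsetSum_apply]
    refine Finset.sum_congr rfl fun i _ => ?_
    rw [withDensity_apply _ hs, Measure.restrict_restrict hs]
  have hac : ν ≪ (μHE[d - 1] : Measure (E d)) := by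
    intro s hs
    rw [hν, Measure.finsetSum_apply]
    exact Finset.sum_eq_zero fun i _ => ((withDensity_absolutelyContinuous _ _).trans
      Measure.restrict_le_self.absolutelyContinuous) hs
  have hR : ν (⋃ i, T.side i)ᶜ = 0 := by
    rw [hνs _ (MeasurableSet.iUnion fun i => measurableSet_side i).compl]
    refine Finset.sum_eq_zero fun i _ => setLIntegral_measure_zero _ _ ?_
    have : (⋃ i, T.side i)ᶜ ∩ T.side i = ∅ := by
      ext x
      simp only [mem_inter_iff, mem_compl_iff, mem_iUnion, not_exists, mem_empty_iff_false, iff_false,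
        not_and]
      exact fun hx => hx i
    rw [this, measure_empty]
  have hνT : ∀ k, ν (T.side k) = ENNReal.ofReal (∫ x in T.side k, J k x ^ 2 ∂(μHE[d - 1])) := by
    intro k
    rw [ofReal_integral_sq (hV.memLp_jumpRes h.isPartition hT k), hνs _ (measurableSet_side k),
      Finset.sum_eq_single_of_mem k (Finset.mem_univ _), inter_self]
    exact fun i _ hi => setLIntegral_measure_zero _ _ (measure_side_inter_side hTn hi.symm)
  have hνT' : ∀ T' ∈ 𝒯', T'.body ⊆ T.body → ∀ k,
      ENNReal.ofReal (∫ x in T'.side k, jumpRes α 𝒯' V T' k x ^ 2 ∂(μHE[d - 1])) ≤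
        ν (T'.side k) := by
    intro T' hT' hsub k
    rcases h.jumpRes_refinement h' hr (fun S hS => hV.hasTrace hS) hT hT' hsub k with h0 | ⟨i, hi, e⟩
    · have : ∫ x in T'.side k, jumpRes α 𝒯' V T' k x ^ 2 ∂(μHE[d - 1]) = 0 :=
        setIntegral_eq_zero_of_forall_eq_zero fun x hx => by rw [h0 x hx]; simp
      rw [this, ENNReal.ofReal_zero]
      exact zero_le
    · rw [setIntegral_congr_fun (measurableSet_side k) e, ofReal_integral_sq
        ((hV.memLp_jumpRes h.isPartition hT i).mono_measure (Measure.restrict_mono_set _ hi)),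
        hνs _ (measurableSet_side k)]
      have := Finset.single_le_sum (f := fun i =>
        ∫⁻ x in T'.side k ∩ T.side i, ENNReal.ofReal (J i x ^ 2) ∂(μHE[d - 1]))
        (fun _ _ => zero_le) (Finset.mem_univ i)
      rwa [inter_eq_left.2 hi] at this
  have key := sum_descendants_le h.isPartition hr hT (fun S => ∑ k, ν (S.side k)) fun k S hS =>
    measure_side_children_le (hS.affineIndependent hTn) hTn (hS.body_subset hTn) ν hac hR
  have hnn : ∀ (S : TaggedSimplex d) (a : Fin (d + 1) → E d → ℝ) (k : Fin (d + 1)),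
      0 ≤ ∫ x in S.side k, a k x ^ 2 ∂(μHE[d - 1]) :=
    fun S a k => integral_nonneg fun x => sq_nonneg _
  refine (ENNReal.ofReal_le_ofReal_iff (Finset.sum_nonneg fun k _ => hnn T J k)).1 ?_
  rw [ENNReal.ofReal_sum_of_nonneg fun S _ => Finset.sum_nonneg fun k _ => hnn S _ k,
    ENNReal.ofReal_sum_of_nonneg fun k _ => hnn T J k]
  simp_rw [← hνT]
  refine (Finset.sum_le_sum fun S hS => ?_).trans key
  rw [ENNReal.ofReal_sum_of_nonneg fun k _ => hnn S _ k]
  obtain ⟨hS', k, hk⟩ := mem_descendants.1 hS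
  exact Finset.sum_le_sum fun i _ => hνT' S hS' (hk.body_subset hTn) i

theorem etaSqLoc_nonneg : 0 ≤ etaSqLoc α f 𝒯 V T := by
  have := T.size_nonneg
  have h1 : 0 ≤ ∫ x in T.body, elemRes α f V x ^ 2 := integral_nonneg fun x => sq_nonneg _
  have h2 : 0 ≤ ∑ i, ∫ x in T.side i, jumpRes α 𝒯 V T i x ^ 2 ∂(μHE[d - 1]) :=
    Finset.sum_nonneg fun i _ => integral_nonneg fun x => sq_nonneg _
  rw [etaSqLoc]
  positivity

/-- The element part even gains `ρ²`; the jump part, weighted by the first power of the size, limits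
the gain to `ρ`. -/
theorem IsAdapted.sum_etaSqLoc_descendants_le (hV : IsAdapted α f C L 𝒯 V G)
    (h : IsTriangulation Ω 𝒯) (h' : IsTriangulation Ω 𝒯') (hr : IsRefinement 𝒯 𝒯') (hT : T ∈ 𝒯)
    {ρ : ℝ} (hρ : 0 ≤ ρ) (hρ1 : ρ ≤ 1) (hsize : ∀ T' ∈ descendants 𝒯' T, T'.size ≤ ρ * T.size) :
    ∑ T' ∈ descendants 𝒯' T, etaSqLoc α f 𝒯' V T' ≤ ρ * etaSqLoc α f 𝒯 V T := by
  have hs := T.size_nonneg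
  have h1 := hV.sum_integral_elemRes_le h.isPartition hr hT
  have h2 := hV.sum_integral_jumpRes_le h h' hr hT
  have hA : 0 ≤ ∫ x in T.body, elemRes α f V x ^ 2 := integral_nonneg fun x => sq_nonneg _
  simp_rw [etaSqLoc]
  rw [Finset.sum_add_distrib, mul_add]
  refine add_le_add ?_ ?_
  · calc _ ≤ ∑ T' ∈ descendants 𝒯' T,
          (ρ * T.size) ^ 2 * ∫ x in T'.body, elemRes α f V x ^ 2 :=
          Finset.sum_le_sum fun S hS => mul_le_mul_of_nonneg_right
            (pow_le_pow_left₀ S.size_nonneg (hsize S hS) 2) (integral_nonneg fun x => sq_nonneg _)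
      _ ≤ (ρ * T.size) ^ 2 * ∫ x in T.body, elemRes α f V x ^ 2 := by
          rw [← Finset.mul_sum]; gcongr
      _ = ρ * (ρ * (T.size ^ 2 * ∫ x in T.body, elemRes α f V x ^ 2)) := by ring
      _ ≤ ρ * (1 * (T.size ^ 2 * ∫ x in T.body, elemRes α f V x ^ 2)) := by gcongr
      _ = _ := by rw [one_mul]
  · calc _ ≤ ∑ T' ∈ descendants 𝒯' T, (ρ * T.size) *
          ∑ k, ∫ x in T'.side k, jumpRes α 𝒯' V T' k x ^ 2 ∂(μHE[d - 1]) :=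
          Finset.sum_le_sum fun S hS => mul_le_mul_of_nonneg_right (hsize S hS)
            (Finset.sum_nonneg fun k _ => integral_nonneg fun x => sq_nonneg _)
      _ ≤ (ρ * T.size) * ∑ k, ∫ x in T.side k, jumpRes α 𝒯 V T k x ^ 2 ∂(μHE[d - 1]) := by
          rw [← Finset.mul_sum]; gcongr
      _ = _ := by ring

/-- Marked elements contribute with the factor `q`, all others with the factor one, since sizes
never increase. -/
theorem IsAdapted.etaSq_le_of_bisectsAtLeast (hV : IsAdapted α f C L 𝒯 V G)
    (h : IsTriangulation Ω 𝒯) (h' : IsTriangulation Ω 𝒯') {ℳ : Mesh d} (hℳ : ℳ ⊆ 𝒯) {n : ℕ}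
    (hb : BisectsAtLeast n 𝒯 ℳ 𝒯') :
    etaSq α f 𝒯' V 𝒯' ≤ etaSq α f 𝒯 V 𝒯 -
      (1 - (2 : ℝ) ^ (-(n : ℝ) / (d : ℝ))) * etaSq α f 𝒯 V ℳ := by
  set q : ℝ := (2 : ℝ) ^ (-(n : ℝ) / (d : ℝ)) with hq
  have hexp : ∀ m k : ℕ, m ≤ k → (2 : ℝ) ^ (-(k : ℝ) / (d : ℝ)) ≤ 2 ^ (-(m : ℝ) / (d : ℝ)) :=
    fun m k hmk => Real.rpow_le_rpow_of_exponent_le one_le_two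
      (div_le_div_of_nonneg_right (neg_le_neg (Nat.cast_le.2 hmk)) (Nat.cast_nonneg _))
  have hzero : (2 : ℝ) ^ (-((0 : ℕ) : ℝ) / (d : ℝ)) = 1 := by simp
  have hq0 : 0 ≤ q := by positivity
  have hq1 : q ≤ 1 := (hexp 0 n (Nat.zero_le _)).trans_eq hzero
  have hin : ∀ T ∈ ℳ, ∑ T' ∈ descendants 𝒯' T, etaSqLoc α f 𝒯' V T' ≤
      q * etaSqLoc α f 𝒯 V T := by
    intro T hT
    refine hV.sum_etaSqLoc_descendants_le h h' hb.1 (hℳ hT) hq0 hq1 fun S hS => ?_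
    obtain ⟨hS', k, hk⟩ := mem_descendants.1 hS
    rw [hk.size_eq (h.nondegenerate T (hℳ hT))]
    exact mul_le_mul_of_nonneg_right (hexp n k (hb.2 T hT S hS' k hk)) T.size_nonneg
  have hout : ∀ T ∈ 𝒯 \ ℳ, ∑ T' ∈ descendants 𝒯' T, etaSqLoc α f 𝒯' V T' ≤
      etaSqLoc α f 𝒯 V T := by
    intro T hT
    have hT' := (Finset.mem_sdiff.1 hT).1
    refine (hV.sum_etaSqLoc_descendants_le h h' hb.1 hT' zero_le_one le_rfl
      fun S hS => ?_).trans_eq (one_mul _)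
    obtain ⟨_, k, hk⟩ := mem_descendants.1 hS
    rw [hk.size_eq (h.nondegenerate T hT')]
    exact mul_le_mul_of_nonneg_right ((hexp 0 k (Nat.zero_le _)).trans_eq hzero) T.size_nonneg
  have hsum := sum_le_sum_descendants hb.1 (etaSqLoc α f 𝒯' V) fun T => etaSqLoc_nonneg
  have h1 := Finset.sum_le_sum hin
  have h2 := Finset.sum_le_sum hout
  rw [← Finset.mul_sum] at h1
  rw [← Finset.sum_sdiff hℳ] at hsum
  have h3 := Finset.sum_sdiff (f := etaSqLoc α f 𝒯 V) hℳ
  simp only [etaSq]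
  linarith

end Reduction

/-! ### Finite element functions -/

section FiniteElements

variable {α : E d → ℝ → ℝ} {f : E d → ℝ} {C : ℝ} {L : ℝ≥0} {Ω : Set (E d)} {𝒯₀ 𝒯 𝒯' : Mesh d}
  {V W : E d → ℝ} {G H : TaggedSimplex d → E d} {T : TaggedSimplex d}

/-- The gradients are constant on the elements, so the elementwise bounds add up exactly to the
energy distance. -/
theorem IsAdapted.gradNormSq_sub (hV : IsAdapted α f C L 𝒯 V G) (hW : IsAdapted α f C L 𝒯 W H)
    (h : IsPartition Ω 𝒯) (hΩ : IsBoundedLipschitzDomain Ω) :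
    gradNormSq Ω (fun x => V x - W x) =
      ∑ T ∈ 𝒯, ‖G T - H T‖ ^ 2 * (volume T.body).toReal := by
  have e : ∀ T ∈ 𝒯, ∀ x ∈ interior T.body,
      ‖gradient (fun x => V x - W x) x‖ ^ 2 = ‖G T - H T‖ ^ 2 := fun T hT x hx => by
    rw [(hV.grad T hT).gradient_sub_eq (hW.grad T hT) hx]
  have hvol : ∀ T : TaggedSimplex d, volume (interior T.body) = volume T.body :=
    fun T => (measure_congr body_ae_eq_interior).symm
  rw [gradNormSq, h.setIntegral_eq_sum hΩ]
  · refine Finset.sum_congr rfl fun T hT => ?_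
    rw [setIntegral_congr_fun isOpen_interior.measurableSet (e T hT), setIntegral_const,
      measureReal_def, hvol, smul_eq_mul, mul_comm]
  · intro T hT
    rw [integrableOn_congr_fun (e T hT) isOpen_interior.measurableSet]
    exact integrableOn_const (by rw [hvol]; exact volume_body_lt_top.ne)

theorem exists_isAdapted (h₀ : IsPartition Ω 𝒯₀)
    (hα : ∀ T ∈ 𝒯₀, IsRegularOn α C L (interior T.body)) (hΩ : IsBoundedLipschitzDomain Ω)
    (hf : MemLp f 2 (volume.restrict Ω)) (hr : IsRefinement 𝒯₀ 𝒯) (hV : V ∈ FESpace Ω 𝒯) :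
    ∃ G, IsAdapted α f C L 𝒯 V G := by
  have hex : ∀ T : TaggedSimplex d, ∃ g, T ∈ 𝒯 → HasConstGradient V T g := by
    intro T
    by_cases hT : T ∈ 𝒯
    · obtain ⟨A, hA⟩ := hV.2 T hT
      obtain ⟨g, hg⟩ := exists_hasConstGradient hA
      exact ⟨g, fun _ => hg⟩
    · exact ⟨0, fun h => absurd h hT⟩
  choose G hG using hex
  refine ⟨G, fun T hT => ?_, fun T hT => hf.mono_measure
    (Measure.restrict_mono_set _ ((h₀.refinement hr).interior_subset hΩ hT)), hG⟩
  obtain ⟨S, hS, k, hk⟩ := hr.exists_ancestor T hT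
  exact (hα S hS).mono isOpen_interior
    (interior_mono (hk.body_subset (h₀.nondegenerate S hS)))

theorem mem_FESpace_of_isRefinement (h : IsPartition Ω 𝒯) (hr : IsRefinement 𝒯 𝒯')
    (hV : V ∈ FESpace Ω 𝒯) : V ∈ FESpace Ω 𝒯' := by
  refine ⟨hV.1, fun T' hT' => ?_⟩
  obtain ⟨T, hT, k, hk⟩ := hr.exists_ancestor T' hT'
  obtain ⟨A, hA⟩ := hV.2 T hT
  exact ⟨A, fun x hx => hA x (hk.body_subset (h.nondegenerate T hT) hx)⟩

/-- The element residual does not refer to the mesh, and the jumps agree on every side by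
`IsTriangulation.jumpRes_eq_of_mem_inter`. -/
theorem IsAdapted.oscSqLoc_eq (hV : IsAdapted α f C L 𝒯 V G) (h : IsTriangulation Ω 𝒯)
    (h' : IsTriangulation Ω 𝒯') (hr : IsRefinement 𝒯 𝒯') (hT : T ∈ 𝒯) (hT' : T ∈ 𝒯') :
    oscSqLoc α f 𝒯 V T = oscSqLoc α f 𝒯' V T := by
  have e : ∀ i, ∀ x ∈ T.side i, jumpRes α 𝒯 V T i x = jumpRes α 𝒯' V T i x := fun i x hx =>
    h.jumpRes_eq_of_mem_inter h' hr (fun S hS => hV.hasTrace hS) hT hT' i hx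
  have eavg : ∀ i, ⨍ y in T.side i, jumpRes α 𝒯 V T i y ∂(μHE[d - 1]) =
      ⨍ y in T.side i, jumpRes α 𝒯' V T i y ∂(μHE[d - 1]) := fun i => by
    rw [setAverage_eq, setAverage_eq, setIntegral_congr_fun (measurableSet_side i) (e i)]
  rw [oscSqLoc, oscSqLoc]
  congr 2
  refine Finset.sum_congr rfl fun i _ => setIntegral_congr_fun (measurableSet_side i)
    fun x hx => ?_
  simp only [e i x hx, eavg i]

theorem resDist_nonneg : 0 ≤ resDist α f 𝒯 V W T := by
  have := T.size_nonneg
  have h1 : 0 ≤ ∫ x in T.body, (elemRes α f V x - elemRes α f W x) ^ 2 :=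
    integral_nonneg fun x => sq_nonneg _
  have h2 : 0 ≤ ∑ i, ∫ x in T.side i, (jumpRes α 𝒯 V T i x - jumpRes α 𝒯 W T i x) ^ 2
      ∂(μHE[d - 1]) := Finset.sum_nonneg fun i _ => integral_nonneg fun x => sq_nonneg _
  rw [resDist]
  positivity

theorem IsPartition.size_le (hd : 0 < d) (h : IsPartition Ω 𝒯) (hΩ : IsBoundedLipschitzDomain Ω)
    (hT : T ∈ 𝒯) : T.size ≤ unitBallVol d ^ (1 / (d : ℝ)) * Metric.diam Ω := by
  have hdiam : Metric.diam T.body ≤ Metric.diam Ω := by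
    rw [← Metric.diam_closure Ω]
    exact Metric.diam_mono (h.body_subset hT) hΩ.isBounded.closure
  refine (size_le_diam hd).trans (mul_le_mul_of_nonneg_left hdiam (Real.rpow_nonneg ?_ _))
  exact ENNReal.toReal_nonneg

theorem IsAdmissibleCoefficient.const_le {c_a C_a : ℝ} (h : IsAdmissibleCoefficient Ω α c_a C_a)
    (hΩ : Ω.Nonempty) : c_a ≤ C_a := by
  obtain ⟨x, hx⟩ := hΩ
  exact ((h x hx).2 1 one_pos).1.trans ((h x hx).2 1 one_pos).2

end FiniteElements

end AFEM

/-! ### Estimator reduction and oscillation perturbation -/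

open AFEM
theorem propositionP {d : ℕ} (hd : d = 2 ∨ d = 3)
    (Ω : Set (E d)) (hΩ : IsBoundedLipschitzDomain Ω)
    (α : E d → ℝ → ℝ) (c_a C_a : ℝ) (hc_a : 0 < c_a)
    (hα : IsAdmissibleCoefficient Ω α c_a C_a)
    (f : E d → ℝ) (hf : MemLp f 2 (volume.restrict Ω))
    (L : ℝ≥0) (κ : ℝ≥0∞) :
    ∃ C_E : ℝ, 1 < C_E ∧
      ∀ 𝒯₀ : Mesh d, IsInitialMesh Ω 𝒯₀ → IsPiecewiseLipschitz α 𝒯₀ L → shapeConst 𝒯₀ = κ →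
        (∀ 𝒯 ∈ Family 𝒯₀, ∀ ℳ ⊆ 𝒯, ∀ n : ℕ, 1 ≤ n →
          ∀ 𝒯s ∈ Family 𝒯₀, BisectsAtLeast n 𝒯 ℳ 𝒯s →
          ∀ V ∈ FESpace Ω 𝒯, ∀ Vs ∈ FESpace Ω 𝒯s, ∀ δ : ℝ, 0 < δ →
            etaSq α f 𝒯s Vs 𝒯s ≤
              (1 + δ) * (etaSq α f 𝒯 V 𝒯
                - (1 - (2 : ℝ) ^ (-(n : ℝ) / (d : ℝ))) * etaSq α f 𝒯 V ℳ)
              + (1 + δ⁻¹) * C_E * gradNormSq Ω (fun x => Vs x - V x)) ∧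
        (∀ 𝒯 ∈ Family 𝒯₀, ∀ 𝒯s ∈ Family 𝒯₀, IsRefinement 𝒯 𝒯s →
          ∀ V ∈ FESpace Ω 𝒯, ∀ Vs ∈ FESpace Ω 𝒯s,
            oscSq α f 𝒯 V (𝒯 ∩ 𝒯s) ≤
              2 * oscSq α f 𝒯s Vs (𝒯 ∩ 𝒯s)
              + 2 * C_E * gradNormSq Ω (fun x => Vs x - V x)) := by
  have hd2 : 2 ≤ d := by omega
  have hC : 0 ≤ C_a := hc_a.le.trans (hα.const_le hΩ.isConnected.nonempty)
  set h₀ : ℝ := TaggedSimplex.unitBallVol d ^ (1 / (d : ℝ)) * Metric.diam Ω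
  set K : ℝ := h₀ ^ 2 * (3 * d * L) ^ 2 + 4 * (d + 1) * C_a ^ 2 * TaggedSimplex.sideConst d κ.toReal with hK
  have hK0 : 0 ≤ K := by
    have := TaggedSimplex.sideConst_nonneg (d := d) κ.toReal_nonneg
    positivity
  -- The summand two makes the constant exceed one for all data. It is fixed before the initial
  -- mesh, which enters through `κ` only.
  refine ⟨2 + K, by linarith, fun 𝒯₀ h𝒯₀ hL hκ => ?_⟩
  have hpart := h𝒯₀.1.isPartition
  have hreg : ∀ T ∈ 𝒯₀, IsRegularOn α C_a L (interior T.body) := fun T hT =>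
    hα.isRegularOn hc_a hC hL hT (hpart.interior_subset hΩ hT)
  have hgn : ∀ v : E d → ℝ, 0 ≤ gradNormSq Ω v := fun v => integral_nonneg fun x => sq_nonneg _
  have hdist : ∀ 𝒯s ∈ Family 𝒯₀, ∀ {V W : E d → ℝ} {G H : TaggedSimplex d → E d},
      IsAdapted α f C_a L 𝒯s V G → IsAdapted α f C_a L 𝒯s W H →
      ∑ T ∈ 𝒯s, resDist α f 𝒯s V W T ≤ (2 + K) * gradNormSq Ω (fun x => V x - W x) := by
    intro 𝒯s h𝒯s V W G H hV hW
    have hs := (h𝒯₀.1.of_mem_family h𝒯s).isPartition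
    have h1 := sum_resDist_le hd2 hV hW hs κ.toReal_nonneg
      (fun T hT => hκ ▸ diam_le_shapeConst_mul hd h𝒯₀.1 h𝒯s hT)
      (fun T hT => hs.size_le (by omega) hΩ hT)
    rw [← hV.gradNormSq_sub hW hs hΩ] at h1
    have := hgn fun x => V x - W x
    linarith
  refine ⟨fun 𝒯 h𝒯 ℳ hℳ n _ 𝒯s h𝒯s hb V hV Vs hVs δ hδ => ?_,
    fun 𝒯 h𝒯 𝒯s h𝒯s hr V hV Vs hVs => ?_⟩
  · have h := h𝒯₀.1.of_mem_family h𝒯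
    have hs := h𝒯₀.1.of_mem_family h𝒯s
    obtain ⟨G, hG⟩ := exists_isAdapted hpart hreg hΩ hf h𝒯.1 hV
    -- The coarse function is now regarded as an element of the fine space.
    obtain ⟨G', hG'⟩ := exists_isAdapted hpart hreg hΩ hf h𝒯s.1
      (mem_FESpace_of_isRefinement h.isPartition hb.1 hV)
    obtain ⟨H, hH⟩ := exists_isAdapted hpart hreg hΩ hf h𝒯s.1 hVs
    have h1 : etaSq α f 𝒯s Vs 𝒯s ≤ (1 + δ) * etaSq α f 𝒯s V 𝒯s +
        (1 + δ⁻¹) * ∑ T ∈ 𝒯s, resDist α f 𝒯s Vs V T := by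
      rw [etaSq, etaSq, Finset.mul_sum, Finset.mul_sum, ← Finset.sum_add_distrib]
      exact Finset.sum_le_sum fun T hT => etaSqLoc_le hH hG' hs.isPartition hT hδ
    have h2 := mul_le_mul_of_nonneg_left (hG.etaSq_le_of_bisectsAtLeast h hs hℳ hb)
      (by positivity : 0 ≤ 1 + δ)
    have h3 := mul_le_mul_of_nonneg_left (hdist 𝒯s h𝒯s hH hG') (by positivity : 0 ≤ 1 + δ⁻¹)
    rw [← mul_assoc] at h3
    exact h1.trans (add_le_add h2 h3)
  · have h := h𝒯₀.1.of_mem_family h𝒯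
    have hs := h𝒯₀.1.of_mem_family h𝒯s
    obtain ⟨G, hG⟩ := exists_isAdapted hpart hreg hΩ hf h𝒯.1 hV
    obtain ⟨G', hG'⟩ := exists_isAdapted hpart hreg hΩ hf h𝒯s.1
      (mem_FESpace_of_isRefinement h.isPartition hr hV)
    obtain ⟨H, hH⟩ := exists_isAdapted hpart hreg hΩ hf h𝒯s.1 hVs
    have h1 : oscSq α f 𝒯 V (𝒯 ∩ 𝒯s) ≤ 2 * oscSq α f 𝒯s Vs (𝒯 ∩ 𝒯s) +
        2 * ∑ T ∈ 𝒯 ∩ 𝒯s, resDist α f 𝒯s V Vs T := by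
      rw [oscSq, oscSq, Finset.mul_sum, Finset.mul_sum, ← Finset.sum_add_distrib]
      refine Finset.sum_le_sum fun T hT => ?_
      obtain ⟨hT1, hT2⟩ := Finset.mem_inter.1 hT
      -- On common elements the coarse oscillation may be computed in the fine mesh, where both
      -- functions can be compared.
      rw [hG.oscSqLoc_eq h hs hr hT1 hT2]
      exact oscSqLoc_le hG' hH hs.isPartition hT2
    have h2 : ∑ T ∈ 𝒯 ∩ 𝒯s, resDist α f 𝒯s V Vs T ≤ ∑ T ∈ 𝒯s, resDist α f 𝒯s V Vs T :=
      Finset.sum_le_sum_of_subset_of_nonneg Finset.inter_subset_right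
        fun T _ _ => resDist_nonneg
    have h3 := hdist 𝒯s h𝒯s hG' hH
    have hswap : gradNormSq Ω (fun x => V x - Vs x) = gradNormSq Ω (fun x => Vs x - V x) := by
      rw [hG'.gradNormSq_sub hH hs.isPartition hΩ, hH.gradNormSq_sub hG' hs.isPartition hΩ]
      simp_rw [norm_sub_rev]
    rw [hswap] at h3
    linarith
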